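/- Let $c_1,c_2,\ldots$ be commuting variables, $c_0:=1$, $c_p:=0$ for $p<0$, and let $\Gamma$ be the quotient of $\mathbb Z[c_1,c_2,\ldots]$ by the relations $c_p^2+2\sum_{i=1}^p(-1)^ic_{p+i}c_{p-i}=0$ for all $p\ge 1$. Let $X=(x_1,x_2,\ldots)$ and $Y=(y_1,y_2,\ldots)$ be commuting independent variables and $X_n=(x_1,\ldots,x_n)$. Let $W_n$ be the group of signed permutations of $\{1,\ldots,n\}$ and $W_\infty=\bigcup_n W_n$, where $W_n\subset W_{n+1}$ by adjoining the fixed point $n+1$. The group $W_\infty$ is generated by the sign change $s_0$ ($1\mapsto\overline 1$) and the transpositions $s_i=(i,i+1)$, $i\ge 1$; $\ell(w)$ is the least length of a word in the $s_i$ with product $w$. Let $s_i$ act on $\Gamma[X,Y]$ by ring automorphisms: for $i\ge1$, $s_i$ interchanges $x_i$ and $x_{i+1}$ and fixes all other variables and all $c_p$; $s_0$ maps $x_1$ to $-x_1$, fixes $x_j$ for $j\ge 2$ and all $y_j$, and $s_0(c_p)=c_p+2\sum_{j=1}^p x_1^jc_{p-j}$ for $p\ge 1$. Define $$\partial_0f=\frac{f-s_0f}{-2x_1},\qquad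 \partial_if=\frac{f-s_if}{x_i-x_{i+1}}\quad(i\ge 1),$$ let $\omega$ be the ring involution of $\Gamma[X,Y]$ with $\omega(x_j)=-y_j$, $\omega(y_j)=-x_j$, $\omega(c_p)=c_p$, and set $\partial_i^y=\omega\partial_i\omega$. For $w\in W_\infty$ put $\partial_w=\partial_{i_1}\circ\cdots\circ\partial_{i_\ell}$ for any reduced word $w=s_{i_1}\cdots s_{i_\ell}$, $\ell=\ell(w)$. The type C double Schubert polynomials $\mathfrak C_w(X,Y)$, $w\in W_\infty$, are the unique family of elements of $\Gamma[X,Y]$ such that, for all $i\ge 0$ and $w\in W_\infty$, $\partial_i\mathfrak C_w=\mathfrak C_{ws_i}$ if $\ell(ws_i)<\ell(w)$ and $\partial_i\mathfrak C_w=0$ otherwise, $\partial_i^y\mathfrak C_w=\mathfrak C_{s_iw}$ if $\ell(s_iw)<\ell(w)$ and $\partial_i^y\mathfrak C_w=0$ otherwise, and the constant term of $\mathfrak C_w$ is $1$ if $w=1$ and $0$ otherwise. Let $\mathfrak C_w:=\mathfrak C_w(X,0)$ denote the single Schubert polynomials. Let $n\ge 0$, let $w_0=[\overline 1,\ldots,\overline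 n]$ be the longest element of $W_n$, and let $\Gamma^{(n)}=\mathbb Z[{}^nc_1,{}^nc_2,\ldots]\subset\Gamma[X_n]$, where ${}^nc_p=\sum_{j=0}^pc_{p-j}e_j(X_n)$ and $e_j$ is the $j$-th elementary symmetric polynomial. For $f,g\in\Gamma[X_n]$ let $\langle f,g\rangle:=\partial_{w_0}(fg)$. Then: 1. $\langle f,g\rangle\in\Gamma^{(n)}$ for all $f,g\in\Gamma[X_n]$, and $\mathfrak C_w\in\Gamma[X_n]$ for all $w\in W_n$. 2. For all $u,v\in W_n$ with $\ell(u)+\ell(v)=n^2$, $$\langle\mathfrak C_u,\mathfrak C_v\rangle=\begin{cases}1&\text{if }v=w_0u,\\0&\text{otherwise.}\end{cases}$$ -/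

import Mathlib

noncomputable section

namespace SchubertC

/-! ## Signed permutations -/

/-- The group `W_∞`: finitely supported signed permutations, realised as the permutations `w`
of `ℤ` with `w (-i) = - w i` (so `w 0 = 0`) that move only finitely many integers. -/
def Winf : Subgroup (Equiv.Perm ℤ) where
  carrier := {w | (∀ i, w (-i) = -w i) ∧ {i | w i ≠ i}.Finite}
  one_mem' := by simp
  mul_mem' := by
    rintro a b ⟨ha, ha'⟩ ⟨hb, hb'⟩
    refine ⟨fun i => by simp [ha, hb], (ha'.union hb').subset ?_⟩
    intro i hi
    by_contra h
    simp only [Set.mem_union, Set.mem_ofPred_eq, not_or, not_not] at h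
    exact hi (by simp [h.1, h.2])
  inv_mem' := by
    rintro a ⟨ha, ha'⟩
    refine ⟨fun i => ?_, ha'.subset ?_⟩
    · rw [Equiv.Perm.inv_eq_iff_eq, ha]
      simp
    · intro i hi h
      exact hi (Equiv.Perm.inv_eq_iff_eq.2 h.symm)

/-- The subgroup `W_n` of `W_∞`: signed permutations of `{1, …, n}`, extended by fixed points. -/
def W (n : ℕ) : Subgroup Winf where
  carrier := {w | ∀ i : ℤ, (n : ℤ) < |i| → w.1 i = i}
  one_mem' := by simp
  mul_mem' := by
    intro a b ha hb i hi
    simp only [Subgroup.coe_mul, Equiv.Perm.coe_mul, Function.comp_apply]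
    rw [hb i hi, ha i hi]
  inv_mem' := by
    intro a ha i hi
    simp only [InvMemClass.coe_inv]
    exact Equiv.Perm.inv_eq_iff_eq.2 (ha i hi).symm

/-- The simple reflections: `s 0` is the sign change `1 ↦ -1`, and `s i` for `i ≥ 1` is the
transposition `(i, i+1)`, extended to negative integers by oddness. -/
def s : ℕ → Winf
  | 0 => ⟨Equiv.swap 1 (-1), by
      refine ⟨fun i => ?_, (Set.toFinite {(1 : ℤ), -1}).subset ?_⟩
      · simp only [Equiv.swap_apply_def]
        split_ifs <;> omega
      · intro i hi
        by_contra h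
        simp only [Set.mem_insert_iff, Set.mem_singleton_iff, not_or] at h
        exact hi (Equiv.swap_apply_of_ne_of_ne h.1 h.2)⟩
  | k + 1 => ⟨Equiv.swap ((k : ℤ) + 1) (k + 2) * Equiv.swap (-((k : ℤ) + 1)) (-(k + 2)), by
      refine ⟨fun i => ?_, (Set.toFinite
        {(k : ℤ) + 1, (k : ℤ) + 2, -((k : ℤ) + 1), -((k : ℤ) + 2)}).subset ?_⟩
      · simp only [Equiv.Perm.coe_mul, Function.comp_apply, Equiv.swap_apply_def]
        split_ifs <;> omega
      · intro i hi
        by_contra h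
        simp only [Set.mem_insert_iff, Set.mem_singleton_iff, not_or] at h
        obtain ⟨h1, h2, h3, h4⟩ := h
        apply hi
        simp only [Equiv.Perm.coe_mul, Function.comp_apply]
        rw [Equiv.swap_apply_of_ne_of_ne h3 h4, Equiv.swap_apply_of_ne_of_ne h1 h2]⟩

/-- The length `ℓ(w)`: the least length of a word in the simple reflections with product `w`. -/
def length (w : Winf) : ℕ :=
  sInf {k | ∃ a : List ℕ, a.length = k ∧ (a.map s).prod = w}

/-- `a` is a reduced word for `w`. -/
def IsReducedWord (a : List ℕ) (w : Winf) : Prop :=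
  (a.map s).prod = w ∧ a.length = length w

/-- The element `w_0 = [-1, …, -n]`, the longest element of `W_n`. -/
def w0 (n : ℕ) : Winf :=
  ⟨{  toFun := fun i => if |i| ≤ (n : ℤ) then -i else i
      invFun := fun i => if |i| ≤ (n : ℤ) then -i else i
      left_inv := fun i => by by_cases h : |i| ≤ (n : ℤ) <;> simp [h]
      right_inv := fun i => by by_cases h : |i| ≤ (n : ℤ) <;> simp [h] }, by
    refine ⟨fun i => ?_, (Set.finite_Icc (-(n : ℤ)) n).subset ?_⟩
    · simp only [Equiv.coe_fn_mk, abs_neg]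
      split_ifs <;> rfl
    · intro i hi
      by_contra h
      apply hi
      have h' : ¬ |i| ≤ (n : ℤ) := fun h' => h (Set.mem_Icc.2 (abs_le.1 h'))
      simp [h']⟩

/-! ## The ring `Γ` -/

/-- The expression `a_p² + 2 ∑_{i=1}^p (-1)^i a_{p+i} a_{p-i}` of a sequence `a`. -/
def qRel {A : Type*} [CommRing A] (a : ℕ → A) (p : ℕ) : A :=
  a p ^ 2 + 2 * ∑ i ∈ Finset.Icc 1 p, (-1) ^ i * (a (p + i) * a (p - i))

theorem map_qRel {A B : Type*} [CommRing A] [CommRing B] (φ : A →+* B) (a : ℕ → A) (p : ℕ) :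
    φ (qRel a p) = qRel (fun k => φ (a k)) p := by
  simp only [qRel, map_add, map_mul, map_pow, map_sum, map_neg, map_one, map_ofNat]

/-- The free variables `c_p`, with `c_0 = 1`; `c_{k+1}` is the polynomial variable `k`. -/
def cFree : ℕ → MvPolynomial ℕ ℤ
  | 0 => 1
  | k + 1 => MvPolynomial.X k

/-- The ideal of relations of `Γ`. -/
def gammaIdeal : Ideal (MvPolynomial ℕ ℤ) :=
  Ideal.span {r | ∃ p : ℕ, 1 ≤ p ∧ r = qRel cFree p}

/-- The ring `Γ = ℤ[c_1, c_2, …] / (c_p² + 2 ∑_{i=1}^p (-1)^i c_{p+i} c_{p-i}, p ≥ 1)`. -/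
def Gamma : Type := MvPolynomial ℕ ℤ ⧸ gammaIdeal

instance : CommRing Gamma := inferInstanceAs (CommRing (MvPolynomial ℕ ℤ ⧸ gammaIdeal))

/-- The quotient map `ℤ[c_1, c_2, …] → Γ`. -/
def toGamma : MvPolynomial ℕ ℤ →+* Gamma := Ideal.Quotient.mk gammaIdeal

/-- The generators `c_p` of `Γ`, with `c_0 = 1`. -/
def c (p : ℕ) : Gamma := toGamma (cFree p)

theorem qRel_c {p : ℕ} (hp : 1 ≤ p) : qRel c p = 0 := by
  have h := map_qRel toGamma cFree p
  have h' : toGamma (qRel cFree p) = 0 :=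
    Ideal.Quotient.eq_zero_iff_mem.2 (Ideal.subset_span ⟨p, hp, rfl⟩)
  rw [h'] at h
  exact h.symm

/-- The ring homomorphism from `Γ` to `A` given by a sequence `a` with `a 0 = 1` that satisfies
the relations of `Γ`; it maps `c_p` to `a p`. -/
def gammaLift {A : Type*} [CommRing A] (a : ℕ → A) (h0 : a 0 = 1)
    (h : ∀ p, 1 ≤ p → qRel a p = 0) : Gamma →+* A :=
  Ideal.Quotient.lift gammaIdeal
    (MvPolynomial.eval₂Hom (Int.castRingHom A) fun k => a (k + 1)) (by
      have key : gammaIdeal ≤ RingHom.ker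
          (MvPolynomial.eval₂Hom (Int.castRingHom A) fun k => a (k + 1)) := by
        refine Ideal.span_le.2 ?_
        rintro r ⟨p, hp, rfl⟩
        simp only [SetLike.mem_coe, RingHom.mem_ker]
        rw [map_qRel]
        convert h p hp using 2
        funext k
        cases k with
        | zero => simp [cFree, h0]
        | succ k => simp [cFree]
      exact fun r hr => key hr)

/-! ## The ring `Γ[X, Y]`, its automorphisms and divided differences -/

/-- The ring `Γ[X, Y]`; the variable `Sum.inl j` is `x_{j+1}` and `Sum.inr j` is `y_{j+1}`. -/
abbrev GammaXY : Type := MvPolynomial (ℕ ⊕ ℕ) Gamma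

/-- `x j` is the variable `x_{j+1}`. -/
def x (j : ℕ) : GammaXY := MvPolynomial.X (Sum.inl j)

/-- `y j` is the variable `y_{j+1}`. -/
def y (j : ℕ) : GammaXY := MvPolynomial.X (Sum.inr j)

/-- `s_0(c_p) = c_p + 2 ∑_{j=1}^p x_1^j c_{p-j}`. -/
def s0c (p : ℕ) : GammaXY :=
  MvPolynomial.C (c p) +
    2 * ∑ j ∈ Finset.Icc 1 p, x 0 ^ j * MvPolynomial.C (c (p - j))

theorem s0c_zero : s0c 0 = 1 := by
  simp [s0c, c, cFree]

open PowerSeries in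
theorem qRel_eq_zero_iff {A : Type*} [CommRing A] (a : ℕ → A) (h0 : a 0 = 1) :
    (∀ p, 1 ≤ p → qRel a p = 0) ↔
      PowerSeries.mk a * evalNegHom (PowerSeries.mk a) = 1 := by
  have hco : ∀ m, coeff m (PowerSeries.mk a * evalNegHom (PowerSeries.mk a)) =
      ∑ ij ∈ Finset.HasAntidiagonal.antidiagonal m, (-1) ^ ij.2 * (a ij.1 * a ij.2) := by
    intro m
    rw [coeff_mul]
    refine Finset.sum_congr rfl fun ij _ => ?_
    simp only [evalNegHom, coeff_rescale, coeff_mk]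
    ring
  have hodd : ∀ m, Odd m →
      ∑ ij ∈ Finset.HasAntidiagonal.antidiagonal m, (-1) ^ ij.2 * (a ij.1 * a ij.2) = 0 := by
    intro m hm
    refine Finset.sum_involution (fun ij _ => ij.swap) ?_ ?_ ?_ ?_
    · rintro ⟨i, j⟩ hij
      rw [Finset.HasAntidiagonal.mem_antidiagonal] at hij
      dsimp only at hij
      subst hij
      simp only [Prod.fst_swap, Prod.snd_swap]
      rcases Nat.even_or_odd i with hi | hi
      · have hj : Odd j := (Nat.odd_add.1 (by rwa [add_comm] at hm)).2 hi
        rw [hi.neg_one_pow, hj.neg_one_pow]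
        ring
      · have hj : Even j := (Nat.odd_add.1 hm).1 hi
        rw [hi.neg_one_pow, hj.neg_one_pow]
        ring
    · rintro ⟨i, j⟩ hij _ h
      rw [Finset.HasAntidiagonal.mem_antidiagonal] at hij
      dsimp only at hij
      simp only [Prod.swap_prod_mk, Prod.mk.injEq] at h
      obtain ⟨h1, -⟩ := h
      subst h1
      subst hij
      exact (Nat.not_even_iff_odd.2 hm) ⟨_, rfl⟩
    · rintro ⟨i, j⟩ hij
      rw [Finset.HasAntidiagonal.mem_antidiagonal] at hij ⊢
      simpa [add_comm] using hij
    · rintro ⟨i, j⟩ hij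
      rfl
  have heven : ∀ p,
      ∑ ij ∈ Finset.HasAntidiagonal.antidiagonal (2 * p), (-1) ^ ij.2 * (a ij.1 * a ij.2) =
        (-1) ^ p * qRel a p := by
    intro p
    rw [Finset.Nat.sum_antidiagonal_eq_sum_range_succ_mk]
    have hsplit : ∀ g : ℕ → A, ∑ k ∈ Finset.range (2 * p + 1), g k =
        g p + ∑ i ∈ Finset.Icc 1 p, (g (p - i) + g (p + i)) := by
      intro g
      have e1 : ∑ i ∈ Finset.Icc 1 p, g (p - i) = ∑ k ∈ Finset.range p, g k := by
        refine Finset.sum_bij' (fun i _ => p - i) (fun k _ => p - k) ?_ ?_ ?_ ?_ ?_ <;>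
          simp only [Finset.mem_Icc, Finset.mem_range]
        · intros; omega
        · intros; omega
        · intros; omega
        · intros; omega
        · intros; trivial
      have e2 : ∑ i ∈ Finset.Icc 1 p, g (p + i) =
          ∑ k ∈ Finset.range p, g (p + 1 + k) := by
        refine Finset.sum_bij' (fun i _ => i - 1) (fun k _ => k + 1) ?_ ?_ ?_ ?_ ?_ <;>
          simp only [Finset.mem_Icc, Finset.mem_range]
        · intros; omega
        · intros; omega
        · intros; omega
        · intros; omega
        · intro i hi
          congr 1
          omega
      rw [Finset.sum_add_distrib, e1, e2,
        show 2 * p + 1 = (p + 1) + p by ring, Finset.sum_range_add,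
        Finset.sum_range_succ]
      ring
    rw [hsplit, qRel, mul_add, mul_left_comm, Finset.mul_sum]
    congr 1
    · rw [show 2 * p - p = p by omega]
      ring
    · rw [Finset.mul_sum]
      refine Finset.sum_congr rfl fun i hi => ?_
      rw [Finset.mem_Icc] at hi
      dsimp only
      rw [show 2 * p - (p - i) = p + i by omega, show 2 * p - (p + i) = p - i by omega]
      have h1 : ((-1 : A)) ^ (p - i) = (-1) ^ (p + i) := by
        rw [show p + i = (p - i) + 2 * i by omega, pow_add, pow_mul]
        simp
      rw [h1, pow_add]
      ring
  constructor
  · intro h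
    ext m
    rw [hco]
    rcases Nat.even_or_odd' m with ⟨p, rfl | rfl⟩
    · rw [heven]
      rcases Nat.eq_zero_or_pos p with rfl | hp
      · simp [qRel, h0]
      · rw [h p hp, coeff_one, if_neg (by omega)]
        simp
    · rw [hodd _ ⟨p, rfl⟩, coeff_one, if_neg (by omega)]
  · intro h p hp
    have h2 := heven p
    rw [← hco, h, coeff_one, if_neg (by omega)] at h2
    rcases Nat.even_or_odd p with hp' | hp'
    · rw [hp'.neg_one_pow] at h2
      simpa using h2.symm
    · rw [hp'.neg_one_pow] at h2
      simpa using h2.symm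

open PowerSeries in
theorem qRel_twist {A : Type*} [CommRing A] (a : ℕ → A) (h0 : a 0 = 1)
    (h : ∀ p, 1 ≤ p → qRel a p = 0) (t : A) (p : ℕ) (hp : 1 ≤ p) :
    qRel (fun p => a p + 2 * ∑ j ∈ Finset.Icc 1 p, t ^ j * a (p - j)) p = 0 := by
  refine (qRel_eq_zero_iff _ (by simp [h0])).2 ?_ p hp
  have hA := (qRel_eq_zero_iff a h0).1 h
  set g : A⟦X⟧ := PowerSeries.mk fun j => t ^ j with hg
  set z : A⟦X⟧ := PowerSeries.C t * X with hz
  have hg1 : (1 - z) * g = 1 := by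
    ext m
    rw [sub_mul, one_mul, hz, mul_assoc, map_sub, coeff_C_mul, mul_comm X g]
    cases m with
    | zero => simp [hg]
    | succ m => simp [hg, coeff_succ_mul_X, coeff_one, pow_succ']
  have hzn : evalNegHom z = -z := by
    rw [hz, map_mul, evalNegHom_X]
    have : evalNegHom (PowerSeries.C t) = PowerSeries.C t := by
      ext m
      rw [evalNegHom, coeff_rescale, coeff_C]
      split_ifs with h
      · simp [h]
      · simp
    rw [this]
    ring
  have hg2 : (1 + z) * evalNegHom g = 1 := by
    have h := congrArg evalNegHom hg1
    rw [map_mul, map_sub, map_one, hzn, sub_neg_eq_add] at h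
    exact h
  have hS : PowerSeries.mk (fun p => a p + 2 * ∑ j ∈ Finset.Icc 1 p, t ^ j * a (p - j)) =
      PowerSeries.mk a * ((1 + z) * g) := by
    have e : (1 + z) * g = 2 * g - 1 := by linear_combination -hg1
    rw [e, mul_sub, mul_one]
    ext m : 1
    rw [map_sub, show PowerSeries.mk a * (2 * g) = 2 * (g * PowerSeries.mk a) by ring,
      show (2 : A⟦X⟧) = PowerSeries.C (2 : A) from (map_ofNat _ 2).symm, coeff_C_mul, coeff_mul,
      Finset.Nat.sum_antidiagonal_eq_sum_range_succ_mk]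
    simp only [coeff_mk, hg]
    rw [Finset.range_eq_Ico, Finset.sum_eq_sum_Ico_succ_bot (Nat.succ_pos m)]
    have hI : Finset.Ico (0 + 1) m.succ = Finset.Icc 1 m := by
      ext
      simp only [Finset.mem_Ico, Finset.mem_Icc]
      omega
    rw [hI]
    simp only [pow_zero, one_mul, Nat.sub_zero]
    ring
  rw [hS, map_mul, map_mul, map_add, map_one, hzn]
  linear_combination
    ((1 + z) * g * ((1 + -z) * evalNegHom g)) * hA + (1 + z) * evalNegHom g * hg1 + hg2

theorem qRel_s0c (p : ℕ) (hp : 1 ≤ p) : qRel s0c p = 0 := by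
  refine qRel_twist (fun p => MvPolynomial.C (c p)) (by simp [c, cFree]) (fun p hp => ?_)
    (x 0) p hp
  have h := map_qRel (MvPolynomial.C : Gamma →+* GammaXY) c p
  rw [qRel_c hp, map_zero] at h
  exact h.symm

/-- The action of the simple reflection `s_i` on `Γ[X, Y]`. For `i ≥ 1` it interchanges `x_i` and
`x_{i+1}`; `s_0` maps `x_1` to `-x_1` and `c_p` to `c_p + 2 ∑_{j=1}^p x_1^j c_{p-j}`. -/
def act : ℕ → GammaXY →+* GammaXY
  | 0 => MvPolynomial.eval₂Hom (gammaLift s0c s0c_zero qRel_s0c)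
      (Sum.elim (fun j => if j = 0 then -x 0 else x j) y)
  | k + 1 => (MvPolynomial.rename (Sum.map (Equiv.swap k (k + 1)) id) :
      GammaXY →ₐ[Gamma] GammaXY)

/-- The denominators: `-2 x_1` for `i = 0`, and `x_i - x_{i+1}` for `i ≥ 1`. -/
def den : ℕ → GammaXY
  | 0 => -2 * x 0
  | k + 1 => x k - x (k + 1)

/-- The divided difference `∂_i f = (f - s_i f) / den i`, the quotient of an exact division in
`Γ[X, Y]`. -/
def ddx (i : ℕ) (f : GammaXY) : GammaXY :=
  Classical.epsilon fun g => den i * g = f - act i f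

/-- The involution `ω` of `Γ[X, Y]`: `x_j ↦ -y_j`, `y_j ↦ -x_j`, `c_p ↦ c_p`. -/
def omega : GammaXY →ₐ[Gamma] GammaXY :=
  MvPolynomial.aeval (Sum.elim (fun j => -y j) fun j => -x j)

/-- The divided difference `∂_i^y = ω ∂_i ω`. -/
def ddy (i : ℕ) (f : GammaXY) : GammaXY := omega (ddx i (omega f))

/-- `∂_w = ∂_{i_1} ∘ ⋯ ∘ ∂_{i_ℓ}`, for a reduced word `(i_1, …, i_ℓ)` of `w`. -/
def ddW (w : Winf) (f : GammaXY) : GammaXY :=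
  (Classical.epsilon fun a : List ℕ => IsReducedWord a w).foldr ddx f

/-- The constant term of an element of `Γ[X, Y]`: all `c_p` with `p ≥ 1`, `x_j`, `y_j` are
mapped to `0`. -/
def constTerm : GammaXY →+* ℤ :=
  MvPolynomial.eval₂Hom
    (gammaLift (fun p => if p = 0 then (1 : ℤ) else 0) (by simp) (by
      intro p hp
      have h : p ≠ 0 := by omega
      simp [qRel, h]))
    fun _ => 0

/-! ## Schubert polynomials -/

open scoped Classical in
/-- The conditions that characterise the family of type C double Schubert polynomials. -/
structure IsDoubleSchubertFamily (F : Winf → GammaXY) : Prop where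
  ddx_eq : ∀ i w, ddx i (F w) = if length (w * s i) < length w then F (w * s i) else 0
  ddy_eq : ∀ i w, ddy i (F w) = if length (s i * w) < length w then F (s i * w) else 0
  constTerm_eq : ∀ w, constTerm (F w) = if w = 1 then 1 else 0

/-- The type C double Schubert polynomials `𝔠_w(X, Y)`: the unique family with the
characterising properties. -/
def doubleSchubert : Winf → GammaXY := Classical.epsilon IsDoubleSchubertFamily

/-- The type C single Schubert polynomial `𝔠_w(X) = 𝔠_w(X, 0)`, viewed in `Γ[X, Y]`. -/
def schubert (w : Winf) : GammaXY :=
  MvPolynomial.aeval (R := Gamma) (Sum.elim x fun _ => 0) (doubleSchubert w)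

/-! ## The scalar product -/

/-- The ring `Γ[X_n] = Γ[x_1, …, x_n]`, a subring of `Γ[X, Y]`. -/
def GammaX (n : ℕ) : Subalgebra Gamma GammaXY := Algebra.adjoin Gamma (x '' {j | j < n})

/-- The elementary symmetric polynomial `e_j(x_1, …, x_n)`. -/
def e (n j : ℕ) : GammaXY := ∑ t ∈ (Finset.range n).powersetCard j, ∏ i ∈ t, x i

/-- `ⁿc_p = ∑_{j=0}^p c_{p-j} e_j(X_n)`. -/
def nc (n p : ℕ) : GammaXY := ∑ j ∈ Finset.range (p + 1), MvPolynomial.C (c (p - j)) * e n j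

/-- The ring `Γ^{(n)} = ℤ[ⁿc_1, ⁿc_2, …]` of theta polynomials of level `n`. -/
def Theta (n : ℕ) : Subalgebra ℤ GammaXY := Algebra.adjoin ℤ (nc n '' {p | 1 ≤ p})

/-- The scalar product `⟨f, g⟩ = ∂_{w_0}(f g)`, where `w_0` is the longest element of `W_n`. -/
def scalarProduct (n : ℕ) (f g : GammaXY) : GammaXY := ddW (w0 n) (f * g)

end SchubertC

end

/-! The proof has two substantial points: `∂_{w_0}` must be controlled on `Γ[X_n]`, and the Schubert
family, chosen by `Classical.epsilon`, must be shown to exist. Its uniqueness is not needed, because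
the argument uses only the defining recursion. Underneath lies the fact that `Γ` has no 2-torsion
(`gamma_two`), so that division by `-2 x_1` is unambiguous.

Control of `∂_{w_0}`. The relations of `Γ` say `c(t) c(-t) = 1` for `c(t) = ∑ c_p t^p`. With `ⁿc(t)
= c(t) ∏ (1 + x_j t)` this gives `ⁿc(t) ⁿc(-t) = ∏ (1 - x_j² t²)`, so the `x_j` are roots of a monic
polynomial over `Γ^{(n)}`. Repeated division shows that `Γ[X_n]` is spanned over `Γ^{(n)}` by
finitely many monomials, of which only `xRho n` has degree as large as `n²`. The ring `Γ^{(n)}` is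
fixed by `s_0, …, s_{n-1}`, and each divided difference lowers the degree by one. Hence a word of
length `n²` in these letters sends `f` to `g * (its value on xRho n)`, with `g ∈ Γ^{(n)}`
independent of the word (`exists_foldr_ddx_eq_mul`). The value on `xRho n` is an integer, which
proves `⟨f, g⟩ ∈ Γ^{(n)}`. Independence of the reduced word is thereby reduced to `ℤ[X]`, where the
braid relations are checked directly (`foldr_ddx_eq`).

Existence. Applying `∂_{w⁻¹ w_0}` to a top class in `ℤ[X_N]` gives a family with the right recursion
for `i < N` only. Modulo the ideal of the `ᴺc_p`, an element symmetric in `x_{n+1}, …, x_N` is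
congruent to one in `Γ[X_n]`. A nonzero element of low degree in few `x` variables never lies in
that ideal (`eq_zero_of_mem_ncIdeal`, by a splitting principle), so for large `N` the congruences
become equalities. An element killed by all `∂_i` lies in `ℤ[Y]` (`mem_ZY_of_ddx_eq_zero`), which
makes the resulting polynomials independent of `n`. The double polynomials are then obtained by
solving a triangular system (`doubleOf`). Their `y` recursion holds because the error is killed by
all `∂_i` and vanishes under the specialisation `evalY`.

Duality. For `i < n` the operator `∂_i` is self-adjoint for the scalar product, since a reduced word
of `w_0` can be chosen to end in `i`. Writing `𝔠_v = ∂_i 𝔠_{v s_i}` and moving `∂_i` to the other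
side replaces `(u, v)` by `(u s_i, v s_i)` or gives zero; the induction ends at `⟨1, 𝔠_{w_0}⟩ = 1`.
-/

noncomputable section

set_option linter.unusedSimpArgs false

namespace SchubertC

section

open MvPolynomial

/-! ## `Γ` has no `2`-torsion -/

/-- The ideal generated by the first `k` relations of `Γ`. -/
def relIdeal (k : ℕ) : Ideal (MvPolynomial ℕ ℤ) :=
  Ideal.span ((fun p => qRel cFree (p + 1)) '' {p | p < k})

theorem relIdeal_mono : Monotone relIdeal := fun _ _ h =>
  Ideal.span_mono (Set.image_mono fun _ (hp : _ < _) => lt_of_lt_of_le hp h)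

theorem relIdeal_le (k : ℕ) : relIdeal k ≤ gammaIdeal := by
  refine Ideal.span_mono ?_
  rintro _ ⟨p, -, rfl⟩
  exact ⟨p + 1, by omega, rfl⟩

theorem exists_mem_relIdeal {f : MvPolynomial ℕ ℤ} (hf : f ∈ gammaIdeal) :
    ∃ k, f ∈ relIdeal k := by
  refine Submodule.span_induction (p := fun f _ => ∃ k, f ∈ relIdeal k) ?_ ?_ ?_ ?_ hf
  · rintro _ ⟨p, hp, rfl⟩
    refine ⟨p, Ideal.subset_span ⟨p - 1, ?_, ?_⟩⟩
    · show p - 1 < p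
      omega
    · simp [Nat.sub_add_cancel hp]
  · exact ⟨0, zero_mem _⟩
  · rintro f g - - ⟨k, hk⟩ ⟨l, hl⟩
    exact ⟨max k l, add_mem (relIdeal_mono (le_max_left _ _) hk)
      (relIdeal_mono (le_max_right _ _) hl)⟩
  · rintro a f - ⟨k, hk⟩
    exact ⟨k, Ideal.mul_mem_left _ a hk⟩

/-- Reduction of coefficients modulo `2`. -/
abbrev redTwo : MvPolynomial ℕ ℤ →+* MvPolynomial ℕ (ZMod 2) := map (Int.castRingHom (ZMod 2))

/-- Modulo 2 the mixed terms disappear, so the relations become squares of variables and the ideals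
they generate become monomial ideals. -/
theorem redTwo_qRel (p : ℕ) : redTwo (qRel cFree (p + 1)) = X p ^ 2 := by
  have h2 : (2 : MvPolynomial ℕ (ZMod 2)) = 0 := by
    have : (C (2 : ZMod 2) : MvPolynomial ℕ (ZMod 2)) = 2 := map_ofNat _ 2
    rw [← this, show (2 : ZMod 2) = 0 from rfl, map_zero]
  rw [map_qRel, qRel, h2, zero_mul, add_zero]
  simp [cFree]

theorem map_relIdeal (k : ℕ) : (relIdeal k).map redTwo =
    Ideal.span ((fun t : ℕ →₀ ℕ => monomial t (1 : ZMod 2)) ''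
      ((fun p => Finsupp.single p 2) '' {p | p < k})) := by
  rw [relIdeal, Ideal.map_span, Set.image_image, Set.image_image]
  simp only [redTwo_qRel, X_pow_eq_monomial]

/-- Membership in a monomial ideal is a condition on exponents. Multiplication by `X k ^ 2` changes
only the exponent of `X k`, which the generators `X p ^ 2` with `p < k` do not see. -/
theorem redTwo_colon (k : ℕ) (h : MvPolynomial ℕ (ZMod 2))
    (hh : h * X k ^ 2 ∈ (relIdeal k).map redTwo) : h ∈ (relIdeal k).map redTwo := by
  rw [map_relIdeal, mem_ideal_span_monomial_image] at hh ⊢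
  intro m hm
  obtain ⟨_, ⟨p, hp, rfl⟩, hle⟩ := hh (m + Finsupp.single k 2) (by
    rw [X_pow_eq_monomial, mem_support_iff, coeff_mul_monomial, mul_one]
    exact mem_support_iff.1 hm)
  refine ⟨_, ⟨p, hp, rfl⟩, ?_⟩
  rw [Finsupp.single_le_iff] at hle ⊢
  have hp' : k ≠ p := (Nat.ne_of_lt hp).symm
  simpa [Finsupp.single_apply, hp'] using hle

theorem two_dvd_of_redTwo_eq_zero {f : MvPolynomial ℕ ℤ} (hf : redTwo f = 0) :
    ∃ g, f = 2 * g := by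
  have := (C_dvd_iff_zmod 2 f).2 hf
  simpa [Dvd.dvd] using this

/-- The relations stay a regular sequence modulo 2, and such a sequence has a torsion-free quotient
at each stage. The induction adds one relation at a time. -/
theorem relIdeal_two (k : ℕ) : ∀ f, 2 * f ∈ relIdeal k → f ∈ relIdeal k := by
  induction k with
  | zero =>
    intro f hf
    simpa [relIdeal] using hf
  | succ k ih =>
    intro f hf
    have hsplit : relIdeal (k + 1) = relIdeal k ⊔ Ideal.span {qRel cFree (k + 1)} := by
      rw [relIdeal, relIdeal, ← Ideal.span_union, ← Set.image_singleton (f := fun p => qRel cFree (p + 1)),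
        ← Set.image_union]
      congr 2
      ext p
      simp only [Set.mem_ofPred_eq, Set.mem_union, Set.mem_singleton_iff]
      omega
    rw [hsplit, Submodule.mem_sup] at hf ⊢
    obtain ⟨a, ha, b, hb, hab⟩ := hf
    obtain ⟨g, rfl⟩ := Ideal.mem_span_singleton'.1 hb
    -- The equation `2 f = a + g q`, with `q` the new relation, reads `g X_k² ≡ -a` modulo 2, so
    -- `redTwo_colon` applies to `g`.
    have hg : redTwo g ∈ (relIdeal k).map redTwo := by
      apply redTwo_colon
      rw [← redTwo_qRel, ← map_mul, ← add_sub_cancel_left a (g * _), hab, map_sub]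
      have h2 : redTwo (2 * f) = 0 := (C_dvd_iff_zmod 2 _).1 (by simp)
      rw [h2, zero_sub]
      exact neg_mem (Ideal.mem_map_of_mem _ ha)
    obtain ⟨t, ht, htg⟩ := (Ideal.mem_map_iff_of_surjective redTwo
      (map_surjective _ (ZMod.ringHom_surjective _))).1 hg
    obtain ⟨g', hg'⟩ := two_dvd_of_redTwo_eq_zero (f := g - t) (by rw [map_sub, htg, sub_self])
    -- Here `g = t + 2 g'` with `t` in the smaller ideal. Subtracting `g' q` from `f` leaves an
    -- element whose double is `a + q t`, and the induction hypothesis applies to it.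
    refine ⟨f - g' * qRel cFree (k + 1), ih _ ?_, g' * qRel cFree (k + 1),
      Ideal.mem_span_singleton'.2 ⟨g', rfl⟩, by ring⟩
    have : 2 * (f - g' * qRel cFree (k + 1)) = a + qRel cFree (k + 1) * t := by
      linear_combination -hab + qRel cFree (k + 1) * hg'
    rw [this]
    exact add_mem ha (Ideal.mul_mem_left _ _ ht)

theorem toGamma_surjective : Function.Surjective toGamma :=
  Ideal.Quotient.mk_surjective (I := gammaIdeal)

theorem toGamma_eq_zero_iff {f : MvPolynomial ℕ ℤ} : toGamma f = 0 ↔ f ∈ gammaIdeal :=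
  Ideal.Quotient.eq_zero_iff_mem

theorem gamma_two {f : Gamma} (hf : 2 * f = 0) : f = 0 := by
  obtain ⟨f, rfl⟩ := toGamma_surjective f
  have h : 2 * f ∈ gammaIdeal := by
    rw [← toGamma_eq_zero_iff, map_mul, map_ofNat, hf]
  obtain ⟨k, hk⟩ := exists_mem_relIdeal h
  exact toGamma_eq_zero_iff.2 (relIdeal_le k (relIdeal_two k f hk))

/-! ## The denominators are not zero divisors -/

theorem eq_zero_of_two_mul {f : GammaXY} (h : 2 * f = 0) : f = 0 := by
  ext m
  have := congrArg (coeff m) h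
  rw [← map_ofNat (C : Gamma →+* GammaXY), coeff_C_mul, coeff_zero] at this
  rw [coeff_zero]
  exact gamma_two this

/-- The invertible substitution `X a ↦ X a + X b` turns `X a - X b` into a variable, and a variable
can be cancelled over any coefficient ring. -/
theorem eq_zero_of_X_sub_X_mul {a b : ℕ ⊕ ℕ} (hab : a ≠ b) {f : GammaXY}
    (h : (X a - X b) * f = 0) : f = 0 := by
  let φ : GammaXY →ₐ[Gamma] GammaXY := aeval fun i => if i = a then X a + X b else X i
  let ψ : GammaXY →ₐ[Gamma] GammaXY := aeval fun i => if i = a then X a - X b else X i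
  have hψ : ψ.comp φ = AlgHom.id _ _ := by
    ext i : 1
    by_cases hi : i = a
    · subst hi
      simp [φ, ψ, hab.symm]
    · simp [φ, ψ, hi]
  have h1 : X a * φ f = 0 := by
    have := congrArg φ h
    simpa [φ, hab.symm] using this
  have h2 : φ f = 0 := by
    rw [← X_mul_cancel_left_iff (i := a), h1, mul_zero]
  have h3 := DFunLike.congr_fun hψ f
  simpa [h2] using h3.symm

theorem eq_zero_of_den_mul {i : ℕ} {f : GammaXY} (h : den i * f = 0) : f = 0 := by
  cases i with
  | zero =>
    apply eq_zero_of_two_mul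
    rw [← X_mul_cancel_left_iff (i := Sum.inl 0)]
    simp only [den, x] at h
    linear_combination -h
  | succ k => exact eq_zero_of_X_sub_X_mul (by simp) h

theorem den_mul_cancel {i : ℕ} {f g : GammaXY} (h : den i * f = den i * g) : f = g := by
  rw [← sub_eq_zero]
  apply eq_zero_of_den_mul (i := i)
  rw [mul_sub, h, sub_self]

/-! ## The action of the simple reflections -/

theorem act_x_zero (j : ℕ) : act 0 (x j) = if j = 0 then -x 0 else x j := by
  simp [act, x]

theorem act_x_succ (k j : ℕ) : act (k + 1) (x j) = x (Equiv.swap k (k + 1) j) := by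
  simp [act, x]

theorem act_y (i j : ℕ) : act i (y j) = y j := by
  cases i <;> simp [act, y]

theorem c_zero : c 0 = 1 := by simp [c, cFree]

theorem gammaLift_c {A : Type*} [CommRing A] (a : ℕ → A) (h0 h) (p : ℕ) :
    gammaLift a h0 h (c p) = a p := by
  cases p with
  | zero => simp [c_zero, h0]
  | succ k =>
    change eval₂Hom (Int.castRingHom A) (fun k => a (k + 1)) (cFree (k + 1)) = _
    simp [cFree]

theorem gamma_hom_ext {A : Type*} [CommRing A] {φ ψ : Gamma →+* A}
    (h : ∀ p, φ (c p) = ψ (c p)) : φ = ψ := by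
  refine Ideal.Quotient.ringHom_ext (MvPolynomial.ringHom_ext (fun n => ?_) fun k => h (k + 1))
  simp

theorem gammaXY_hom_ext {A : Type*} [CommRing A] {φ ψ : GammaXY →+* A}
    (hc : ∀ p, φ (C (c p)) = ψ (C (c p))) (hx : ∀ j, φ (x j) = ψ (x j))
    (hy : ∀ j, φ (y j) = ψ (y j)) : φ = ψ := by
  refine MvPolynomial.ringHom_ext (fun r => ?_) ?_
  · have : φ.comp C = ψ.comp C := gamma_hom_ext hc
    exact RingHom.congr_fun this r
  · rintro (j | j)
    · exact hx j
    · exact hy j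

@[elab_as_elim]
theorem gamma_induction {P : Gamma → Prop} (f : Gamma) (hint : ∀ n : ℤ, P n)
    (hadd : ∀ f g, P f → P g → P (f + g)) (hmul : ∀ f g, P f → P g → P (f * g))
    (hc : ∀ p, P (c p)) : P f := by
  obtain ⟨f, rfl⟩ := toGamma_surjective f
  induction f using MvPolynomial.induction_on with
  | C a => simpa using hint a
  | add p q hp hq => simpa using hadd _ _ hp hq
  | mul_X p n hp => rw [map_mul]; exact hmul _ _ hp (hc (n + 1))

@[elab_as_elim]
theorem gammaXY_induction {P : GammaXY → Prop} (f : GammaXY) (hint : ∀ n : ℤ, P n)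
    (hadd : ∀ f g, P f → P g → P (f + g)) (hmul : ∀ f g, P f → P g → P (f * g))
    (hc : ∀ p, P (C (c p))) (hx : ∀ j, P (x j)) (hy : ∀ j, P (y j)) : P f := by
  induction f using MvPolynomial.induction_on with
  | C a =>
    induction a using gamma_induction with
    | hint n => simpa using hint n
    | hadd f g hf hg => simpa using hadd _ _ hf hg
    | hmul f g hf hg => simpa using hmul _ _ hf hg
    | hc p => exact hc p
  | add p q hp hq => exact hadd _ _ hp hq
  | mul_X p n hp =>
    refine hmul _ _ hp ?_
    rcases n with j | j
    · exact hx j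
    · exact hy j

theorem act_c_zero (p : ℕ) : act 0 (C (c p)) = s0c p := by
  simp [act, gammaLift_c]

theorem act_c_succ (k p : ℕ) : act (k + 1) (C (c p)) = C (c p) := by
  simp [act]

/-! ### Generating series -/

/-- The series `∑ c_p t^p`. -/
def cSer : PowerSeries GammaXY := PowerSeries.mk fun p => C (c p)

/-- The series `1 + a t`. -/
def lin (a : GammaXY) : PowerSeries GammaXY := 1 + PowerSeries.C a * PowerSeries.X

theorem coeff_lin_mul_succ (a : GammaXY) (f : PowerSeries GammaXY) (p : ℕ) :
    PowerSeries.coeff (p + 1) (lin a * f) =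
      PowerSeries.coeff (p + 1) f + a * PowerSeries.coeff p f := by
  rw [lin, add_mul, one_mul, mul_assoc, map_add, PowerSeries.coeff_C_mul, mul_comm PowerSeries.X,
    PowerSeries.coeff_succ_mul_X]

theorem coeff_lin_mul_zero (a : GammaXY) (f : PowerSeries GammaXY) :
    PowerSeries.coeff 0 (lin a * f) = PowerSeries.coeff 0 f := by
  simp [lin]

theorem map_lin (φ : GammaXY →+* GammaXY) (a : GammaXY) :
    PowerSeries.map φ (lin a) = lin (φ a) := by
  simp [lin]

/-- This is the coefficient form of `(1 - x_1 t) s_0(c(t)) = (1 + x_1 t) c(t)`: multiplication by `1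
- x_1 t` telescopes the geometric series in `s0c`. -/
theorem s0c_succ (p : ℕ) : s0c (p + 1) - x 0 * s0c p = C (c (p + 1)) + x 0 * C (c p) := by
  have h : ∑ j ∈ Finset.Icc 1 (p + 1), x 0 ^ j * C (c (p + 1 - j)) =
      x 0 * (C (c p) + ∑ j ∈ Finset.Icc 1 p, x 0 ^ j * C (c (p - j))) := by
    have e : ∀ m, Finset.Icc 1 m = (Finset.range m).image (· + 1) := by
      intro m
      ext j
      simp only [Finset.mem_Icc, Finset.mem_image, Finset.mem_range]
      constructor
      · intro h
        exact ⟨j - 1, by omega, by omega⟩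
      · rintro ⟨a, h, rfl⟩
        omega
    rw [e, e, Finset.sum_image (by simp), Finset.sum_image (by simp), Finset.sum_range_succ']
    simp only [mul_add, Finset.mul_sum]
    rw [add_comm]
    congr 1
    · simp
    · refine Finset.sum_congr rfl fun j _ => ?_
      rw [show p + 1 - (j + 1 + 1) = p - (j + 1) by omega]
      ring
  rw [s0c, s0c, h]
  ring

/-- `s_0` multiplies `∑ c_p t^p` by `(1 + x_1 t) / (1 - x_1 t)`. -/
theorem lin_mul_map_act_cSer :
    lin (-x 0) * PowerSeries.map (act 0) cSer = lin (x 0) * cSer := by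
  ext p : 1
  cases p with
  | zero => simp [coeff_lin_mul_zero, cSer, c_zero]
  | succ p =>
    rw [coeff_lin_mul_succ, coeff_lin_mul_succ]
    simp only [PowerSeries.coeff_map, cSer, PowerSeries.coeff_mk, act_c_zero]
    rw [← s0c_succ]
    ring

/-- Identities between ring maps on all the `c_p` at once are proved by multiplying series by such
factors and cancelling them afterwards. -/
theorem lin_isUnit (a : GammaXY) : IsUnit (lin a) := by
  rw [PowerSeries.isUnit_iff_constantCoeff]
  simp [lin]

theorem act_act (i : ℕ) (f : GammaXY) : act i (act i f) = f := by
  suffices h : (act i).comp (act i) = RingHom.id _ from RingHom.congr_fun h f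
  cases i with
  | zero =>
    refine gammaXY_hom_ext (fun p => ?_) (fun j => ?_) fun j => ?_
    · have h : PowerSeries.map (act 0) (PowerSeries.map (act 0) cSer) = cSer := by
        have h1 := congrArg (PowerSeries.map (act 0)) lin_mul_map_act_cSer
        simp only [map_mul, map_lin, map_neg, act_x_zero, if_true, neg_neg] at h1
        apply (lin_isUnit (x 0)).mul_left_cancel
        rw [h1, lin_mul_map_act_cSer]
      simpa [cSer] using congrArg (PowerSeries.coeff p) h
    · by_cases hj : j = 0 <;> simp [act_x_zero, hj]
    · simp [act_y]
  | succ k =>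
    refine gammaXY_hom_ext (fun p => ?_) (fun j => ?_) fun j => ?_
    · simp [act_c_succ]
    · simp [act_x_succ]
    · simp [act_y]

theorem act_den (i : ℕ) : act i (den i) = -den i := by
  cases i <;> simp [den, act_x_zero, act_x_succ, map_ofNat]

/-! ### Divided differences -/

/-- The elements whose difference with their image is divisible by `den i` are closed under sums
and, by the twisted Leibniz rule, under products. It remains to divide explicitly on the generators.
-/
theorem exists_ddx (i : ℕ) (f : GammaXY) : ∃ g, den i * g = f - act i f := by
  induction f using gammaXY_induction with
  | hint n => exact ⟨0, by simp⟩
  | hadd f g hf hg =>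
    obtain ⟨a, ha⟩ := hf
    obtain ⟨b, hb⟩ := hg
    exact ⟨a + b, by rw [mul_add, ha, hb, map_add]; ring⟩
  | hmul f g hf hg =>
    obtain ⟨a, ha⟩ := hf
    obtain ⟨b, hb⟩ := hg
    exact ⟨a * g + act i f * b, by rw [map_mul]; linear_combination g * ha + act i f * hb⟩
  | hc p =>
    cases i with
    | zero =>
      refine ⟨∑ j ∈ Finset.Icc 1 p, x 0 ^ (j - 1) * C (c (p - j)), ?_⟩
      rw [act_c_zero, s0c, den, mul_assoc, Finset.mul_sum]
      have : ∑ j ∈ Finset.Icc 1 p, x 0 * (x 0 ^ (j - 1) * C (c (p - j))) =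
          ∑ j ∈ Finset.Icc 1 p, x 0 ^ j * C (c (p - j)) := by
        refine Finset.sum_congr rfl fun j hj => ?_
        rw [← mul_assoc, ← pow_succ', Nat.sub_add_cancel (Finset.mem_Icc.1 hj).1]
      rw [this]
      ring
    | succ k => exact ⟨0, by simp [act_c_succ]⟩
  | hx j =>
    cases i with
    | zero =>
      by_cases hj : j = 0
      · exact ⟨-1, by rw [act_x_zero, if_pos hj, den, hj]; ring⟩
      · exact ⟨0, by rw [act_x_zero, if_neg hj]; ring⟩
    | succ k =>
      rw [act_x_succ, den]
      by_cases h1 : j = k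
      · exact ⟨1, by rw [h1, Equiv.swap_apply_left]; ring⟩
      · by_cases h2 : j = k + 1
        · exact ⟨-1, by rw [h2, Equiv.swap_apply_right]; ring⟩
        · exact ⟨0, by rw [Equiv.swap_apply_of_ne_of_ne h1 h2]; ring⟩
  | hy j => exact ⟨0, by simp [act_y]⟩

theorem den_mul_ddx (i : ℕ) (f : GammaXY) : den i * ddx i f = f - act i f :=
  Classical.epsilon_spec (p := fun g => den i * g = f - act i f) (exists_ddx i f)

theorem ddx_eq_of_den_mul {i : ℕ} {f g : GammaXY} (h : den i * g = f - act i f) :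
    ddx i f = g :=
  den_mul_cancel (by rw [den_mul_ddx, h])

theorem ddx_add (i : ℕ) (f g : GammaXY) : ddx i (f + g) = ddx i f + ddx i g :=
  ddx_eq_of_den_mul (by rw [mul_add, den_mul_ddx, den_mul_ddx, map_add]; ring)

theorem ddx_mul (i : ℕ) (f g : GammaXY) : ddx i (f * g) = ddx i f * g + act i f * ddx i g :=
  ddx_eq_of_den_mul (by
    rw [map_mul]
    linear_combination g * den_mul_ddx i f + act i f * den_mul_ddx i g)

theorem ddx_eq_zero_iff {i : ℕ} {f : GammaXY} : ddx i f = 0 ↔ act i f = f := by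
  constructor
  · intro h
    have := den_mul_ddx i f
    rw [h, mul_zero] at this
    exact (sub_eq_zero.1 this.symm).symm
  · intro h
    exact ddx_eq_of_den_mul (by rw [h]; ring)

theorem ddx_mul_of_act_eq {i : ℕ} {f : GammaXY} (h : act i f = f) (g : GammaXY) :
    ddx i (f * g) = f * ddx i g := by
  rw [ddx_mul, ddx_eq_zero_iff.2 h, h]
  ring

theorem ddx_zero (i : ℕ) : ddx i 0 = 0 := ddx_eq_zero_iff.2 (map_zero _)

theorem ddx_one (i : ℕ) : ddx i 1 = 0 := ddx_eq_zero_iff.2 (map_one _)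

theorem ddx_neg (i : ℕ) (f : GammaXY) : ddx i (-f) = -ddx i f :=
  ddx_eq_of_den_mul (by rw [map_neg]; linear_combination -den_mul_ddx i f)

theorem ddx_sub (i : ℕ) (f g : GammaXY) : ddx i (f - g) = ddx i f - ddx i g := by
  rw [sub_eq_add_neg, ddx_add, ddx_neg, sub_eq_add_neg]

/-- Both the numerator `f - s_i f` and the denominator change sign under `s_i`. -/
theorem act_ddx (i : ℕ) (f : GammaXY) : act i (ddx i f) = ddx i f := by
  apply den_mul_cancel (i := i)
  have h := congrArg (act i) (den_mul_ddx i f)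
  rw [map_mul, act_den, map_sub, act_act] at h
  linear_combination -h - den_mul_ddx i f

theorem ddx_ddx (i : ℕ) (f : GammaXY) : ddx i (ddx i f) = 0 := ddx_eq_zero_iff.2 (act_ddx i f)

theorem ddx_sum {ι : Type*} (i : ℕ) (t : Finset ι) (f : ι → GammaXY) :
    ddx i (∑ a ∈ t, f a) = ∑ a ∈ t, ddx i (f a) :=
  map_sum (AddMonoidHom.mk' (ddx i) (ddx_add i)) f t

theorem ddx_x_zero (j : ℕ) : ddx 0 (x j) = if j = 0 then -1 else 0 := by
  apply ddx_eq_of_den_mul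
  rw [act_x_zero]
  split_ifs with h
  · rw [h, den]; ring
  · ring

theorem ddx_x_succ (k j : ℕ) :
    ddx (k + 1) (x j) = if j = k then 1 else if j = k + 1 then -1 else 0 := by
  apply ddx_eq_of_den_mul
  rw [act_x_succ]
  split_ifs with h h'
  · rw [h, den, Equiv.swap_apply_left]; ring
  · rw [h', den, Equiv.swap_apply_right]; ring
  · rw [Equiv.swap_apply_of_ne_of_ne h h']; ring

end

section

open MvPolynomial

/-! ## Integral polynomials in the `x_j` -/

/-- The monomials of degree `d` in the variables `x_j`. -/
def xMon : ℕ → Set GammaXY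
  | 0 => {1}
  | d + 1 => {f | ∃ j, ∃ m ∈ xMon d, f = x j * m}

/-- The homogeneous integral polynomials of degree `d` in the variables `x_j`. -/
def HX (d : ℕ) : AddSubgroup GammaXY := AddSubgroup.closure (xMon d)

theorem x_mul_mem_HX (j : ℕ) {d : ℕ} {f : GammaXY} (hf : f ∈ HX d) : x j * f ∈ HX (d + 1) := by
  induction hf using AddSubgroup.closure_induction with
  | mem m hm => exact AddSubgroup.subset_closure ⟨j, m, hm, rfl⟩
  | zero => simp
  | add f g _ _ hf hg => rw [mul_add]; exact add_mem hf hg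
  | neg f _ hf => rw [mul_neg]; exact neg_mem hf

theorem one_mem_HX : (1 : GammaXY) ∈ HX 0 := AddSubgroup.subset_closure rfl

theorem x_pow_mul_mem_HX (j k : ℕ) {d : ℕ} {f : GammaXY} (hf : f ∈ HX d) :
    x j ^ k * f ∈ HX (d + k) := by
  induction k with
  | zero => simpa using hf
  | succ k ih => rw [pow_succ', mul_assoc]; exact x_mul_mem_HX j ih

theorem prod_pow_mem_HX (t : Finset ℕ) (a : ℕ → ℕ) : ∏ j ∈ t, x j ^ a j ∈ HX (∑ j ∈ t, a j) := by
  induction t using Finset.induction_on with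
  | empty => simpa using one_mem_HX
  | insert j t hj ih =>
    rw [Finset.prod_insert hj, Finset.sum_insert hj, add_comm]
    exact x_pow_mul_mem_HX j _ ih

theorem mem_HX_zero {f : GammaXY} (hf : f ∈ HX 0) : ∃ n : ℤ, f = n := by
  induction hf using AddSubgroup.closure_induction with
  | mem m hm => exact ⟨1, by rw [show m = 1 from hm, Int.cast_one]⟩
  | zero => exact ⟨0, by simp⟩
  | add f g _ _ hf hg =>
    obtain ⟨a, rfl⟩ := hf
    obtain ⟨b, rfl⟩ := hg
    exact ⟨a + b, by simp⟩
  | neg f _ hf =>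
    obtain ⟨a, rfl⟩ := hf
    exact ⟨-a, by simp⟩

theorem ddx_intCast (i : ℕ) (n : ℤ) : ddx i n = 0 := ddx_eq_zero_iff.2 (map_intCast _ _)

theorem exists_act_x (i j : ℕ) : ∃ k, act i (x j) = x k ∨ act i (x j) = -x k := by
  cases i with
  | zero =>
    refine ⟨j, ?_⟩
    rw [act_x_zero]
    split_ifs with h
    · exact Or.inr (by rw [h])
    · exact Or.inl rfl
  | succ k => exact ⟨_, Or.inl (act_x_succ k j)⟩

theorem exists_ddx_x (i j : ℕ) : ∃ n : ℤ, ddx i (x j) = n := by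
  cases i with
  | zero =>
    rw [ddx_x_zero]
    split_ifs
    · exact ⟨-1, by simp⟩
    · exact ⟨0, by simp⟩
  | succ k =>
    rw [ddx_x_succ]
    split_ifs
    · exact ⟨1, by simp⟩
    · exact ⟨-1, by simp⟩
    · exact ⟨0, by simp⟩

theorem ddx_mem_HX (i : ℕ) {d : ℕ} {f : GammaXY} (hf : f ∈ HX (d + 1)) : ddx i f ∈ HX d := by
  induction hf using AddSubgroup.closure_induction with
  | mem m hm =>
    induction d generalizing m with
    | zero =>
      obtain ⟨j, m', hm', rfl⟩ := hm
      obtain rfl : m' = 1 := hm'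
      obtain ⟨n, hn⟩ := exists_ddx_x i j
      rw [mul_one, hn, ← zsmul_one]
      exact zsmul_mem one_mem_HX n
    | succ d ih =>
      obtain ⟨j, m', hm', rfl⟩ := hm
      obtain ⟨n, hn⟩ := exists_ddx_x i j
      rw [ddx_mul, hn, ← zsmul_eq_mul]
      refine add_mem (zsmul_mem (AddSubgroup.subset_closure hm') n) ?_
      obtain ⟨k, hk | hk⟩ := exists_act_x i j
      · rw [hk]; exact x_mul_mem_HX k (ih m' hm')
      · rw [hk, neg_mul]; exact neg_mem (x_mul_mem_HX k (ih m' hm'))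
  | zero => rw [ddx_zero]; exact zero_mem _
  | add f g _ _ hf hg => rw [ddx_add]; exact add_mem hf hg
  | neg f _ hf => rw [ddx_neg]; exact neg_mem hf

theorem ddx_eq_zero_of_mem_HX_zero (i : ℕ) {f : GammaXY} (hf : f ∈ HX 0) : ddx i f = 0 := by
  obtain ⟨n, rfl⟩ := mem_HX_zero hf
  exact ddx_intCast i n

theorem foldr_ddx_mem_HX (a : List ℕ) {d : ℕ} {f : GammaXY} (hf : f ∈ HX (d + a.length)) :
    a.foldr ddx f ∈ HX d := by
  induction a generalizing d with
  | nil => exact hf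
  | cons i a ih =>
    rw [List.foldr_cons]
    apply ddx_mem_HX
    apply ih
    rwa [List.length_cons, ← add_assoc, add_right_comm] at hf

theorem foldr_ddx_zero (a : List ℕ) : a.foldr ddx 0 = 0 := by
  induction a with
  | nil => rfl
  | cons i a ih => rw [List.foldr_cons, ih, ddx_zero]

theorem foldr_ddx_add (a : List ℕ) (f g : GammaXY) :
    a.foldr ddx (f + g) = a.foldr ddx f + a.foldr ddx g := by
  induction a with
  | nil => rfl
  | cons i a ih => simp only [List.foldr_cons, ih, ddx_add]

theorem foldr_ddx_mul (a : List ℕ) {f : GammaXY} (hf : ∀ i ∈ a, act i f = f) (g : GammaXY) :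
    a.foldr ddx (f * g) = f * a.foldr ddx g := by
  induction a with
  | nil => rfl
  | cons i a ih =>
    rw [List.foldr_cons, ih fun j hj => hf j (List.mem_cons_of_mem _ hj),
      ddx_mul_of_act_eq (hf i List.mem_cons_self), List.foldr_cons]

/-- Each letter lowers the degree by one, so a word longer than the degree reaches a constant before
its letters run out, and the next letter kills it. -/
theorem foldr_ddx_eq_zero (a : List ℕ) {d : ℕ} {f : GammaXY} (hf : f ∈ HX d)
    (h : d < a.length) : a.foldr ddx f = 0 := by
  induction a generalizing d f with
  | nil => simp at h
  | cons i a ih =>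
    rw [List.foldr_cons]
    by_cases h' : d < a.length
    · rw [ih hf h', ddx_zero]
    · apply ddx_eq_zero_of_mem_HX_zero
      apply foldr_ddx_mem_HX
      rw [List.length_cons] at h
      rwa [show 0 + a.length = d by omega]

/-- The subring `ℤ[x_1, x_2, …]`. -/
def ZX : Subring GammaXY := Subring.closure (Set.range x)

theorem x_mem_ZX (j : ℕ) : x j ∈ ZX := Subring.subset_closure ⟨j, rfl⟩

theorem act_mem_ZX (i : ℕ) {f : GammaXY} (hf : f ∈ ZX) : act i f ∈ ZX := by
  induction hf using Subring.closure_induction with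
  | mem f hf =>
    obtain ⟨j, rfl⟩ := hf
    obtain ⟨k, hk | hk⟩ := exists_act_x i j
    · rw [hk]; exact x_mem_ZX k
    · rw [hk]; exact neg_mem (x_mem_ZX k)
  | zero => simp
  | one => simp
  | add f g _ _ hf hg => rw [map_add]; exact add_mem hf hg
  | neg f _ hf => rw [map_neg]; exact neg_mem hf
  | mul f g _ _ hf hg => rw [map_mul]; exact mul_mem hf hg

theorem ddx_mem_ZX (i : ℕ) {f : GammaXY} (hf : f ∈ ZX) : ddx i f ∈ ZX := by
  induction hf using Subring.closure_induction with
  | mem f hf =>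
    obtain ⟨j, rfl⟩ := hf
    obtain ⟨n, hn⟩ := exists_ddx_x i j
    rw [hn]
    exact intCast_mem _ n
  | zero => rw [ddx_zero]; exact zero_mem _
  | one => rw [ddx_one]; exact zero_mem _
  | add f g _ _ hf hg => rw [ddx_add]; exact add_mem hf hg
  | neg f _ hf => rw [ddx_neg]; exact neg_mem hf
  | mul f g hf' hg' hf hg =>
    rw [ddx_mul]
    exact add_mem (mul_mem hf hg') (mul_mem (act_mem_ZX i hf') hg)

theorem HX_le_ZX {d : ℕ} {f : GammaXY} (hf : f ∈ HX d) : f ∈ ZX := by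
  induction hf using AddSubgroup.closure_induction with
  | mem m hm =>
    induction d generalizing m with
    | zero =>
      obtain rfl : m = 1 := hm
      exact one_mem _
    | succ d ih =>
      obtain ⟨j, m', hm', rfl⟩ := hm
      exact mul_mem (x_mem_ZX j) (ih m' hm')
  | zero => exact zero_mem _
  | add f g _ _ hf hg => exact add_mem hf hg
  | neg f _ hf => exact neg_mem hf

/-! ## Braid relations -/

/-- The braid relations are verified on `ℤ[X]` only, where ring maps are compared on variables. This
suffices, because `∂_{w_0}` on `Γ[X_n]` is determined by its value on the integral monomial `xRho
n`. -/
theorem eq_of_mem_ZX {φ ψ : GammaXY →+* GammaXY} (h : ∀ j, φ (x j) = ψ (x j)) {f : GammaXY}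
    (hf : f ∈ ZX) : φ f = ψ f := by
  refine RingHom.eqOn_set_closure (s := Set.range x) ?_ hf
  rintro _ ⟨j, rfl⟩
  exact h j

theorem act_comm {i j : ℕ} (h : i + 2 ≤ j) {f : GammaXY} (hf : f ∈ ZX) :
    act i (act j f) = act j (act i f) := by
  refine eq_of_mem_ZX (φ := (act i).comp (act j)) (ψ := (act j).comp (act i)) (fun k => ?_) hf
  obtain ⟨j, rfl⟩ := Nat.exists_eq_add_of_le h
  cases i with
  | zero =>
    rw [show 0 + 2 + j = j + 1 + 1 by ring]
    simp only [RingHom.comp_apply, act_x_succ, act_x_zero, apply_ite, map_neg]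
    by_cases hk : k = 0
    · subst hk
      simp [Equiv.swap_apply_def]
    · have : Equiv.swap (j + 1) (j + 1 + 1) k ≠ 0 := by
        simp only [Equiv.swap_apply_def]
        split_ifs <;> omega
      simp [hk, this]
  | succ i =>
    rw [show i + 1 + 2 + j = i + 2 + j + 1 by ring]
    simp only [RingHom.comp_apply, act_x_succ]
    congr 1
    simp only [Equiv.swap_apply_def]
    split_ifs <;> omega

theorem act_den_of_le {i j : ℕ} (h : i + 2 ≤ j) :
    act i (den j) = den j ∧ act j (den i) = den i := by
  obtain ⟨j, rfl⟩ := Nat.exists_eq_add_of_le h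
  cases i with
  | zero =>
    rw [show 0 + 2 + j = j + 1 + 1 by ring]
    simp [den, act_x_zero, act_x_succ, map_ofNat, Equiv.swap_apply_def]
  | succ i =>
    rw [show i + 1 + 2 + j = i + 2 + j + 1 by ring]
    simp only [den, map_sub, act_x_succ]
    constructor
    · rw [Equiv.swap_apply_of_ne_of_ne (by omega) (by omega),
        Equiv.swap_apply_of_ne_of_ne (by omega) (by omega)]
    · rw [Equiv.swap_apply_of_ne_of_ne (by omega) (by omega),
        Equiv.swap_apply_of_ne_of_ne (by omega) (by omega)]

theorem ddx_comm {i j : ℕ} (h : i + 2 ≤ j) {f : GammaXY} (hf : f ∈ ZX) :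
    ddx i (ddx j f) = ddx j (ddx i f) := by
  apply den_mul_cancel (i := i)
  apply den_mul_cancel (i := j)
  obtain ⟨h1, h2⟩ := act_den_of_le h
  have e1 := congrArg (act i) (den_mul_ddx j f)
  have e2 := congrArg (act j) (den_mul_ddx i f)
  rw [map_mul, map_sub, h1] at e1
  rw [map_mul, map_sub, h2] at e2
  linear_combination den j * den_mul_ddx i (ddx j f) - den i * den_mul_ddx j (ddx i f) - e1 + e2
    + den_mul_ddx j f - den_mul_ddx i f + act_comm h hf

theorem act_braid (k : ℕ) {f : GammaXY} (hf : f ∈ ZX) :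
    act (k + 1) (act (k + 2) (act (k + 1) f)) = act (k + 2) (act (k + 1) (act (k + 2) f)) := by
  refine eq_of_mem_ZX (φ := (act (k + 1)).comp ((act (k + 2)).comp (act (k + 1))))
    (ψ := (act (k + 2)).comp ((act (k + 1)).comp (act (k + 2)))) (fun j => ?_) hf
  simp only [RingHom.comp_apply, act_x_succ]
  congr 1
  simp only [Equiv.swap_apply_def]
  split_ifs <;> omega

theorem eq_zero_of_act_den_mul {i j : ℕ} {f : GammaXY} (h : act j (den i) * f = 0) : f = 0 := by
  have h' := congrArg (act j) h
  rw [map_mul, act_act, map_zero] at h'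
  rw [← act_act j f, eq_zero_of_den_mul h', map_zero]

/-- Multiplied by the three positive roots of `A_2`, either side becomes the alternating sum of the
six group elements applied to `f`. The two expansions differ only in the word chosen for the longest
element. -/
theorem ddx_braid (k : ℕ) {f : GammaXY} (hf : f ∈ ZX) :
    ddx (k + 1) (ddx (k + 2) (ddx (k + 1) f)) = ddx (k + 2) (ddx (k + 1) (ddx (k + 2) f)) := by
  have k1 : k + 1 + 1 ≠ k := by omega
  have hs : act (k + 1) (den (k + 2)) = x k - x (k + 2) := by
    simp [den, act_x_succ, Equiv.swap_apply_def, k1]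
  have ht : act (k + 2) (den (k + 1)) = x k - x (k + 2) := by
    simp [den, act_x_succ, Equiv.swap_apply_def, k1.symm]
  have hd1 : den (k + 1) = x k - x (k + 1) := rfl
  have hd2 : den (k + 2) = x (k + 1) - x (k + 2) := rfl
  have key1 : den (k + 1) * (den (k + 2) * ((x k - x (k + 2)) *
      ddx (k + 1) (ddx (k + 2) (ddx (k + 1) f)))) = f - act (k + 1) f - act (k + 2) f +
        act (k + 2) (act (k + 1) f) + act (k + 1) (act (k + 2) f) -
        act (k + 1) (act (k + 2) (act (k + 1) f)) := by
    have e1 := den_mul_ddx (k + 1) f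
    have e2 := congrArg (act (k + 2)) e1
    have e3 := congrArg (act (k + 1)) e2
    have e4 := den_mul_ddx (k + 2) (ddx (k + 1) f)
    have e5 := congrArg (act (k + 1)) e4
    have e6 := den_mul_ddx (k + 1) (ddx (k + 2) (ddx (k + 1) f))
    simp only [map_mul, map_sub, hs, ht, act_ddx] at e2 e3 e5
    have h3 : act (k + 1) (x k) - act (k + 1) (x (k + 2)) = x (k + 1) - x (k + 2) := by
      simp [act_x_succ, Equiv.swap_apply_def]
    rw [h3] at e3
    rw [hd1] at e1 e6 ⊢
    rw [hd2] at e4 ⊢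
    linear_combination (x (k + 1) - x (k + 2)) * (x k - x (k + 2)) * e6 +
      (x k - x (k + 2)) * e4 - (x (k + 1) - x (k + 2)) * e5 + e1 - e2 + e3
  have key2 : den (k + 1) * (den (k + 2) * ((x k - x (k + 2)) *
      ddx (k + 2) (ddx (k + 1) (ddx (k + 2) f)))) = f - act (k + 1) f - act (k + 2) f +
        act (k + 2) (act (k + 1) f) + act (k + 1) (act (k + 2) f) -
        act (k + 2) (act (k + 1) (act (k + 2) f)) := by
    have e1 := den_mul_ddx (k + 2) f
    have e2 := congrArg (act (k + 1)) e1
    have e3 := congrArg (act (k + 2)) e2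
    have e4 := den_mul_ddx (k + 1) (ddx (k + 2) f)
    have e5 := congrArg (act (k + 2)) e4
    have e6 := den_mul_ddx (k + 2) (ddx (k + 1) (ddx (k + 2) f))
    simp only [map_mul, map_sub, hs, ht, act_ddx] at e2 e3 e5
    have h3 : act (k + 2) (x k) - act (k + 2) (x (k + 2)) = x k - x (k + 1) := by
      simp [act_x_succ, Equiv.swap_apply_def, k1.symm]
    rw [h3] at e3
    rw [hd1] at e4 ⊢
    rw [hd2] at e1 e6 ⊢
    linear_combination (x k - x (k + 1)) * (x k - x (k + 2)) * e6 +
      (x k - x (k + 2)) * e4 - (x k - x (k + 1)) * e5 + e1 - e2 + e3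
  rw [← sub_eq_zero]
  apply eq_zero_of_act_den_mul (i := k + 2) (j := k + 1)
  apply eq_zero_of_den_mul (i := k + 2)
  apply eq_zero_of_den_mul (i := k + 1)
  rw [hs]
  linear_combination key1 - key2 - act_braid k hf

theorem act_braid_zero {f : GammaXY} (hf : f ∈ ZX) :
    act 0 (act 1 (act 0 (act 1 f))) = act 1 (act 0 (act 1 (act 0 f))) := by
  refine eq_of_mem_ZX (φ := ((act 0).comp (act 1)).comp ((act 0).comp (act 1)))
    (ψ := ((act 1).comp (act 0)).comp ((act 1).comp (act 0))) (fun j => ?_) hf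
  obtain rfl | rfl | h : j = 0 ∨ j = 1 ∨ 2 ≤ j := by omega
  · simp [act_x_succ, act_x_zero]
  · simp [act_x_succ, act_x_zero]
  · have h1 : Equiv.swap 0 1 j = j := Equiv.swap_apply_of_ne_of_ne (by omega) (by omega)
    have h2 : j ≠ 0 := by omega
    simp [act_x_succ, act_x_zero, h1, h2]

/-- The argument is that of `ddx_braid` for the dihedral group of order 8, with four positive roots
and an alternating sum of eight terms. -/
theorem ddx_braid_zero {f : GammaXY} (hf : f ∈ ZX) :
    ddx 0 (ddx 1 (ddx 0 (ddx 1 f))) = ddx 1 (ddx 0 (ddx 1 (ddx 0 f))) := by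
  -- The roots are `p = -2 x_1`, `q = x_1 - x_2`, `p' = -2 x_2` and `q' = -x_1 - x_2`. They are made
  -- opaque, since only the two linear relations `r1`, `r2` and the action on the roots enter the
  -- computation.
  obtain ⟨p, hp⟩ : ∃ p, den 0 = p := ⟨_, rfl⟩
  obtain ⟨q, hq⟩ : ∃ q, den 1 = q := ⟨_, rfl⟩
  obtain ⟨p', hp'⟩ : ∃ p', act 1 (den 0) = p' := ⟨_, rfl⟩
  obtain ⟨q', hq'⟩ : ∃ q', act 0 (den 1) = q' := ⟨_, rfl⟩
  have r1 : q' - q = p := by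
    rw [← hq', ← hq, ← hp]
    simp [den, act_x_zero]
    ring
  have r2 : p' - q' = q := by
    rw [← hp', ← hq', ← hq]
    simp [den, act_x_zero, act_x_succ, map_ofNat]
    ring
  have sp' : act 0 p' = p' := by
    rw [← hp']
    simp [den, act_x_zero, act_x_succ, map_ofNat]
  have tq' : act 1 q' = q' := by
    rw [← hq']
    simp [den, act_x_zero, act_x_succ]
    ring
  have sq : act 0 q = q' := by rw [← hq, hq']
  have tp : act 1 p = p' := by rw [← hp, hp']
  have sq' : act 0 q' = q := by rw [← sq, act_act]
  have tp' : act 1 p' = p := by rw [← tp, act_act]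
  have D0 : ∀ f, p * ddx 0 f = f - act 0 f := fun f => by rw [← hp, den_mul_ddx]
  have D1 : ∀ f, q * ddx 1 f = f - act 1 f := fun f => by rw [← hq, den_mul_ddx]
  have key1 : p * (q * (p' * (q' * ddx 0 (ddx 1 (ddx 0 (ddx 1 f)))))) =
      f - act 1 f - act 0 f + act 0 (act 1 f) + act 1 (act 0 f) - act 1 (act 0 (act 1 f)) -
      act 0 (act 1 (act 0 f)) + act 0 (act 1 (act 0 (act 1 f))) := by
    have e1 := D1 f
    have e2 := congrArg (act 0) e1
    have e5 := congrArg (act 1) e2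
    have e9 := congrArg (act 0) e5
    have e3 := D0 (ddx 1 f)
    have e4 := congrArg (act 1) e3
    have e8 := congrArg (act 0) e4
    have e6 := D1 (ddx 0 (ddx 1 f))
    have e7 := congrArg (act 0) e6
    have e10 := D0 (ddx 1 (ddx 0 (ddx 1 f)))
    simp only [map_mul, map_sub, sq, tq', tp, sq', sp', act_ddx] at e2 e5 e9 e4 e8 e7
    subst r1
    obtain rfl : p' = q + q' := by linear_combination r2
    linear_combination q * (q + q') * q' * e10 + (q + q') * q' * e6 - q * (q + q') * e7
      + (q + q') * e3 - q' * e4 + q * e8 + e1 - e2 + e5 - e9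
  have key2 : p * (q * (p' * (q' * ddx 1 (ddx 0 (ddx 1 (ddx 0 f)))))) =
      f - act 1 f - act 0 f + act 0 (act 1 f) + act 1 (act 0 f) - act 1 (act 0 (act 1 f)) -
      act 0 (act 1 (act 0 f)) + act 1 (act 0 (act 1 (act 0 f))) := by
    have e1 := D0 f
    have e2 := congrArg (act 1) e1
    have e5 := congrArg (act 0) e2
    have e9 := congrArg (act 1) e5
    have e3 := D1 (ddx 0 f)
    have e4 := congrArg (act 0) e3
    have e8 := congrArg (act 1) e4
    have e6 := D0 (ddx 1 (ddx 0 f))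
    have e7 := congrArg (act 1) e6
    have e10 := D1 (ddx 0 (ddx 1 (ddx 0 f)))
    simp only [map_mul, map_sub, sq, tq', tp, tp', sp', act_ddx] at e2 e5 e9 e4 e8 e7
    subst r1
    obtain rfl : p' = q + q' := by linear_combination r2
    linear_combination (q' - q) * (q + q') * q' * e10 + (q + q') * q' * e6 - (q' - q) * q' * e7
      + 2 * q' * e3 - (q + q') * e4 + (q' - q) * e8 + e1 - e2 + e5 - e9
  rw [← sub_eq_zero]
  apply eq_zero_of_act_den_mul (i := 1) (j := 0)
  apply eq_zero_of_act_den_mul (i := 0) (j := 1)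
  apply eq_zero_of_den_mul (i := 1)
  apply eq_zero_of_den_mul (i := 0)
  rw [hq', hp', hq, hp]
  linear_combination key1 - key2 + act_braid_zero hf

end

/-! ## Lengths of signed permutations -/

theorem winf_neg (w : Winf) (i : ℤ) : w.1 (-i) = -w.1 i := w.2.1 i

theorem winf_zero (w : Winf) : w.1 0 = 0 := by
  have := winf_neg w 0
  rw [neg_zero] at this
  omega

theorem winf_ext {v w : Winf} (h : ∀ i, v.1 i = w.1 i) : v = w := Subtype.ext (Equiv.ext h)

theorem winf_mul_apply (v w : Winf) (i : ℤ) : (v * w).1 i = v.1 (w.1 i) := rfl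

theorem s_zero_apply (z : ℤ) :
    (s 0).1 z = if z = 1 then -1 else if z = -1 then 1 else z := by
  simp [s, Equiv.swap_apply_def]

theorem s_succ_apply (k : ℕ) (z : ℤ) : (s (k + 1)).1 z =
    if z = k + 1 then (k : ℤ) + 2 else if z = k + 2 then (k : ℤ) + 1 else
      if z = -(k + 1) then -((k : ℤ) + 2) else if z = -(k + 2) then -((k : ℤ) + 1) else z := by
  simp only [s, Equiv.Perm.coe_mul, Function.comp_apply, Equiv.swap_apply_def]
  split_ifs <;> omega

theorem s_s_apply (i : ℕ) (z : ℤ) : (s i).1 ((s i).1 z) = z := by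
  cases i with
  | zero =>
    simp only [s_zero_apply]
    split_ifs <;> first | omega | simp_all
  | succ k =>
    simp only [s_succ_apply]
    split_ifs <;> omega

theorem s_mul_s (i : ℕ) : s i * s i = 1 := winf_ext fun z => s_s_apply i z

theorem s_inv (i : ℕ) : (s i)⁻¹ = s i := inv_eq_of_mul_eq_one_left (s_mul_s i)

theorem mul_s_mul_s (w : Winf) (i : ℕ) : w * s i * s i = w := by
  rw [mul_assoc, s_mul_s, mul_one]

theorem s_mul_s_mul (w : Winf) (i : ℕ) : s i * (s i * w) = w := by
  rw [← mul_assoc, s_mul_s, one_mul]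

theorem exists_mem_W (w : Winf) : ∃ n, w ∈ W n := by
  obtain ⟨B, hB⟩ := (w.2.2.image fun i => i.natAbs).bddAbove
  refine ⟨B, fun i hi => ?_⟩
  by_contra h
  have := hB ⟨i, h, rfl⟩
  dsimp only at this
  rw [lt_abs] at hi
  omega

theorem W_mono {m n : ℕ} (h : m ≤ n) : W m ≤ W n := fun _ hw i hi => hw i (by omega)

theorem s_mem_W {i n : ℕ} (h : i < n) : s i ∈ W n := by
  intro z hz
  rw [lt_abs] at hz
  cases i with
  | zero =>
    rw [s_zero_apply]
    split_ifs <;> omega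
  | succ k =>
    rw [s_succ_apply]
    split_ifs <;> omega

theorem abs_le_of_mem_W {n : ℕ} {w : Winf} (hw : w ∈ W n) {i : ℤ} (hi : |i| ≤ n) :
    |w.1 i| ≤ n := by
  by_contra h
  have h1 := hw (w.1 i) (by omega)
  have h2 := w.1.injective h1
  rw [h2] at h
  exact h hi

/-- The inversions of `w`, each of them represented by two elements. -/
def inversions (w : Winf) : Set (ℤ × ℤ × Bool) :=
  {r | r.1 < r.2.1 ∧ r.1 ≠ 0 ∧ r.2.1 ≠ 0 ∧ w.1 r.2.1 < w.1 r.1 ∧ (r.2.2 = true → r.1 = -r.2.1)}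

theorem inversions_subset {n : ℕ} {w : Winf} (hw : w ∈ W n) :
    inversions w ⊆ Set.Icc (-n : ℤ) n ×ˢ Set.Icc (-n : ℤ) n ×ˢ Set.univ := by
  rintro ⟨a, b, t⟩ ⟨h1, -, -, h2, -⟩
  dsimp only at h1 h2
  have key : |a| ≤ n ∧ |b| ≤ n := by
    by_contra h
    rw [not_and_or] at h
    by_cases hb : |b| ≤ n
    · have ha : ¬ |a| ≤ n := by tauto
      have e1 := hw a (by omega)
      have e2 := abs_le_of_mem_W hw hb
      rw [abs_le] at e2 hb
      rw [abs_le] at ha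
      omega
    · have e1 := hw b (by omega)
      by_cases ha : |a| ≤ n
      · have e2 := abs_le_of_mem_W hw ha
        rw [abs_le] at e2 ha
        rw [abs_le] at hb
        omega
      · have e2 := hw a (by omega)
        omega
  rw [abs_le, abs_le] at key
  simp only [Set.mem_prod, Set.mem_Icc, Set.mem_univ, and_true]
  omega

theorem inversions_finite (w : Winf) : (inversions w).Finite := by
  obtain ⟨n, hn⟩ := exists_mem_W w
  exact ((Set.finite_Icc _ _).prod ((Set.finite_Icc _ _).prod Set.finite_univ)).subset
    (inversions_subset hn)

/-- The inversions of a simple reflection. -/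
def simpleInversions (i : ℕ) : Set (ℤ × ℤ × Bool) :=
  if i = 0 then {(-1, 1, false), (-1, 1, true)}
  else {((i : ℤ), (i : ℤ) + 1, false), (-((i : ℤ) + 1), -(i : ℤ), false)}

theorem simpleInversions_ncard (i : ℕ) : (simpleInversions i).ncard = 2 := by
  rw [simpleInversions]
  split_ifs with h
  · exact Set.ncard_pair (by simp)
  · refine Set.ncard_pair ?_
    simp only [ne_eq, Prod.mk.injEq]
    omega

theorem mem_simpleInversions {i : ℕ} {a b : ℤ} {t : Bool} :
    (a, b, t) ∈ simpleInversions i ↔ (i = 0 ∧ a = -1 ∧ b = 1) ∨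
      (i ≠ 0 ∧ t = false ∧ (a = i ∧ b = i + 1 ∨ a = -(i + 1) ∧ b = -i)) := by
  rw [simpleInversions]
  split_ifs with h
  · cases t <;> simp [h]
  · simp only [Set.mem_insert_iff, Set.mem_singleton_iff, Prod.mk.injEq, h, false_and, false_or]
    tauto

theorem s_lt_or {i : ℕ} {a b : ℤ} (hab : a < b) (ha : a ≠ 0) (hb : b ≠ 0) :
    (s i).1 a < (s i).1 b ∨ (i = 0 ∧ a = -1 ∧ b = 1) ∨
      (i ≠ 0 ∧ (a = i ∧ b = i + 1 ∨ a = -(i + 1) ∧ b = -i)) := by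
  cases i with
  | zero =>
    simp only [s_zero_apply]
    split_ifs <;> first | omega | simp_all
  | succ k =>
    simp only [s_succ_apply]
    split_ifs <;> push_cast <;> omega

theorem s_ne_zero {i : ℕ} {a : ℤ} (ha : a ≠ 0) : (s i).1 a ≠ 0 := fun h => ha (by
  rw [← s_s_apply i a, h, winf_zero])

theorem s_apply_self {i : ℕ} (hi : i ≠ 0) : (s i).1 i = i + 1 ∧ (s i).1 (i + 1) = i := by
  obtain ⟨k, rfl⟩ := Nat.exists_eq_succ_of_ne_zero hi
  simp only [Nat.succ_eq_add_one, s_succ_apply]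
  constructor <;> split_ifs <;> push_cast at * <;> omega

theorem s_zero_one : (s 0).1 1 = -1 := by simp [s_zero_apply]

/-- The reflection `s i` preserves the order of every pair of nonzero integers except the pairs it
inverts itself. Inversions therefore move along `s i`, and exactly those of `s i` are added. For `i
= 0` the single pair `(-1, 1)` is its own mirror image, and the Boolean mark supplies its second
copy. -/
theorem inversions_mul_s {i : ℕ} {w : Winf} (h : w.1 i < w.1 (i + 1)) :
    inversions (w * s i) =
      (fun r => ((s i).1 r.1, (s i).1 r.2.1, r.2.2)) '' inversions w ∪ simpleInversions i := by
  have h0 : i = 0 → 0 < w.1 1 := by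
    rintro rfl
    simpa [winf_zero] using h
  ext ⟨a, b, t⟩
  have himg : (a, b, t) ∈ (fun r : ℤ × ℤ × Bool => ((s i).1 r.1, (s i).1 r.2.1, r.2.2)) ''
      inversions w ↔ ((s i).1 a, (s i).1 b, t) ∈ inversions w := by
    constructor
    · rintro ⟨⟨a', b', t'⟩, hr, hr'⟩
      simp only [Prod.mk.injEq] at hr'
      obtain ⟨rfl, rfl, rfl⟩ := hr'
      simpa only [s_s_apply] using hr
    · intro hr
      exact ⟨_, hr, by simp only [s_s_apply]⟩
  rw [Set.mem_union, himg, mem_simpleInversions]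
  simp only [inversions, Set.mem_ofPred_eq, winf_mul_apply]
  constructor
  · rintro ⟨h1, h2, h3, h4, h5⟩
    rcases s_lt_or (i := i) h1 h2 h3 with hs | hs | hs
    · refine Or.inl ⟨hs, s_ne_zero h2, s_ne_zero h3, h4, fun ht => ?_⟩
      rw [h5 ht, winf_neg]
    · exact Or.inr (Or.inl hs)
    · refine Or.inr (Or.inr ⟨hs.1, ?_, hs.2⟩)
      by_contra ht
      have := h5 (by simpa using ht)
      omega
  · rintro (⟨h1, h2, h3, h4, h5⟩ | ⟨rfl, rfl, rfl⟩ | ⟨hi, rfl, ⟨rfl, rfl⟩ | ⟨rfl, rfl⟩⟩)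
    · have ha : a ≠ 0 := fun ha => h2 (by rw [ha, winf_zero])
      have hb : b ≠ 0 := fun hb => h3 (by rw [hb, winf_zero])
      refine ⟨?_, ha, hb, h4, fun ht => ?_⟩
      · rcases s_lt_or (i := i) h1 h2 h3 with hs | ⟨rfl, hs, hs'⟩ | ⟨-, ⟨hs, hs'⟩ | ⟨hs, hs'⟩⟩
        · simpa only [s_s_apply] using hs
        · rw [hs, hs', winf_neg] at h4
          have := h0 rfl
          omega
        · rw [hs, hs'] at h4
          omega
        · rw [hs, hs', winf_neg, winf_neg] at h4
          omega
      · rw [← s_s_apply i a, h5 ht, winf_neg, s_s_apply]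
    · have := h0 rfl
      simp only [winf_neg, s_zero_one]
      refine ⟨by norm_num, by norm_num, by norm_num, by omega, fun _ => trivial⟩
    · rw [(s_apply_self hi).1, (s_apply_self hi).2]
      exact ⟨by omega, by omega, by omega, h, by simp⟩
    · simp only [winf_neg, (s_apply_self hi).1, (s_apply_self hi).2]
      exact ⟨by omega, by omega, by omega, by omega, by simp⟩

theorem ncard_inversions_mul_s {i : ℕ} {w : Winf} (h : w.1 i < w.1 (i + 1)) :
    (inversions (w * s i)).ncard = (inversions w).ncard + 2 := by
  rw [inversions_mul_s h, Set.ncard_union_eq ?_ ((inversions_finite w).image _)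
    (Set.finite_of_ncard_pos (by rw [simpleInversions_ncard]; norm_num)),
    simpleInversions_ncard, Set.ncard_image_of_injective]
  · rintro ⟨a, b, t⟩ ⟨a', b', t'⟩ hr
    simp only [Prod.mk.injEq, EmbeddingLike.apply_eq_iff_eq] at hr
    simpa using hr
  · rw [Set.disjoint_left]
    rintro _ ⟨⟨a, b, t⟩, ⟨h1, h2, h3, h4, h5⟩, rfl⟩ hr
    dsimp only at h1 h4
    rw [mem_simpleInversions] at hr
    rcases hr with ⟨rfl, hr, hr'⟩ | ⟨hi, -, ⟨hr, hr'⟩ | ⟨hr, hr'⟩⟩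
    · have e1 := s_s_apply 0 a
      have e2 := s_s_apply 0 b
      rw [hr, winf_neg, s_zero_one] at e1
      rw [hr', s_zero_one] at e2
      omega
    · have e1 := s_s_apply i a
      have e2 := s_s_apply i b
      rw [hr, (s_apply_self hi).1] at e1
      rw [hr', (s_apply_self hi).2] at e2
      omega
    · have e1 := s_s_apply i a
      have e2 := s_s_apply i b
      rw [hr, winf_neg, (s_apply_self hi).2] at e1
      rw [hr', winf_neg, (s_apply_self hi).1] at e2
      omega

theorem lt_or_gt_apply_succ (w : Winf) (i : ℕ) :
    w.1 i < w.1 (i + 1) ∨ w.1 (i + 1) < w.1 i :=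
  lt_or_gt_of_ne fun h => by
    have := w.1.injective h
    omega

theorem mul_s_lt_iff {w : Winf} {i : ℕ} :
    (w * s i).1 i < (w * s i).1 (i + 1) ↔ w.1 (i + 1) < w.1 i := by
  rw [winf_mul_apply, winf_mul_apply]
  by_cases hi : i = 0
  · subst hi
    simp only [Nat.cast_zero, zero_add, s_zero_one, winf_neg, winf_zero]
    exact neg_pos
  · rw [(s_apply_self hi).1, (s_apply_self hi).2]

theorem ncard_inversions_mul_s' {i : ℕ} {w : Winf} (h : w.1 (i + 1) < w.1 i) :
    (inversions (w * s i)).ncard + 2 = (inversions w).ncard := by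
  rw [← ncard_inversions_mul_s (mul_s_lt_iff.2 h), mul_s_mul_s]

/-- Without descents `w` is strictly increasing on the natural numbers, starts at `w 0 = 0` and is
the identity far out. Strict growth from `0` gives `w i ≥ i`, and strict growth up to a fixed point
gives `w i ≤ i`. For `i = 0` a descent means `w 1 < 0`. -/
theorem exists_descent {w : Winf} (hw : w ≠ 1) : ∃ i : ℕ, w.1 (i + 1) < w.1 i := by
  by_contra! h
  have h' : ∀ i : ℕ, w.1 i < w.1 (i + 1) := fun i =>
    (lt_or_gt_apply_succ w i).resolve_right (not_lt.2 (h i))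
  obtain ⟨n, hn⟩ := exists_mem_W w
  have key : ∀ k i : ℕ, w.1 i + k ≤ w.1 (i + k) := by
    intro k
    induction k with
    | zero => simp
    | succ k ih =>
      intro i
      have h1 := ih i
      have h2 := h' (i + k)
      push_cast at h2 ⊢
      rw [← add_assoc, ← add_assoc]
      omega
  have hpos : ∀ i : ℕ, w.1 i = i := by
    intro i
    have h1 := key i 0
    have h2 := key (n + 1) i
    rw [hn ((i : ℤ) + (n + 1 : ℕ)) (by push_cast; rw [lt_abs]; omega)] at h2
    simp only [Nat.cast_zero, winf_zero, zero_add] at h1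
    push_cast at h2
    omega
  apply hw
  refine winf_ext fun z => ?_
  obtain ⟨m, rfl | rfl⟩ := z.eq_nat_or_neg
  · exact hpos m
  · rw [winf_neg, hpos]
    rfl

theorem inversions_one : inversions 1 = ∅ := by
  ext ⟨a, b, t⟩
  simp only [inversions, Set.mem_ofPred_eq, Set.mem_empty_iff_false, iff_false]
  rintro ⟨h1, -, -, h2, -⟩
  exact lt_asymm h1 h2

/-! ### Length as half the number of marked inversions -/

theorem ncard_inversions_prod_le (a : List ℕ) :
    (inversions (a.map s).prod).ncard ≤ 2 * a.length := by
  induction a using List.reverseRecOn with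
  | nil => simp [inversions_one]
  | append_singleton a i ih =>
    rw [List.map_append, List.prod_append, List.map_singleton, List.prod_singleton,
      List.length_append, List.length_singleton]
    rcases lt_or_gt_apply_succ (a.map s).prod i with h | h
    · rw [ncard_inversions_mul_s h]; omega
    · have := ncard_inversions_mul_s' h
      omega

theorem exists_word (w : Winf) :
    ∃ a : List ℕ, (a.map s).prod = w ∧ 2 * a.length = (inversions w).ncard := by
  obtain ⟨N, hN⟩ : ∃ N, (inversions w).ncard = N := ⟨_, rfl⟩
  induction N using Nat.strong_induction_on generalizing w with
  | _ N ih =>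
    by_cases hw : w = 1
    · exact ⟨[], by simp [hw], by simp [hw, inversions_one]⟩
    · obtain ⟨i, hi⟩ := exists_descent hw
      have h1 := ncard_inversions_mul_s' hi
      obtain ⟨a, ha, ha'⟩ := ih _ (by omega) (w * s i) rfl
      refine ⟨a ++ [i], ?_, ?_⟩
      · simp [ha, mul_s_mul_s]
      · rw [List.length_append, List.length_singleton]
        omega

theorem length_le {a : List ℕ} {w : Winf} (h : (a.map s).prod = w) : length w ≤ a.length :=
  Nat.sInf_le ⟨a, rfl, h⟩

theorem exists_reducedWord (w : Winf) : ∃ a, IsReducedWord a w := by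
  obtain ⟨a, ha, -⟩ := exists_word w
  obtain ⟨b, hb, hb'⟩ := Nat.sInf_mem
    (⟨_, a, rfl, ha⟩ : {k | ∃ a : List ℕ, a.length = k ∧ (a.map s).prod = w}.Nonempty)
  exact ⟨b, hb', hb⟩

/-- The pairs `(a, b)` and `(-b, -a)` represent the same inversion, and a pair `(-b, b)` is doubled
by its Boolean mark, so each inversion counts twice. A letter changes the count by 2 in either
direction, and a descent always allows the count to be lowered. -/
theorem two_mul_length (w : Winf) : 2 * length w = (inversions w).ncard := by
  apply le_antisymm
  · obtain ⟨a, ha, ha'⟩ := exists_word w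
    have := length_le ha
    omega
  · obtain ⟨a, rfl, ha⟩ := exists_reducedWord w
    rw [← ha]
    exact ncard_inversions_prod_le a

theorem length_mul_s {w : Winf} {i : ℕ} (h : w.1 i < w.1 (i + 1)) :
    length (w * s i) = length w + 1 := by
  have h1 := ncard_inversions_mul_s h
  rw [← two_mul_length, ← two_mul_length] at h1
  omega

theorem length_mul_s' {w : Winf} {i : ℕ} (h : w.1 (i + 1) < w.1 i) :
    length (w * s i) + 1 = length w := by
  have h1 := ncard_inversions_mul_s' h
  rw [← two_mul_length, ← two_mul_length] at h1
  omega

theorem length_mul_s_lt_iff {w : Winf} {i : ℕ} :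
    length (w * s i) < length w ↔ w.1 (i + 1) < w.1 i := by
  rcases lt_or_gt_apply_succ w i with h | h
  · have := length_mul_s h
    constructor <;> intro <;> omega
  · have := length_mul_s' h
    constructor <;> intro <;> omega

theorem length_mul_s_or (w : Winf) (i : ℕ) :
    length (w * s i) = length w + 1 ∨ length (w * s i) + 1 = length w :=
  (lt_or_gt_apply_succ w i).imp length_mul_s length_mul_s'

theorem length_one : length 1 = 0 := by
  have := two_mul_length 1
  rw [inversions_one, Set.ncard_empty] at this
  omega

theorem length_eq_zero {w : Winf} (h : length w = 0) : w = 1 := by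
  by_contra hw
  obtain ⟨i, hi⟩ := exists_descent hw
  have := length_mul_s' hi
  omega

theorem length_inv (w : Winf) : length w⁻¹ = length w := by
  have key : ∀ w : Winf, length w⁻¹ ≤ length w := by
    intro w
    obtain ⟨a, ha, ha'⟩ := exists_reducedWord w
    rw [← ha', ← List.length_reverse]
    apply length_le
    rw [← ha, List.prod_inv_reverse, List.map_map, List.map_reverse]
    congr 2
    exact List.map_congr_left fun i _ => (s_inv i).symm
  apply le_antisymm (key w)
  simpa using key w⁻¹

theorem length_s_mul (w : Winf) (i : ℕ) : length (s i * w) = length (w⁻¹ * s i) := by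
  rw [← length_inv, mul_inv_rev, s_inv]

theorem length_s_mul_or (w : Winf) (i : ℕ) :
    length (s i * w) = length w + 1 ∨ length (s i * w) + 1 = length w := by
  rw [length_s_mul, ← length_inv w]
  exact length_mul_s_or _ i

theorem length_mul_le (u v : Winf) : length (u * v) ≤ length u + length v := by
  obtain ⟨a, ha, ha'⟩ := exists_reducedWord u
  obtain ⟨b, hb, hb'⟩ := exists_reducedWord v
  rw [← ha', ← hb', ← List.length_append]
  exact length_le (by rw [List.map_append, List.prod_append, ha, hb])

theorem lt_of_descent {n : ℕ} {w : Winf} (hw : w ∈ W n) {i : ℕ} (h : w.1 (i + 1) < w.1 i) :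
    i < n := by
  by_contra hi
  have h1 := hw ((i : ℤ) + 1) (by rw [lt_abs]; omega)
  by_cases hi' : i = n
  · have := abs_le_of_mem_W hw (i := i) (by rw [abs_le]; omega)
    rw [abs_le] at this
    omega
  · have := hw (i : ℤ) (by rw [lt_abs]; omega)
    omega

/-! ### Reduced words -/

theorem isReducedWord_nil : IsReducedWord [] 1 := ⟨rfl, length_one.symm⟩

theorem IsReducedWord.snoc {a : List ℕ} {w : Winf} (h : IsReducedWord a w) {i : ℕ}
    (hi : w.1 i < w.1 (i + 1)) : IsReducedWord (a ++ [i]) (w * s i) :=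
  ⟨by simp [h.1], by rw [length_mul_s hi, ← h.2, List.length_append, List.length_singleton]⟩

theorem IsReducedWord.of_snoc {a : List ℕ} {w : Winf} {i : ℕ} (h : IsReducedWord (a ++ [i]) w) :
    IsReducedWord a (w * s i) ∧ w.1 (i + 1) < w.1 i := by
  have hp : (a.map s).prod = w * s i := by
    rw [← h.1]
    simp [mul_s_mul_s]
  have h2 := h.2
  rw [List.length_append, List.length_singleton] at h2
  have h3 := length_le hp
  have h4 : length (w * s i) < length w := by omega
  refine ⟨⟨hp, ?_⟩, length_mul_s_lt_iff.1 h4⟩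
  have := length_mul_s' (length_mul_s_lt_iff.1 h4)
  omega

theorem IsReducedWord.cons {a : List ℕ} {w : Winf} (h : IsReducedWord a w) {i : ℕ}
    (hi : length (s i * w) = length w + 1) : IsReducedWord (i :: a) (s i * w) :=
  ⟨by simp [h.1], by rw [hi, ← h.2, List.length_cons]⟩

theorem IsReducedWord.lt {n : ℕ} {a : List ℕ} {w : Winf} (h : IsReducedWord a w) (hw : w ∈ W n) :
    ∀ i ∈ a, i < n := by
  induction a using List.reverseRecOn generalizing w with
  | nil => simp
  | append_singleton a i ih =>
    obtain ⟨h1, h2⟩ := h.of_snoc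
    have hi := lt_of_descent hw h2
    intro j hj
    rw [List.mem_append, List.mem_singleton] at hj
    rcases hj with hj | rfl
    · exact ih h1 (mul_mem hw (s_mem_W hi)) j hj
    · exact hi

/-! ### The longest element -/

theorem w0_apply (n : ℕ) (i : ℤ) : (w0 n).1 i = if |i| ≤ (n : ℤ) then -i else i := rfl

theorem w0_mem_W (n : ℕ) : w0 n ∈ W n := fun i hi => by
  rw [w0_apply, if_neg (not_le.2 hi)]

theorem w0_mul_w0 (n : ℕ) : w0 n * w0 n = 1 := winf_ext fun i => by
  rw [winf_mul_apply, w0_apply n i]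
  split_ifs with h
  · rw [w0_apply, abs_neg, if_pos h, neg_neg]
    rfl
  · rw [w0_apply, if_neg h]
    rfl

theorem w0_inv (n : ℕ) : (w0 n)⁻¹ = w0 n := inv_eq_of_mul_eq_one_left (w0_mul_w0 n)

theorem mem_inversions_w0 {n : ℕ} {a b : ℤ} {t : Bool} : (a, b, t) ∈ inversions (w0 n) ↔
    a < b ∧ a ≠ 0 ∧ b ≠ 0 ∧ -(n : ℤ) ≤ a ∧ b ≤ n ∧ (t = true → a = -b) := by
  constructor
  · intro h
    have h' := inversions_subset (w0_mem_W n) h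
    simp only [Set.mem_prod, Set.mem_Icc] at h'
    exact ⟨h.1, h.2.1, h.2.2.1, h'.1.1, h'.2.1.2, h.2.2.2.2⟩
  · rintro ⟨h1, h2, h3, h4, h5, h6⟩
    refine ⟨h1, h2, h3, ?_, h6⟩
    dsimp only
    rw [w0_apply, w0_apply, if_pos (abs_le.2 ⟨by omega, h5⟩), if_pos (abs_le.2 ⟨h4, by omega⟩)]
    omega

theorem ncard_Icc_diff_zero {a b : ℤ} (ha : a ≤ 0) (hb : 0 ≤ b) :
    ((Set.Icc a b \ {0}).ncard : ℤ) = b - a := by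
  rw [Set.ncard_sdiff_singleton_of_mem (Set.mem_Icc.2 ⟨ha, hb⟩), Set.ncard_eq_toFinset_card' (Set.Icc a b),
    Set.toFinset_Icc, Int.card_Icc]
  omega

theorem inversions_w0_succ (n : ℕ) : inversions (w0 (n + 1)) = inversions (w0 n) ∪
    ((fun a : ℤ => (a, (n : ℤ) + 1, false)) '' (Set.Icc (-((n : ℤ) + 1)) n \ {0}) ∪
      ((fun b : ℤ => (-((n : ℤ) + 1), b, false)) '' (Set.Icc (-(n : ℤ)) n \ {0}) ∪
        {(-((n : ℤ) + 1), (n : ℤ) + 1, true)})) := by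
  ext ⟨a, b, t⟩
  simp only [Set.mem_union, mem_inversions_w0, Set.mem_image, Set.mem_sdiff, Set.mem_Icc,
    Set.mem_singleton_iff, Prod.mk.injEq, Nat.cast_add, Nat.cast_one]
  constructor
  · rintro ⟨h1, h2, h3, h4, h5, h6⟩
    by_cases hb : b = n + 1
    · cases t
      · exact Or.inr (Or.inl ⟨a, ⟨⟨by omega, by omega⟩, h2⟩, rfl, hb.symm, rfl⟩)
      · have := h6 rfl
        exact Or.inr (Or.inr (Or.inr ⟨by omega, hb, rfl⟩))
    · by_cases ha : a = -(n + 1)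
      · cases t
        · exact Or.inr (Or.inr (Or.inl ⟨b, ⟨⟨by omega, by omega⟩, h3⟩, ha.symm, rfl, rfl⟩))
        · have := h6 rfl
          omega
      · exact Or.inl ⟨h1, h2, h3, by omega, by omega, h6⟩
  · rintro (⟨h1, h2, h3, h4, h5, h6⟩ | ⟨a', ⟨⟨h1, h2⟩, h3⟩, rfl, rfl, rfl⟩ |
      ⟨b', ⟨⟨h1, h2⟩, h3⟩, rfl, rfl, rfl⟩ | ⟨rfl, rfl, rfl⟩)
    · exact ⟨h1, h2, h3, by omega, by omega, h6⟩
    · exact ⟨by omega, h3, by omega, by omega, by omega, by simp⟩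
    · exact ⟨by omega, by omega, h3, by omega, by omega, by simp⟩
    · exact ⟨by omega, by omega, by omega, by omega, by omega, by simp⟩

theorem ncard_inversions_w0 (n : ℕ) : (inversions (w0 n)).ncard = 2 * n ^ 2 := by
  induction n with
  | zero =>
    rw [show inversions (w0 0) = ∅ from ?_, Set.ncard_empty]
    · norm_num
    · ext ⟨a, b, t⟩
      rw [mem_inversions_w0]
      simp only [Set.mem_empty_iff_false, iff_false]
      rintro ⟨h1, h2, h3, h4, h5, -⟩
      push_cast at h4 h5
      omega
  | succ n ih =>
    have f1 : ((fun a : ℤ => (a, (n : ℤ) + 1, false)) '' (Set.Icc (-((n : ℤ) + 1)) n \ {0})).Finite :=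
      ((Set.finite_Icc _ _).sdiff).image _
    have f2 : ((fun b : ℤ => (-((n : ℤ) + 1), b, false)) '' (Set.Icc (-(n : ℤ)) n \ {0})).Finite :=
      ((Set.finite_Icc _ _).sdiff).image _
    have i1 := ncard_Icc_diff_zero (a := -((n : ℤ) + 1)) (b := n) (by omega) (by omega)
    have i2 := ncard_Icc_diff_zero (a := -(n : ℤ)) (b := n) (by omega) (by omega)
    -- The new elements number `2n + 1` with larger entry `n + 1`, `2n` with smaller entry `-(n +
    -- 1)` only, and one marked pair. Together these are `4n + 2 = 2 ((n + 1)² - n²)`.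
    rw [inversions_w0_succ, Set.ncard_union_eq ?_ (inversions_finite _)
        (f1.union (f2.union (Set.finite_singleton _))), ih,
      Set.ncard_union_eq ?_ f1 (f2.union (Set.finite_singleton _)),
      Set.ncard_union_eq ?_ f2 (Set.finite_singleton _), Set.ncard_singleton,
      Set.ncard_image_of_injective, Set.ncard_image_of_injective]
    · zify
      rw [i1, i2]
      ring
    · intro a b h
      simpa using h
    · intro a b h
      simpa using h
    · rw [Set.disjoint_singleton_right]
      rintro ⟨b, -, hb⟩
      simp at hb
    · rw [Set.disjoint_left]
      rintro _ ⟨a, -, rfl⟩ (⟨b, ⟨hb, -⟩, hb'⟩ | h)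
      · simp only [Prod.mk.injEq, Set.mem_Icc] at hb hb'
        omega
      · simp at h
    · rw [Set.disjoint_left]
      rintro ⟨a, b, t⟩ hab h
      rw [mem_inversions_w0] at hab
      rcases h with ⟨a', -, h⟩ | ⟨b', -, h⟩ | h
      · simp only [Prod.mk.injEq] at h
        omega
      · simp only [Prod.mk.injEq] at h
        omega
      · simp only [Set.mem_singleton_iff, Prod.mk.injEq] at h
        omega

theorem length_w0 (n : ℕ) : length (w0 n) = n ^ 2 := by
  have := two_mul_length (w0 n)
  rw [ncard_inversions_w0] at this
  omega

theorem w0_mul_apply_lt_iff {n : ℕ} {w : Winf} (hw : w ∈ W n) {i : ℕ} (hi : i < n) :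
    (w0 n * w).1 i < (w0 n * w).1 (i + 1) ↔ w.1 (i + 1) < w.1 i := by
  rw [winf_mul_apply, winf_mul_apply, w0_apply, w0_apply,
    if_pos (abs_le_of_mem_W hw (abs_le.2 ⟨by omega, by omega⟩)),
    if_pos (abs_le_of_mem_W hw (abs_le.2 ⟨by omega, by omega⟩))]
  omega

/-- Left multiplication by `w0 n` negates all values in the window, hence exchanges ascents and
descents at `i < n`. Removing a descent from `w` adds a letter to `w0 n * w`. -/
theorem length_w0_mul {n : ℕ} {w : Winf} (hw : w ∈ W n) :
    length (w0 n * w) + length w = n ^ 2 := by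
  obtain ⟨N, hN⟩ : ∃ N, length w = N := ⟨_, rfl⟩
  induction N generalizing w with
  | zero => rw [length_eq_zero hN, mul_one, length_one, length_w0, add_zero]
  | succ N ih =>
    have hw1 : w ≠ 1 := by
      rintro rfl
      rw [length_one] at hN
      omega
    obtain ⟨i, hi⟩ := exists_descent hw1
    have hin := lt_of_descent hw hi
    have h1 := length_mul_s' hi
    have h2 := length_mul_s ((w0_mul_apply_lt_iff hw hin).2 hi)
    have h3 := ih (mul_mem hw (s_mem_W hin)) (by omega)
    rw [← mul_assoc] at h3
    omega

theorem length_inv_mul_w0 {n : ℕ} {w : Winf} (hw : w ∈ W n) :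
    length (w⁻¹ * w0 n) + length w = n ^ 2 := by
  rw [← length_inv (w⁻¹ * w0 n), mul_inv_rev, inv_inv, w0_inv, length_w0_mul hw]

theorem exists_ascent {n : ℕ} {w : Winf} (hw : w ∈ W n) (h : w ≠ w0 n) :
    ∃ i < n, w.1 i < w.1 (i + 1) := by
  have h1 : w0 n * w ≠ 1 := fun h1 => h (by
    rw [← w0_inv n]
    exact eq_inv_of_mul_eq_one_right h1)
  obtain ⟨i, hi⟩ := exists_descent h1
  have hin := lt_of_descent (mul_mem (w0_mem_W n) hw) hi
  refine ⟨i, hin, (lt_or_gt_apply_succ w i).resolve_right fun h2 => ?_⟩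
  have := (w0_mul_apply_lt_iff hw hin).2 h2
  omega

/-! ### Independence of the reduced word -/

theorem winf_ext_nat {v w : Winf} (h : ∀ i : ℕ, v.1 i = w.1 i) : v = w := winf_ext fun z => by
  obtain ⟨m, rfl | rfl⟩ := z.eq_nat_or_neg
  · exact h m
  · rw [winf_neg, winf_neg, h]

theorem s_succ_natCast (k m : ℕ) :
    (s (k + 1)).1 m = (Equiv.swap (k + 1) (k + 2) m : ℕ) := by
  rw [s_succ_apply, Equiv.swap_apply_def]
  split_ifs <;> push_cast <;> omega

theorem s_comm {i j : ℕ} (h : i + 2 ≤ j) : s i * s j = s j * s i := by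
  refine winf_ext_nat fun z => ?_
  obtain ⟨j, rfl⟩ := Nat.exists_eq_add_of_le h
  rw [winf_mul_apply, winf_mul_apply]
  cases i with
  | zero =>
    rw [show 0 + 2 + j = j + 1 + 1 by ring, s_succ_natCast, s_zero_apply, s_zero_apply]
    simp only [Equiv.swap_apply_def]
    split_ifs <;> first | omega | (simp only [s_succ_apply]; push_cast; split_ifs <;> omega)
  | succ i =>
    rw [show i + 1 + 2 + j = i + 2 + j + 1 by ring]
    simp only [s_succ_natCast]
    congr 1
    simp only [Equiv.swap_apply_def]
    split_ifs <;> omega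

theorem s_braid (k : ℕ) :
    s (k + 1) * s (k + 2) * s (k + 1) = s (k + 2) * s (k + 1) * s (k + 2) := by
  refine winf_ext_nat fun z => ?_
  simp only [winf_mul_apply, s_succ_natCast]
  congr 1
  simp only [Equiv.swap_apply_def]
  split_ifs <;> omega

theorem s_braid_zero : s 0 * s 1 * s 0 * s 1 = s 1 * s 0 * s 1 * s 0 := by
  refine winf_ext_nat fun z => ?_
  obtain rfl | rfl | h : z = 1 ∨ z = 2 ∨ (z ≠ 1 ∧ z ≠ 2) := by omega
  · simp [winf_mul_apply, s_succ_apply, s_zero_apply]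
  · simp [winf_mul_apply, s_succ_apply, s_zero_apply]
  · have h0 : (s 0).1 z = z := by
      rw [s_zero_apply, if_neg (by omega), if_neg (by omega)]
    have h1 : (s 1).1 z = z := by
      rw [show s 1 = s (0 + 1) from rfl, s_succ_natCast, Equiv.swap_apply_of_ne_of_ne h.1 h.2]
    simp only [winf_mul_apply, h0, h1]

/-- Two reduced words of `w` that end in different letters `i < j` are joined, through words
that end in `i` and in `j`, by a braid relation. -/
theorem exists_braid {w : Winf} {i j : ℕ} (hij : i < j) (hi : w.1 (i + 1) < w.1 i)
    (hj : w.1 (j + 1) < w.1 j) : ∃ e p q : List ℕ, IsReducedWord (e ++ p) (w * s i) ∧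
      IsReducedWord (e ++ q) (w * s j) ∧
      ∀ f ∈ ZX, (p ++ [i]).foldr ddx f = (q ++ [j]).foldr ddx f := by
  by_cases h2 : i + 2 ≤ j
  · obtain ⟨e, he⟩ := exists_reducedWord (w * s i * s j)
    have hj' : (w * s i).1 (j + 1) < (w * s i).1 j := by
      have e1 : (s i).1 j = j := by
        cases i with
        | zero => rw [s_zero_apply, if_neg (by omega), if_neg (by omega)]
        | succ k => rw [s_succ_apply]; split_ifs <;> omega
      have e2 : (s i).1 (j + 1) = j + 1 := by
        cases i with
        | zero => rw [s_zero_apply, if_neg (by omega), if_neg (by omega)]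
        | succ k => rw [s_succ_apply]; split_ifs <;> omega
      rwa [winf_mul_apply, winf_mul_apply, e1, e2]
    have r1 := he.snoc (mul_s_lt_iff.2 hj')
    have hc : w * s i * s j = w * s j * s i := by rw [mul_assoc, s_comm h2, mul_assoc]
    have hi' : (w * s j).1 (i + 1) < (w * s j).1 i := by
      rw [← length_mul_s_lt_iff, ← hc]
      have := length_mul_s' hi
      have := length_mul_s' hj
      have := length_mul_s' hj'
      omega
    rw [hc] at he
    have r2 := he.snoc (mul_s_lt_iff.2 hi')
    rw [mul_s_mul_s] at r1 r2
    exact ⟨e, [j], [i], r1, r2, fun f hf => by simp [ddx_comm h2 hf]⟩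
  · obtain rfl : j = i + 1 := by omega
    cases i with
    | zero =>
      simp only [Nat.cast_zero, zero_add, winf_zero, Nat.cast_one] at hi hj
      rw [show (1 : ℤ) + 1 = 2 from rfl] at hj
      have t1 : (s 1).1 1 = 2 := by simp [s_succ_apply]
      have t2 : (s 1).1 2 = 1 := by simp [s_succ_apply]
      have t3 : (s 0).1 2 = 2 := by simp [s_zero_apply]
      -- Multiplication by the longest element of the dihedral group `⟨s 0, s 1⟩` gives the shortest
      -- representative `u` of the coset of `w`. From `u` one climbs back to `w` along either of the
      -- two alternating words, checking an ascent at each letter.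
      obtain ⟨u, hu⟩ : ∃ u, u = w * (s 0 * s 1 * s 0 * s 1) := ⟨_, rfl⟩
      have hu1 : u.1 1 = -w.1 1 := by simp [hu, winf_mul_apply, t1, t2, t3, s_zero_one, winf_neg]
      have hu2 : u.1 2 = -w.1 2 := by simp [hu, winf_mul_apply, t1, t2, t3, s_zero_one, winf_neg]
      have hw : w = u * s 1 * s 0 * s 1 * s 0 := by
        rw [hu]
        simp only [← mul_assoc, mul_s_mul_s]
      have hw' : w = u * s 0 * s 1 * s 0 * s 1 := by
        rw [hu, s_braid_zero]
        simp only [← mul_assoc, mul_s_mul_s]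
      obtain ⟨e, he⟩ := exists_reducedWord u
      have r1 := ((he.snoc (i := 1) (by
          simp only [Nat.cast_one, show (1 : ℤ) + 1 = 2 from rfl, hu1, hu2]; omega)).snoc
        (i := 0) (by simp [winf_mul_apply, winf_zero, t1, hu2]; omega)).snoc (i := 1) (by
          simp only [Nat.cast_one, show (1 : ℤ) + 1 = 2 from rfl, winf_mul_apply, s_zero_one,
            winf_neg, t1, t2, t3, hu1, hu2]; omega)
      have r2 := ((he.snoc (i := 0) (by
          simp [winf_zero, hu1]; omega)).snoc (i := 1) (by
          simp only [Nat.cast_one, show (1 : ℤ) + 1 = 2 from rfl, winf_mul_apply, s_zero_one,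
            winf_neg, t1, t2, t3, hu1, hu2]; omega)).snoc (i := 0) (by
          simp [winf_mul_apply, winf_zero, t1, t3, hu2]; omega)
      refine ⟨e, [1, 0, 1], [0, 1, 0], ?_, ?_, fun f hf => ?_⟩
      · rw [hw, mul_s_mul_s]
        simpa using r1
      · rw [hw', mul_s_mul_s]
        simpa using r2
      · simp [ddx_braid_zero hf]
    | succ k =>
      push_cast at hi hj
      rw [show (k : ℤ) + 1 + 1 = k + 2 by ring] at hi hj
      rw [show (k : ℤ) + 2 + 1 = k + 3 by ring] at hj
      have a1 : (s (k + 1)).1 (k + 1) = k + 2 := by rw [s_succ_apply]; split_ifs <;> omega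
      have a2 : (s (k + 1)).1 (k + 2) = k + 1 := by rw [s_succ_apply]; split_ifs <;> omega
      have a3 : (s (k + 1)).1 (k + 3) = k + 3 := by rw [s_succ_apply]; split_ifs <;> omega
      have b1 : (s (k + 1 + 1)).1 (k + 1) = k + 1 := by
        rw [s_succ_apply]; push_cast; split_ifs <;> omega
      have b2 : (s (k + 1 + 1)).1 (k + 2) = k + 3 := by
        rw [s_succ_apply]; push_cast; split_ifs <;> omega
      have b3 : (s (k + 1 + 1)).1 (k + 3) = k + 2 := by
        rw [s_succ_apply]; push_cast; split_ifs <;> omega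
      -- Again `u` is the shortest representative of the coset of `w`, now for the symmetric group
      -- `⟨s (k + 1), s (k + 2)⟩`.
      obtain ⟨u, hu⟩ : ∃ u, u = w * (s (k + 1) * s (k + 1 + 1) * s (k + 1)) := ⟨_, rfl⟩
      have hu1 : u.1 (k + 1) = w.1 (k + 3) := by
        simp only [hu, winf_mul_apply, a1, a2, a3, b1, b2, b3]
      have hu2 : u.1 (k + 2) = w.1 (k + 2) := by
        simp only [hu, winf_mul_apply, a1, a2, a3, b1, b2, b3]
      have hu3 : u.1 (k + 3) = w.1 (k + 1) := by
        simp only [hu, winf_mul_apply, a1, a2, a3, b1, b2, b3]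
      have hw : w = u * s (k + 1) * s (k + 1 + 1) * s (k + 1) := by
        rw [hu]
        simp only [← mul_assoc, mul_s_mul_s]
      have hw' : w = u * s (k + 1 + 1) * s (k + 1) * s (k + 1 + 1) := by
        rw [hu, s_braid]
        simp only [← mul_assoc, mul_s_mul_s]
      have c1 : ((k + 1 : ℕ) : ℤ) = k + 1 := by push_cast; ring
      have c1' : (k : ℤ) + 1 + 1 = k + 2 := by ring
      have c2 : ((k + 1 + 1 : ℕ) : ℤ) = k + 2 := by push_cast; ring
      have c2' : (k : ℤ) + 2 + 1 = k + 3 := by ring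
      obtain ⟨e, he⟩ := exists_reducedWord u
      have r1 := (he.snoc (i := k + 1) (by rw [c1, c1', hu1, hu2]; omega)).snoc
        (i := k + 1 + 1) (by
          simp only [c2, c2', winf_mul_apply, a1, a2, a3, hu1, hu3]; omega)
      have r2 := (he.snoc (i := k + 1 + 1) (by rw [c2, c2', hu2, hu3]; omega)).snoc
        (i := k + 1) (by
          simp only [c1, c1', winf_mul_apply, b1, b2, b3, hu1, hu3]; omega)
      refine ⟨e, [k + 1, k + 1 + 1], [k + 1 + 1, k + 1], ?_, ?_, fun f hf => ?_⟩
      · rw [hw, mul_s_mul_s]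
        simpa using r1
      · rw [hw', mul_s_mul_s]
        simpa using r2
      · simpa using ddx_braid k hf

/-- This is Matsumoto's argument by induction on the length. If the last letters agree, that letter
is removed. Otherwise both words are compared, through words with the same last letters, to two
words joined by a single braid relation. -/
theorem foldr_ddx_eq {a b : List ℕ} {w : Winf} (ha : IsReducedWord a w) (hb : IsReducedWord b w)
    {f : GammaXY} (hf : f ∈ ZX) : a.foldr ddx f = b.foldr ddx f := by
  obtain ⟨N, hN⟩ : ∃ N, length w = N := ⟨_, rfl⟩
  induction N generalizing w a b f with
  | zero =>
    have h1 := ha.2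
    have h2 := hb.2
    rw [hN] at h1 h2
    rw [List.length_eq_zero_iff.1 h1, List.length_eq_zero_iff.1 h2]
  | succ N ih =>
    have hne : ∀ {a : List ℕ}, IsReducedWord a w → a ≠ [] := by
      rintro _ h rfl
      have := h.2
      rw [hN] at this
      simp at this
    obtain ⟨a, i, rfl⟩ := (List.eq_nil_or_concat' a).resolve_left (hne ha)
    obtain ⟨b, j, rfl⟩ := (List.eq_nil_or_concat' b).resolve_left (hne hb)
    obtain ⟨ha', hi⟩ := ha.of_snoc
    obtain ⟨hb', hj⟩ := hb.of_snoc
    have key : ∀ {a b : List ℕ} {i j : ℕ}, i < j → IsReducedWord a (w * s i) →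
        IsReducedWord b (w * s j) → w.1 (i + 1) < w.1 i → w.1 (j + 1) < w.1 j →
        (a ++ [i]).foldr ddx f = (b ++ [j]).foldr ddx f := by
      intro a b i j hij ha hb hi hj
      obtain ⟨e, p, q, h1, h2, h3⟩ := exists_braid hij hi hj
      have li := length_mul_s' hi
      have lj := length_mul_s' hj
      rw [List.foldr_append, List.foldr_append]
      have e1 := ih ha h1 (f := [i].foldr ddx f) (ddx_mem_ZX i hf) (by omega)
      have e2 := ih hb h2 (f := [j].foldr ddx f) (ddx_mem_ZX j hf) (by omega)
      have e3 := h3 f hf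
      rw [List.foldr_append, List.foldr_append] at e3
      rw [e1, e2, List.foldr_append, List.foldr_append, e3]
    rcases lt_trichotomy i j with h | rfl | h
    · exact key h ha' hb' hi hj
    · have li := length_mul_s' hi
      rw [List.foldr_append, List.foldr_append]
      exact ih ha' hb' (ddx_mem_ZX i hf) (by omega)
    · exact (key h hb' ha' hj hi).symm

instance : Nontrivial GammaXY := ⟨0, 1, fun h => by simpa using congrArg constTerm h⟩

/-! ## The series of the `ⁿc_p` -/

/-- The series `∑ ⁿc_p t^p`. -/
def ncSer (n : ℕ) : PowerSeries GammaXY := PowerSeries.mk (nc n)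

theorem coeff_prod_lin (n j : ℕ) :
    PowerSeries.coeff j (∏ i ∈ Finset.range n, lin (x i)) = e n j := by
  simp only [lin]
  rw [Finset.prod_one_add, map_sum, e, Finset.powersetCard_eq_filter, Finset.sum_filter]
  refine Finset.sum_congr rfl fun t _ => ?_
  rw [Finset.prod_mul_distrib, Finset.prod_const, ← map_prod, PowerSeries.coeff_C_mul,
    PowerSeries.coeff_X_pow]
  simp only [eq_comm (a := j), mul_ite, mul_one, mul_zero]

theorem ncSer_eq (n : ℕ) : ncSer n = (∏ i ∈ Finset.range n, lin (x i)) * cSer := by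
  ext p : 1
  rw [PowerSeries.coeff_mul, Finset.Nat.sum_antidiagonal_eq_sum_range_succ_mk, ncSer,
    PowerSeries.coeff_mk, nc]
  refine Finset.sum_congr rfl fun j _ => ?_
  rw [coeff_prod_lin, cSer, PowerSeries.coeff_mk, mul_comm]

theorem nc_zero (n : ℕ) : nc n 0 = 1 := by
  simp [nc, e, c_zero]

/-- The reflection `s_0` replaces the factor `1 + x_1 t` by `1 - x_1 t`, and this is exactly
compensated by the factor `(1 + x_1 t) / (1 - x_1 t)` that it produces on `c(t)`. The other
reflections only permute the linear factors. -/
theorem map_act_ncSer {n i : ℕ} (h : i < n) : PowerSeries.map (act i) (ncSer n) = ncSer n := by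
  cases i with
  | zero =>
    obtain ⟨m, rfl⟩ := Nat.exists_eq_succ_of_ne_zero (Nat.ne_of_gt h)
    rw [ncSer_eq, map_mul, map_prod, Nat.succ_eq_add_one, Finset.prod_range_succ',
      Finset.prod_range_succ']
    simp only [map_lin, act_x_zero, Nat.add_eq_zero_iff, one_ne_zero, and_false, if_false, if_true]
    rw [mul_assoc, mul_assoc, lin_mul_map_act_cSer]
  | succ k =>
    rw [ncSer_eq, map_mul, map_prod]
    congr 1
    · simp only [map_lin, act_x_succ]
      refine Finset.prod_equiv (Equiv.swap k (k + 1)) (fun j => ?_) fun j _ => rfl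
      simp only [Finset.mem_range, Equiv.swap_apply_def]
      split_ifs <;> omega
    · ext p : 1
      simp [cSer, act_c_succ]

theorem act_nc {n i : ℕ} (h : i < n) (p : ℕ) : act i (nc n p) = nc n p := by
  simpa [ncSer] using congrArg (PowerSeries.coeff p) (map_act_ncSer h)

open PowerSeries in
theorem evalNegHom_lin (a : GammaXY) : evalNegHom (lin a) = lin (-a) := by
  ext p : 1
  rw [evalNegHom, coeff_rescale, lin, lin]
  simp only [map_add, coeff_C_mul, coeff_one, coeff_X]
  split_ifs <;> simp_all

-- Since the relations of `Γ` amount to `c(t) c(-t) = 1`, only the products `(1 + x_j t)(1 - x_j t)`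
-- survive. Hence the elementary symmetric polynomials of the `x_j²` are integral polynomials in the
-- `ⁿc_p`.
open PowerSeries in
theorem ncSer_mul_evalNegHom (n : ℕ) : ncSer n * evalNegHom (ncSer n) =
    ∏ j ∈ Finset.range n, (1 - PowerSeries.C (x j ^ 2) * X ^ 2) := by
  have h : cSer * evalNegHom cSer = 1 := by
    refine (qRel_eq_zero_iff (fun p => MvPolynomial.C (c p)) (by simp [c_zero])).1 fun p hp => ?_
    have h := map_qRel (MvPolynomial.C : Gamma →+* GammaXY) c p
    rw [qRel_c hp, map_zero] at h
    exact h.symm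
  rw [ncSer_eq, map_mul, map_prod, mul_mul_mul_comm, h, mul_one, ← Finset.prod_mul_distrib]
  refine Finset.prod_congr rfl fun j _ => ?_
  rw [evalNegHom_lin, lin, lin]
  simp only [map_neg, map_pow]
  ring

/-! ## A spanning set over the ring of theta polynomials -/

section Span

variable (S : Subring GammaXY) (n : ℕ)

theorem coeff_mul_mem {S : Subring GammaXY} {f g : PowerSeries GammaXY}
    (hf : ∀ p, PowerSeries.coeff p f ∈ S) (hg : ∀ p, PowerSeries.coeff p g ∈ S) (p : ℕ) :
    PowerSeries.coeff p (f * g) ∈ S := by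
  rw [PowerSeries.coeff_mul]
  exact sum_mem fun _ _ => mul_mem (hf _) (hg _)

theorem coeff_mem_of_lin_mul {S : Subring GammaXY} {a : GammaXY} (ha : a ∈ S)
    {f : PowerSeries GammaXY} (hf : ∀ p, PowerSeries.coeff p (lin a * f) ∈ S) (p : ℕ) :
    PowerSeries.coeff p f ∈ S := by
  induction p with
  | zero =>
    have := hf 0
    rwa [coeff_lin_mul_zero] at this
  | succ p ih =>
    have := hf (p + 1)
    rw [coeff_lin_mul_succ] at this
    simpa using sub_mem this (mul_mem ha ih)

/-- Linear factors with constant term 1 can be divided out recursively without leaving the ring.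
This is how the `c_p` are recovered from the `ⁿc_p` and the `x_j`. -/
theorem coeff_mem_of_prod_lin_mul {ι : Type*} {S : Subring GammaXY} (t : Finset ι) {a : ι → GammaXY}
    (ha : ∀ j ∈ t, a j ∈ S) {f : PowerSeries GammaXY}
    (hf : ∀ p, PowerSeries.coeff p ((∏ j ∈ t, lin (a j)) * f) ∈ S) (p : ℕ) :
    PowerSeries.coeff p f ∈ S := by
  classical
  induction t using Finset.induction_on generalizing p with
  | empty => simpa using hf p
  | insert j t hj ih =>
    refine ih (fun i hi => ha i (Finset.mem_insert_of_mem hi)) (fun p => ?_) p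
    refine coeff_mem_of_lin_mul (ha j (Finset.mem_insert_self _ _)) (fun p => ?_) p
    have := hf p
    rwa [Finset.prod_insert hj, mul_assoc] at this

/-- The subring generated by `S` and `x_1, …, x_k`. -/
def extX (k : ℕ) : Subring GammaXY := Subring.closure (S ∪ x '' {j | j < k})

theorem le_extX (k : ℕ) : S ≤ extX S k := fun _ hf => Subring.subset_closure (Or.inl hf)

theorem x_mem_extX {j k : ℕ} (h : j < k) : x j ∈ extX S k :=
  Subring.subset_closure (Or.inr ⟨j, h, rfl⟩)

theorem extX_mono {j k : ℕ} (h : j ≤ k) : extX S j ≤ extX S k :=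
  Subring.closure_mono (Set.union_subset_union_right _
    (Set.image_mono fun _ (hi : _ < _) => lt_of_lt_of_le hi h))

/-- The polynomial `∏ (z² - x_j²)`, `k < j ≤ n`. -/
def sqPoly (k : ℕ) : Polynomial GammaXY :=
  ∏ j ∈ Finset.Ico k n, (Polynomial.X ^ 2 - Polynomial.C (x j ^ 2))

theorem monic_sq (j : ℕ) :
    (Polynomial.X ^ 2 - Polynomial.C (x j ^ 2) : Polynomial GammaXY).Monic :=
  Polynomial.monic_X_pow_sub_C _ (by norm_num)

theorem sqPoly_monic (k : ℕ) : (sqPoly n k).Monic :=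
  Polynomial.monic_prod_of_monic _ _ fun j _ => monic_sq j

theorem sqPoly_natDegree (k : ℕ) : (sqPoly n k).natDegree = 2 * (n - k) := by
  rw [sqPoly, Polynomial.natDegree_prod_of_monic _ _ fun j _ => monic_sq j]
  simp only [Polynomial.natDegree_X_pow_sub_C, Finset.sum_const, Nat.card_Ico, smul_eq_mul,
    mul_comm]

theorem sqPoly_succ {k : ℕ} (h : k < n) :
    sqPoly n k = (Polynomial.X ^ 2 - Polynomial.C (x k ^ 2)) * sqPoly n (k + 1) := by
  rw [sqPoly, Finset.prod_eq_prod_Ico_succ_bot h, sqPoly]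

theorem reflect_sqPoly : Polynomial.reflect (2 * n) (sqPoly n 0) =
    ∏ j ∈ Finset.range n, (1 - Polynomial.C (x j ^ 2) * Polynomial.X ^ 2) := by
  rw [sqPoly, ← Finset.range_eq_Ico]
  have key : ∀ m, (∏ j ∈ Finset.range m,
      (Polynomial.X ^ 2 - Polynomial.C (x j ^ 2)) : Polynomial GammaXY).natDegree ≤ 2 * m := by
    intro m
    have := sqPoly_natDegree m 0
    rw [sqPoly, ← Finset.range_eq_Ico] at this
    omega
  induction n with
  | zero => simp
  | succ m ih =>
    rw [Finset.prod_range_succ, Finset.prod_range_succ, mul_add, mul_one,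
      Polynomial.reflect_mul _ _ (key m) (Polynomial.natDegree_X_pow_sub_C).le, ih,
      Polynomial.reflect_sub, ← Polynomial.monomial_zero_left, ← Polynomial.C_mul_X_pow_eq_monomial,
      ← one_mul (Polynomial.X ^ 2 : Polynomial GammaXY), ← Polynomial.C_1,
      Polynomial.reflect_C_mul_X_pow, Polynomial.reflect_C_mul_X_pow]
    simp

variable {S n}

/-- For `k = 0` the coefficients are, in reversed order, those of `ⁿc(t) ⁿc(-t)`. Each further step
divides by a monic polynomial `z² - x_j²` with coefficients in the enlarged ring, and division by a
monic polynomial stays in that ring. -/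
theorem sqPoly_mem_lifts (hS : ∀ p, nc n p ∈ S) (k : ℕ) (hk : k ≤ n) :
    sqPoly n k ∈ Polynomial.lifts (extX S k).subtype := by
  induction k with
  | zero =>
    rw [Polynomial.lifts_iff_coeff_lifts]
    intro i
    simp only [Subring.coe_subtype, Subtype.range_coe_subtype]
    apply le_extX
    have h : (sqPoly n 0).coeff i =
        (Polynomial.reflect (2 * n) (sqPoly n 0)).coeff (Polynomial.revAt (2 * n) i) := by
      rw [Polynomial.coeff_reflect, Polynomial.revAt_invol]
    rw [h, reflect_sqPoly, ← Polynomial.coeff_coe]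
    have h' := ncSer_mul_evalNegHom n
    have h'' : ((∏ j ∈ Finset.range n, (1 - Polynomial.C (x j ^ 2) * Polynomial.X ^ 2) :
        Polynomial GammaXY) : PowerSeries GammaXY) = ncSer n * PowerSeries.evalNegHom (ncSer n) := by
      rw [h', ← Polynomial.coeToPowerSeries.ringHom_apply, map_prod]
      simp
    rw [h'']
    refine coeff_mul_mem (fun p => ?_) (fun p => ?_) _
    · simpa [ncSer] using hS p
    · rw [PowerSeries.evalNegHom, PowerSeries.coeff_rescale, ncSer, PowerSeries.coeff_mk]
      exact mul_mem (pow_mem (neg_mem (one_mem _)) _) (hS p)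
  | succ k ih =>
    have h1 : sqPoly n k ∈ Polynomial.lifts (extX S (k + 1)).subtype := by
      have := ih (by omega)
      rw [Polynomial.lifts_iff_coeff_lifts] at this ⊢
      intro i
      simp only [Subring.coe_subtype, Subtype.range_coe_subtype] at this ⊢
      exact extX_mono S (Nat.le_succ k) (this i)
    obtain ⟨P, hP⟩ := (Polynomial.mem_lifts _).1 h1
    let a : extX S (k + 1) := ⟨x k, x_mem_extX S (Nat.lt_succ_self k)⟩
    have hD : (Polynomial.X ^ 2 - Polynomial.C (a ^ 2)).Monic :=
      Polynomial.monic_X_pow_sub_C _ (by norm_num)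
    refine (Polynomial.mem_lifts _).2 ⟨P /ₘ (Polynomial.X ^ 2 - Polynomial.C (a ^ 2)), ?_⟩
    rw [Polynomial.map_divByMonic _ hD, hP, sqPoly_succ n (by omega)]
    have : Polynomial.map (extX S (k + 1)).subtype (Polynomial.X ^ 2 - Polynomial.C (a ^ 2)) =
        Polynomial.X ^ 2 - Polynomial.C (x k ^ 2) := by
      simp [a]
    rw [this, Polynomial.mul_divByMonic_cancel_left _ (monic_sq k)]

variable (S n)

/-- The `S`-span of a set. -/
def spanOver (T : Set GammaXY) : AddSubgroup GammaXY :=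
  AddSubgroup.closure {f | ∃ g ∈ S, ∃ m ∈ T, f = g * m}

/-- The monomials `∏ x_j ^ (a j)`, `j < k`, with `a j < 2 (n - j)`. -/
def boundedMon (k : ℕ) : Set GammaXY :=
  {m | ∃ a : ℕ → ℕ, (∀ j < k, a j < 2 * (n - j)) ∧ m = ∏ j ∈ Finset.range k, x j ^ a j}

variable {S n}

/-- The next variable is a root of the monic polynomial `sqPoly n k` of degree `2 (n - k)` over the
ring generated so far, so division with remainder bounds its exponent. This is done for one variable
after another. -/
theorem extX_le_spanOver (hS : ∀ p, nc n p ∈ S) (k : ℕ) (hk : k ≤ n) {f : GammaXY}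
    (hf : f ∈ extX S k) : f ∈ spanOver S (boundedMon n k) := by
  induction k generalizing f with
  | zero =>
    have : f ∈ S := by
      simpa [extX] using hf
    exact AddSubgroup.subset_closure ⟨f, this, 1, ⟨fun _ => 0, by simp, by simp⟩, by simp⟩
  | succ k ih =>
    have h1 : extX S (k + 1) ≤
        (Polynomial.eval₂RingHom (extX S k).subtype (x k)).range := by
      refine Subring.closure_le.2 (Set.union_subset ?_ ?_)
      · intro g hg
        exact ⟨Polynomial.C ⟨g, le_extX S k hg⟩, by simp⟩
      · rintro _ ⟨j, hj, rfl⟩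
        by_cases h : j = k
        · exact ⟨Polynomial.X, by simp [h]⟩
        · exact ⟨Polynomial.C ⟨x j, x_mem_extX S (lt_of_le_of_ne (Nat.lt_succ_iff.1 hj) h)⟩,
            by simp⟩
    obtain ⟨q, rfl⟩ := h1 hf
    obtain ⟨P, hP, hdeg, hmon⟩ := Polynomial.lifts_and_degree_eq_and_monic
      (sqPoly_mem_lifts hS k (by omega)) (sqPoly_monic n k)
    have hroot : Polynomial.eval₂ (extX S k).subtype (x k) P = 0 := by
      rw [← Polynomial.eval_map, hP, sqPoly_succ n (by omega)]
      simp
    have hq : Polynomial.eval₂ (extX S k).subtype (x k) q =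
        Polynomial.eval₂ (extX S k).subtype (x k) (q %ₘ P) := by
      conv_lhs => rw [← Polynomial.modByMonic_add_div q P]
      rw [Polynomial.eval₂_add, Polynomial.eval₂_mul, hroot, zero_mul, add_zero]
    have hlt : (q %ₘ P).natDegree < 2 * (n - k) := by
      have h2 : P.natDegree = 2 * (n - k) := by
        rw [← sqPoly_natDegree n k]
        exact Polynomial.natDegree_eq_natDegree hdeg
      rw [← h2]
      refine Polynomial.natDegree_modByMonic_lt _ hmon fun h => ?_
      rw [h] at h2
      simp at h2
      omega
    rw [Polynomial.coe_eval₂RingHom, hq, Polynomial.eval₂_eq_sum_range' _ hlt]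
    refine sum_mem fun i hi => ?_
    have hc := ih (by omega) ((q %ₘ P).coeff i).2
    rw [Subring.subtype_apply]
    generalize ((q %ₘ P).coeff i : GammaXY) = f at hc
    induction hc using AddSubgroup.closure_induction with
    | mem f hf =>
      obtain ⟨g, hg, _, ⟨a, ha, rfl⟩, rfl⟩ := hf
      refine AddSubgroup.subset_closure ⟨g, hg, _, ⟨Function.update a k i, ?_, rfl⟩, ?_⟩
      · intro j hj
        by_cases h : j = k
        · rw [h, Function.update_self]
          exact Finset.mem_range.1 hi
        · rw [Function.update_of_ne h]
          exact ha j (by omega)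
      · rw [Finset.prod_range_succ, Function.update_self, mul_assoc]
        congr 2
        refine Finset.prod_congr rfl fun j hj => ?_
        rw [Function.update_of_ne (Finset.mem_range.1 hj).ne]
    | zero => simp
    | add f g _ _ hf hg => rw [add_mul]; exact add_mem hf hg
    | neg f _ hf => rw [neg_mul]; exact neg_mem hf

/-- The monomial `∏ x_j ^ (2 (n - j) - 1)`, `j < n`. -/
def xRho (n : ℕ) : GammaXY := ∏ j ∈ Finset.range n, x j ^ (2 * (n - j) - 1)

theorem sum_rho (n : ℕ) : ∑ j ∈ Finset.range n, (2 * (n - j) - 1) = n ^ 2 := by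
  induction n with
  | zero => simp
  | succ n ih =>
    rw [Finset.sum_range_succ']
    simp only [Nat.reduceSubDiff, ih, Nat.sub_zero]
    rw [add_sq]
    omega

theorem xRho_mem_HX (n : ℕ) : xRho n ∈ HX (n ^ 2) := by
  rw [← sum_rho]
  exact prod_pow_mem_HX _ _

/-- The largest allowed exponents `2 (n - j) - 1` add up to `n²`; every other allowed choice has a
strictly smaller sum. -/
theorem boundedMon_cases {m : GammaXY} (hm : m ∈ boundedMon n n) :
    m = xRho n ∨ ∃ d < n ^ 2, m ∈ HX d := by
  obtain ⟨a, ha, rfl⟩ := hm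
  by_cases h : ∀ j < n, a j = 2 * (n - j) - 1
  · left
    refine Finset.prod_congr rfl fun j hj => ?_
    rw [h j (Finset.mem_range.1 hj)]
  · right
    push Not at h
    obtain ⟨j, hj, hne⟩ := h
    refine ⟨_, ?_, prod_pow_mem_HX _ a⟩
    rw [← sum_rho]
    refine Finset.sum_lt_sum (fun i hi => ?_) ⟨j, Finset.mem_range.2 hj, ?_⟩
    · have := ha i (Finset.mem_range.1 hi)
      omega
    · have := ha j hj
      omega

/-- Words of length `n²` in `s_0, …, s_{n-1}` are proportional on `S[x_1, …, x_n]`. -/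
theorem exists_foldr_ddx_eq_mul (hS : ∀ p, nc n p ∈ S) (hinv : ∀ g ∈ S, ∀ i < n, act i g = g)
    {f : GammaXY} (hf : f ∈ extX S n) : ∃ g ∈ S, ∀ b : List ℕ, b.length = n ^ 2 →
      (∀ i ∈ b, i < n) → b.foldr ddx f = g * b.foldr ddx (xRho n) := by
  replace hf := extX_le_spanOver hS n le_rfl hf
  induction hf using AddSubgroup.closure_induction with
  | mem f hf =>
    obtain ⟨g, hg, m, hm, rfl⟩ := hf
    -- Elements of `S` are scalars for the word. A monomial other than `xRho n` has degree below the
    -- length `n²` of the word and is killed, so it contributes the factor `0`.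
    rcases boundedMon_cases hm with rfl | ⟨d, hd, hm⟩
    · exact ⟨g, hg, fun b _ hb => foldr_ddx_mul b (fun i hi => hinv g hg i (hb i hi)) _⟩
    · refine ⟨0, zero_mem _, fun b hlen hb => ?_⟩
      rw [foldr_ddx_mul b (fun i hi => hinv g hg i (hb i hi)),
        foldr_ddx_eq_zero b hm (by omega), mul_zero, zero_mul]
  | zero => exact ⟨0, zero_mem _, fun b _ _ => by rw [foldr_ddx_zero, zero_mul]⟩
  | add f g _ _ ihf ihg =>
    obtain ⟨f', hf', hf⟩ := ihf
    obtain ⟨g', hg', hg⟩ := ihg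
    exact ⟨f' + g', add_mem hf' hg', fun b h1 h2 => by
      rw [foldr_ddx_add, hf b h1 h2, hg b h1 h2, add_mul]⟩
  | neg f _ ih =>
    obtain ⟨f', hf', hf⟩ := ih
    refine ⟨-f', neg_mem hf', fun b h1 h2 => ?_⟩
    rw [eq_comm, neg_mul, ← hf b h1 h2, ← add_eq_zero_iff_neg_eq, ← foldr_ddx_add, add_neg_cancel,
      foldr_ddx_zero]

end Span

/-! ### A word that maps `xRho n` to `± 1` -/

theorem act_prod_x {i : ℕ} {t : Finset ℕ} (h : ∀ j ∈ t, act i (x j) = x j) (k : ℕ) :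
    act i (∏ j ∈ t, x j ^ k) = ∏ j ∈ t, x j ^ k := by
  rw [map_prod]
  exact Finset.prod_congr rfl fun j hj => by rw [map_pow, h j hj]

theorem act_x_of_ne {k j : ℕ} (h1 : j ≠ k) (h2 : j ≠ k + 1) : act (k + 1) (x j) = x j := by
  rw [act_x_succ, Equiv.swap_apply_of_ne_of_ne h1 h2]

/-- The letters `n, n - 1, …` are applied in this order. Each one meets `x k ^ 2 * x (k + 1) = (x k
* x (k + 1)) * x k`, pulls out the symmetric factor and replaces `x k` by `1`. -/
theorem exists_word_down (n m : ℕ) (hm : m ≤ n) : ∃ b : List ℕ, b.length = m ∧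
    (∀ i ∈ b, i < n + 1) ∧ b.foldr ddx ((∏ j ∈ Finset.range n, x j ^ 2) * x n) =
      (∏ j ∈ Finset.range (n - m), x j ^ 2) * ∏ j ∈ Finset.Ico (n - m) (n + 1), x j ^ 1 := by
  induction m with
  | zero => exact ⟨[], rfl, by simp, by simp⟩
  | succ m ih =>
    obtain ⟨b, h1, h2, h3⟩ := ih (by omega)
    obtain ⟨k, hk⟩ : ∃ k, n - m = k + 1 := ⟨n - m - 1, by omega⟩
    have hk' : n - (m + 1) = k := by omega
    refine ⟨(k + 1) :: b, by rw [List.length_cons, h1], ?_, ?_⟩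
    · intro i hi
      rcases List.mem_cons.1 hi with rfl | hi
      · omega
      · exact h2 i hi
    · rw [List.foldr_cons, h3, hk, hk', Finset.prod_range_succ,
        Finset.prod_eq_prod_Ico_succ_bot (show k + 1 < n + 1 by omega),
        Finset.prod_eq_prod_Ico_succ_bot (show k < n + 1 by omega),
        Finset.prod_eq_prod_Ico_succ_bot (show k + 1 < n + 1 by omega)]
      have e1 : act (k + 1) (∏ j ∈ Finset.range k, x j ^ 2) = ∏ j ∈ Finset.range k, x j ^ 2 :=
        act_prod_x (fun j hj => act_x_of_ne (by simp at hj; omega) (by simp at hj; omega)) 2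
      have e2 : act (k + 1) (∏ j ∈ Finset.Ico (k + 1 + 1) (n + 1), x j ^ 1) =
          ∏ j ∈ Finset.Ico (k + 1 + 1) (n + 1), x j ^ 1 :=
        act_prod_x (fun j hj => act_x_of_ne (by simp at hj; omega) (by simp at hj; omega)) 1
      have e3 : act (k + 1) (x k * x (k + 1)) = x k * x (k + 1) := by
        rw [map_mul, act_x_succ, act_x_succ, Equiv.swap_apply_left, Equiv.swap_apply_right,
          mul_comm]
      rw [show ∀ A B : GammaXY, A * x k ^ 2 * (x (k + 1) ^ 1 * B) =
        (A * B * (x k * x (k + 1))) * x k by intros; ring, ddx_mul_of_act_eq, ddx_x_succ,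
        if_pos rfl]
      · ring
      · rw [map_mul, map_mul, e1, e2, e3]

/-- The letters `0, 1, …` are applied in this order. Each removes the variable of lowest index still
present and contributes a sign. -/
theorem exists_word_up (n m : ℕ) (hm : m ≤ n) : ∃ b : List ℕ, b.length = m ∧
    (∀ i ∈ b, i < n) ∧ b.foldr ddx (∏ j ∈ Finset.range n, x j ^ 1) =
      (-1) ^ m * ∏ j ∈ Finset.Ico m n, x j ^ 1 := by
  induction m with
  | zero => exact ⟨[], rfl, by simp, by simp⟩
  | succ m ih =>
    obtain ⟨b, h1, h2, h3⟩ := ih (by omega)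
    refine ⟨m :: b, by rw [List.length_cons, h1], ?_, ?_⟩
    · intro i hi
      rcases List.mem_cons.1 hi with rfl | hi
      · omega
      · exact h2 i hi
    · rw [List.foldr_cons, h3, Finset.prod_eq_prod_Ico_succ_bot (show m < n by omega)]
      have e1 : act m (∏ j ∈ Finset.Ico (m + 1) n, x j ^ 1) =
          ∏ j ∈ Finset.Ico (m + 1) n, x j ^ 1 := by
        refine act_prod_x (fun j hj => ?_) 1
        simp only [Finset.mem_Ico] at hj
        cases m with
        | zero => rw [act_x_zero, if_neg (by omega)]
        | succ k => exact act_x_of_ne (by omega) (by omega)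
      rw [show ∀ B : GammaXY, (-1) ^ m * (x m ^ 1 * B) = ((-1) ^ m * B) * x m by intros; ring,
        ddx_mul_of_act_eq]
      · have : ddx m (x m) = -1 := by
          cases m with
          | zero => rw [ddx_x_zero, if_pos rfl]
          | succ k => rw [ddx_x_succ, if_neg (by omega), if_pos rfl]
        rw [this]
        ring
      · rw [map_mul, map_pow, map_neg, map_one, e1]

theorem xRho_succ (n : ℕ) :
    xRho (n + 1) = ((∏ j ∈ Finset.range n, x j ^ 2) * x n) * xRho n := by
  rw [xRho, Finset.prod_range_succ, xRho,
    Finset.prod_congr rfl (g := fun j => x j ^ 2 * x j ^ (2 * (n - j) - 1)),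
    Finset.prod_mul_distrib, show 2 * (n + 1 - n) - 1 = 1 by omega]
  · ring
  · intro j hj
    rw [Finset.mem_range] at hj
    rw [← pow_add]
    congr 1
    omega

/-- By `xRho_succ` the monomial for `n + 1` is the one for `n` times a factor invariant under `s_0,
…, s_{n-1}`. The word for `n` is applied first, then `n` letters down and `n + 1` letters up reduce
the invariant factor to a sign. The lengths add up to `n² + 2n + 1`. -/
theorem exists_word_xRho (n : ℕ) : ∃ b : List ℕ, b.length = n ^ 2 ∧ (∀ i ∈ b, i < n) ∧
    (b.foldr ddx (xRho n) = 1 ∨ b.foldr ddx (xRho n) = -1) := by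
  induction n with
  | zero => exact ⟨[], rfl, by simp, Or.inl (by simp [xRho])⟩
  | succ n ih =>
    obtain ⟨b, h1, h2, h3⟩ := ih
    obtain ⟨d, d1, d2, d3⟩ := exists_word_down n n le_rfl
    obtain ⟨u, u1, u2, u3⟩ := exists_word_up (n + 1) (n + 1) le_rfl
    have hsq : ∀ i < n, act i ((∏ j ∈ Finset.range n, x j ^ 2) * x n) =
        (∏ j ∈ Finset.range n, x j ^ 2) * x n := by
      intro i hi
      rw [map_mul, map_prod]
      cases i with
      | zero =>
        rw [act_x_zero, if_neg (by omega)]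
        congr 1
        refine Finset.prod_congr rfl fun j _ => ?_
        rw [map_pow, act_x_zero]
        split_ifs with h
        · rw [h, neg_sq]
        · rfl
      | succ k =>
        rw [act_x_of_ne (by omega) (by omega)]
        congr 1
        simp only [map_pow, act_x_succ]
        refine Finset.prod_equiv (Equiv.swap k (k + 1)) (fun j => ?_) fun j _ => rfl
        simp only [Finset.mem_range, Equiv.swap_apply_def]
        split_ifs <;> omega
    have hb : b.foldr ddx (xRho (n + 1)) =
        ((∏ j ∈ Finset.range n, x j ^ 2) * x n) * b.foldr ddx (xRho n) := by
      rw [xRho_succ, foldr_ddx_mul b fun i hi => hsq i (h2 i hi)]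
    have hneg : ∀ (a : List ℕ) (f : GammaXY), a.foldr ddx (-f) = -a.foldr ddx f := by
      intro a f
      rw [← add_eq_zero_iff_eq_neg, ← foldr_ddx_add, neg_add_cancel, foldr_ddx_zero]
    have hdu : u.foldr ddx (d.foldr ddx ((∏ j ∈ Finset.range n, x j ^ 2) * x n)) =
        (-1) ^ (n + 1) := by
      rw [d3, Nat.sub_self, Finset.prod_range_zero, one_mul, ← Finset.range_eq_Ico, u3,
        Finset.Ico_self, Finset.prod_empty, mul_one]
    refine ⟨u ++ (d ++ b), ?_, ?_, ?_⟩
    · rw [List.length_append, List.length_append, u1, d1, h1]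
      ring
    · intro i hi
      rw [List.mem_append, List.mem_append] at hi
      rcases hi with hi | hi | hi
      · exact u2 i hi
      · exact d2 i hi
      · have := h2 i hi
        omega
    · rw [List.foldr_append, List.foldr_append, hb]
      rcases h3 with h3 | h3
      · rw [h3, mul_one, hdu]
        exact neg_one_pow_eq_or _ _
      · rw [h3, mul_neg_one, hneg, hneg, hdu]
        rcases neg_one_pow_eq_or GammaXY (n + 1) with h | h
        · rw [h]; exact Or.inr rfl
        · rw [h, neg_neg]; exact Or.inl rfl

/-! ## Homomorphisms from `Γ[X, Y]` -/

/-- The homomorphism with `c_p ↦ a p`, `x_j ↦ u j`, `y_j ↦ v j`. -/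
def evalHom {A : Type*} [CommRing A] (a : ℕ → A) (h0 : a 0 = 1) (h : ∀ p, 1 ≤ p → qRel a p = 0)
    (u v : ℕ → A) : GammaXY →+* A :=
  MvPolynomial.eval₂Hom (gammaLift a h0 h) (Sum.elim u v)

section evalHom

variable {A : Type*} [CommRing A] (a : ℕ → A) (h0 : a 0 = 1) (h : ∀ p, 1 ≤ p → qRel a p = 0)
    (u v : ℕ → A)

theorem evalHom_c (p : ℕ) : evalHom a h0 h u v (MvPolynomial.C (c p)) = a p := by
  simp [evalHom, gammaLift_c]

theorem evalHom_x (j : ℕ) : evalHom a h0 h u v (x j) = u j := by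
  simp [evalHom, x]

theorem evalHom_y (j : ℕ) : evalHom a h0 h u v (y j) = v j := by
  simp [evalHom, y]

end evalHom

theorem qRel_map_c {A : Type*} [CommRing A] (φ : GammaXY →+* A) (p : ℕ) (hp : 1 ≤ p) :
    qRel (fun p => φ (MvPolynomial.C (c p))) p = 0 := by
  have h := map_qRel (φ.comp MvPolynomial.C) c p
  rw [qRel_c hp, map_zero] at h
  exact h.symm

theorem qRel_mul_pow {A : Type*} [CommRing A] (a : ℕ → A) (t : A) (p : ℕ) :
    qRel (fun p => a p * t ^ p) p = qRel a p * t ^ (2 * p) := by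
  rw [qRel, qRel, add_mul, mul_assoc, Finset.sum_mul]
  congr 1
  · ring
  · congr 1
    refine Finset.sum_congr rfl fun i hi => ?_
    have h : 2 * p = (p + i) + (p - i) := by
      have := (Finset.mem_Icc.1 hi).2
      omega
    rw [h, pow_add t (p + i)]
    ring

/-! ## The grading -/

/-- The homomorphism `c_p ↦ c_p T^p`, `x_j ↦ x_j T`, `y_j ↦ y_j` that records degrees. -/
def delta : GammaXY →+* Polynomial GammaXY :=
  evalHom (fun p => Polynomial.C (MvPolynomial.C (c p)) * Polynomial.X ^ p)
    (by simp [c_zero]) (fun p hp => by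
      rw [qRel_mul_pow (fun p => Polynomial.C (MvPolynomial.C (c p))),
        qRel_map_c Polynomial.C p hp, zero_mul])
    (fun j => Polynomial.C (x j) * Polynomial.X) fun j => Polynomial.C (y j)

theorem delta_c (p : ℕ) : delta (MvPolynomial.C (c p)) =
    Polynomial.C (MvPolynomial.C (c p)) * Polynomial.X ^ p := evalHom_c _ _ _ _ _ p

theorem delta_x (j : ℕ) : delta (x j) = Polynomial.C (x j) * Polynomial.X := evalHom_x _ _ _ _ _ j

theorem delta_y (j : ℕ) : delta (y j) = Polynomial.C (y j) := evalHom_y _ _ _ _ _ j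

/-- The coefficients of `delta f` are the homogeneous parts of `f`, and their sum is `f`; in
particular `delta` is injective. -/
theorem eval_delta (f : GammaXY) : (delta f).eval 1 = f := by
  have : (Polynomial.evalRingHom 1).comp delta = RingHom.id GammaXY :=
    gammaXY_hom_ext (fun p => by simp [delta_c]) (fun j => by simp [delta_x])
      fun j => by simp [delta_y]
  exact RingHom.congr_fun this f

/-- The elements of degree `d`, where the `y_j` have degree `0`. -/
def HA (d : ℕ) : AddSubgroup GammaXY where
  carrier := {f | delta f = Polynomial.C f * Polynomial.X ^ d}
  zero_mem' := by simp
  add_mem' := by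
    intro f g hf hg
    simp only [Set.mem_ofPred_eq] at hf hg ⊢
    rw [map_add, hf, hg, map_add, add_mul]
  neg_mem' := by
    intro f hf
    simp only [Set.mem_ofPred_eq] at hf ⊢
    rw [map_neg, hf, map_neg]
    ring

theorem mem_HA {d : ℕ} {f : GammaXY} :
    f ∈ HA d ↔ delta f = Polynomial.C f * Polynomial.X ^ d := Iff.rfl

theorem mul_mem_HA {d d' : ℕ} {f g : GammaXY} (hf : f ∈ HA d) (hg : g ∈ HA d') :
    f * g ∈ HA (d + d') := by
  rw [mem_HA] at *
  rw [map_mul, hf, hg, map_mul, pow_add]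
  ring

theorem x_mem_HA (j : ℕ) : x j ∈ HA 1 := by rw [mem_HA, delta_x, pow_one]

theorem y_mem_HA (j : ℕ) : y j ∈ HA 0 := by rw [mem_HA, delta_y, pow_zero, mul_one]

theorem c_mem_HA (p : ℕ) : MvPolynomial.C (c p) ∈ HA p := delta_c p

theorem intCast_mem_HA (n : ℤ) : (n : GammaXY) ∈ HA 0 := by
  rw [mem_HA, map_intCast, map_intCast, pow_zero, mul_one]

theorem HX_le_HA {d : ℕ} {f : GammaXY} (hf : f ∈ HX d) : f ∈ HA d := by
  induction hf using AddSubgroup.closure_induction with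
  | mem m hm =>
    induction d generalizing m with
    | zero =>
      obtain rfl : m = 1 := hm
      simpa using intCast_mem_HA 1
    | succ d ih =>
      obtain ⟨j, m', hm', rfl⟩ := hm
      rw [add_comm]
      exact mul_mem_HA (x_mem_HA j) (ih m' hm')
  | zero => exact zero_mem _
  | add f g _ _ hf hg => exact add_mem hf hg
  | neg f _ hf => exact neg_mem hf

theorem e_mem_HA (n j : ℕ) : e n j ∈ HA j := by
  refine sum_mem fun t ht => HX_le_HA ?_
  have := prod_pow_mem_HX t fun _ => 1
  simpa [(Finset.mem_powersetCard.1 ht).2] using this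

theorem nc_mem_HA (n p : ℕ) : nc n p ∈ HA p := by
  refine sum_mem fun j hj => ?_
  have := mul_mem_HA (c_mem_HA (p - j)) (e_mem_HA n j)
  rwa [Nat.sub_add_cancel (Nat.lt_succ_iff.1 (Finset.mem_range.1 hj))] at this

theorem coeff_delta_mem_HA (f : GammaXY) (d : ℕ) : (delta f).coeff d ∈ HA d := by
  have key : ∀ {f : GammaXY} {k : ℕ}, f ∈ HA k → ∀ d, (delta f).coeff d ∈ HA d := by
    intro f k hf d
    rw [mem_HA.1 hf, Polynomial.coeff_C_mul_X_pow]
    split_ifs with h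
    · rwa [h]
    · exact zero_mem _
  induction f using gammaXY_induction generalizing d with
  | hint n => exact key (intCast_mem_HA n) d
  | hadd f g hf hg => rw [map_add, Polynomial.coeff_add]; exact add_mem (hf d) (hg d)
  | hmul f g hf hg =>
    rw [map_mul, Polynomial.coeff_mul]
    refine sum_mem fun ij hij => ?_
    rw [← Finset.HasAntidiagonal.mem_antidiagonal.1 hij]
    exact mul_mem_HA (hf _) (hg _)
  | hc p => exact key (c_mem_HA p) d
  | hx j => exact key (x_mem_HA j) d
  | hy j => exact key (y_mem_HA j) d

theorem delta_act (i : ℕ) (f : GammaXY) :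
    delta (act i f) = Polynomial.mapRingHom (act i) (delta f) := by
  suffices h : delta.comp (act i) = (Polynomial.mapRingHom (act i)).comp delta from
    RingHom.congr_fun h f
  refine gammaXY_hom_ext (fun p => ?_) (fun j => ?_) fun j => ?_
  · cases i with
    | zero =>
      have h : s0c p ∈ HA p := by
        refine add_mem (c_mem_HA p) ?_
        rw [two_mul]
        have : ∑ j ∈ Finset.Icc 1 p, x 0 ^ j * MvPolynomial.C (c (p - j)) ∈ HA p := by
          refine sum_mem fun j hj => ?_
          have h1 : x 0 ^ j ∈ HA j := by
            have := HX_le_HA (x_pow_mul_mem_HX 0 j one_mem_HX)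
            simpa using this
          have := mul_mem_HA h1 (c_mem_HA (p - j))
          rwa [Nat.add_sub_cancel' (Finset.mem_Icc.1 hj).2] at this
        exact add_mem this this
      simp [act_c_zero, delta_c, mem_HA.1 h]
    | succ k => simp [act_c_succ, delta_c]
  · cases i with
    | zero =>
      by_cases hj : j = 0
      · subst hj
        simp only [RingHom.comp_apply, act_x_zero, if_true, map_neg, delta_x, map_mul,
          Polynomial.coe_mapRingHom, Polynomial.map_C, Polynomial.map_X, RingHom.coe_coe]
        ring
      · simp [act_x_zero, delta_x, hj]
    | succ k => simp [act_x_succ, delta_x]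
  · simp [act_y, delta_y]

theorem den_mem_HA (i : ℕ) : den i ∈ HA 1 := by
  cases i with
  | zero =>
    rw [den, neg_mul, two_mul]
    exact neg_mem (add_mem (x_mem_HA 0) (x_mem_HA 0))
  | succ k => exact sub_mem (x_mem_HA k) (x_mem_HA (k + 1))

/-- `delta` intertwines `act i` with its coefficientwise extension, so `delta` of the defining
equation can be compared coefficient by coefficient, with `den i` cancelled each time. -/
theorem ddx_mem_HA (i : ℕ) {d : ℕ} {f : GammaXY} (hf : f ∈ HA (d + 1)) : ddx i f ∈ HA d := by
  have h := congrArg delta (den_mul_ddx i f)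
  rw [map_mul, map_sub, delta_act, mem_HA.1 hf, mem_HA.1 (den_mem_HA i)] at h
  rw [mem_HA]
  ext k : 1
  apply den_mul_cancel (i := i)
  have h' := congrArg (Polynomial.coeff · (k + 1)) h
  simp only [Polynomial.coe_mapRingHom, Polynomial.map_mul, Polynomial.map_C, Polynomial.map_pow,
    Polynomial.map_X, RingHom.coe_coe, ← sub_mul, ← map_sub, ← den_mul_ddx, pow_one] at h'
  rw [mul_assoc, mul_comm Polynomial.X, ← mul_assoc, Polynomial.coeff_mul_X,
    Polynomial.coeff_C_mul, pow_succ, ← mul_assoc, Polynomial.coeff_mul_X, map_mul, mul_assoc,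
    Polynomial.coeff_C_mul] at h'
  exact h'

theorem ddx_eq_zero_of_mem_HA_zero (i : ℕ) {f : GammaXY} (hf : f ∈ HA 0) : ddx i f = 0 := by
  have h := congrArg delta (den_mul_ddx i f)
  rw [map_mul, map_sub, delta_act, mem_HA.1 hf, mem_HA.1 (den_mem_HA i)] at h
  have h' := congrArg (Polynomial.coeff · 0) h
  simp only [Polynomial.coe_mapRingHom, Polynomial.map_mul, Polynomial.map_C, Polynomial.map_pow,
    Polynomial.map_X, RingHom.coe_coe, ← sub_mul, ← map_sub, ← den_mul_ddx, pow_one, pow_zero,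
    mul_one] at h'
  rw [mul_assoc, mul_comm Polynomial.X, ← mul_assoc, Polynomial.coeff_mul_X_zero,
    Polynomial.coeff_C_zero] at h'
  exact eq_zero_of_den_mul h'.symm

/-! ## Elements that involve only `x_1, …, x_n` -/

/-- The ring `Γ[x_1, …, x_n, Y]`. -/
def GammaXn (n : ℕ) : Subalgebra Gamma GammaXY :=
  Algebra.adjoin Gamma (x '' {j | j < n} ∪ Set.range y)

theorem C_mem (T : Subalgebra Gamma GammaXY) (r : Gamma) : MvPolynomial.C r ∈ T :=
  T.algebraMap_mem r

theorem x_mem_GammaXn {j n : ℕ} (h : j < n) : x j ∈ GammaXn n :=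
  Algebra.subset_adjoin (Or.inl ⟨j, h, rfl⟩)

theorem y_mem_GammaXn (j n : ℕ) : y j ∈ GammaXn n := Algebra.subset_adjoin (Or.inr ⟨j, rfl⟩)

theorem GammaXn_mono {m n : ℕ} (h : m ≤ n) : GammaXn m ≤ GammaXn n :=
  Algebra.adjoin_mono (Set.union_subset_union_left _
    (Set.image_mono fun _ (hi : _ < _) => lt_of_lt_of_le hi h))

theorem GammaX_le_GammaXn (n : ℕ) : GammaX n ≤ GammaXn n :=
  Algebra.adjoin_mono Set.subset_union_left

theorem exists_mem_GammaXn (f : GammaXY) : ∃ n, f ∈ GammaXn n := by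
  induction f using gammaXY_induction with
  | hint n => exact ⟨0, intCast_mem _ n⟩
  | hadd f g hf hg =>
    obtain ⟨m, hm⟩ := hf
    obtain ⟨n, hn⟩ := hg
    exact ⟨max m n, add_mem (GammaXn_mono (le_max_left m n) hm)
      (GammaXn_mono (le_max_right m n) hn)⟩
  | hmul f g hf hg =>
    obtain ⟨m, hm⟩ := hf
    obtain ⟨n, hn⟩ := hg
    exact ⟨max m n, mul_mem (GammaXn_mono (le_max_left m n) hm)
      (GammaXn_mono (le_max_right m n) hn)⟩
  | hc p => exact ⟨0, C_mem _ _⟩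
  | hx j => exact ⟨j + 1, x_mem_GammaXn (Nat.lt_succ_self j)⟩
  | hy j => exact ⟨0, y_mem_GammaXn j 0⟩

theorem GammaXn_induction {n : ℕ} {P : GammaXY → Prop} {f : GammaXY} (hf : f ∈ GammaXn n)
    (hC : ∀ r, P (MvPolynomial.C r)) (hadd : ∀ f g, P f → P g → P (f + g))
    (hmul : ∀ f g, P f → P g → P (f * g)) (hx : ∀ j < n, P (x j)) (hy : ∀ j, P (y j)) : P f := by
  induction hf using Algebra.adjoin_induction with
  | mem f hf =>
    rcases hf with ⟨j, hj, rfl⟩ | ⟨j, rfl⟩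
    · exact hx j hj
    · exact hy j
  | algebraMap r => exact hC r
  | add f g _ _ hf hg => exact hadd f g hf hg
  | mul f g _ _ hf hg => exact hmul f g hf hg

/-- The substitution `x_{n+1} ↦ 0`. -/
def killX (n : ℕ) : GammaXY →ₐ[Gamma] GammaXY :=
  MvPolynomial.aeval (Sum.elim (fun j => if j = n then 0 else x j) y)

theorem killX_x (n j : ℕ) : killX n (x j) = if j = n then 0 else x j := by
  simp [killX, x]

theorem killX_y (n j : ℕ) : killX n (y j) = y j := by
  simp [killX, y]

theorem algHom_C (φ : GammaXY →ₐ[Gamma] GammaXY) (r : Gamma) :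
    φ (MvPolynomial.C r) = MvPolynomial.C r := φ.commutes r

theorem act_succ_C (k : ℕ) (r : Gamma) : act (k + 1) (MvPolynomial.C r) = MvPolynomial.C r := by
  simp [act]

/-- The reflection exchanges `x n` with a variable absent from `f`, so its image does not involve `x
n`. If `f` equals that image, setting `x n` to zero leaves `f` unchanged. -/
theorem mem_GammaXn_of_act_eq {n : ℕ} {f : GammaXY} (hf : f ∈ GammaXn (n + 1))
    (h : act (n + 1) f = f) : f ∈ GammaXn n := by
  have h1 : killX n (act (n + 1) f) = act (n + 1) f := by
    clear h
    refine GammaXn_induction (P := fun f => killX n (act (n + 1) f) = act (n + 1) f) hf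
      (fun r => by rw [act_succ_C, algHom_C])
      (fun f g hf hg => by rw [map_add, map_add, hf, hg])
      (fun f g hf hg => by rw [map_mul, map_mul, hf, hg]) (fun j hj => ?_)
      fun j => by rw [act_y, killX_y]
    · rw [act_x_succ, killX_x, if_neg]
      rw [Equiv.swap_apply_def]
      split_ifs <;> omega
  have h2 : killX n f ∈ GammaXn n := by
    clear h h1
    refine GammaXn_induction (P := fun f => killX n f ∈ GammaXn n) hf
      (fun r => by rw [algHom_C]; exact C_mem _ r)
      (fun f g hf hg => by rw [map_add]; exact add_mem hf hg)
      (fun f g hf hg => by rw [map_mul]; exact mul_mem hf hg) (fun j hj => ?_)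
      fun j => by rw [killX_y]; exact y_mem_GammaXn j n
    · rw [killX_x]
      split_ifs with h
      · exact zero_mem _
      · exact x_mem_GammaXn (by omega)
  rw [h] at h1
  rwa [h1] at h2

/-- Only finitely many variables occur in `f`; the superfluous ones are removed from the top, one at
a time. -/
theorem mem_GammaXn_of_forall {n : ℕ} {f : GammaXY} (h : ∀ i, n < i → act i f = f) :
    f ∈ GammaXn n := by
  obtain ⟨m, hm⟩ := exists_mem_GammaXn f
  induction m with
  | zero => exact GammaXn_mono (Nat.zero_le n) hm
  | succ m ih =>
    by_cases hn : m + 1 ≤ n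
    · exact GammaXn_mono hn hm
    · exact ih (mem_GammaXn_of_act_eq hm (h _ (by omega)))

/-! ## The ideal of the `ⁿc_p` -/

/-- The ideal generated by the `ⁿc_p`, `p ≥ 1`. -/
def ncIdeal (n : ℕ) : Ideal GammaXY := Ideal.span (nc n '' {p | 1 ≤ p})

theorem nc_mem_ncIdeal {n p : ℕ} (hp : 1 ≤ p) : nc n p ∈ ncIdeal n :=
  Ideal.subset_span ⟨p, hp, rfl⟩

/-- The generators are invariant under `s_i` for `i < n`, so the Leibniz rule keeps the ideal
stable. -/
theorem ddx_mem_ncIdeal {n i : ℕ} (hi : i < n) {f : GammaXY} (hf : f ∈ ncIdeal n) :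
    ddx i f ∈ ncIdeal n := by
  induction hf using Submodule.span_induction with
  | mem f hf =>
    obtain ⟨p, hp, rfl⟩ := hf
    rw [ddx_eq_zero_iff.2 (act_nc hi p)]
    exact zero_mem _
  | zero => rw [ddx_zero]; exact zero_mem _
  | add f g _ _ hf hg => rw [ddx_add]; exact add_mem hf hg
  | smul a f hf' hf =>
    rw [smul_eq_mul, ddx_mul]
    refine add_mem (Ideal.mul_mem_left _ _ hf') (Ideal.mul_mem_left _ _ hf)

theorem coeff_delta_mem_ncIdeal {n : ℕ} {f : GammaXY} (hf : f ∈ ncIdeal n) (d : ℕ) :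
    (delta f).coeff d ∈ ncIdeal n := by
  refine Ideal.mem_map_C_iff.1 (?_ : delta f ∈ (ncIdeal n).map Polynomial.C) d
  induction hf using Submodule.span_induction with
  | mem f hf =>
    obtain ⟨p, hp, rfl⟩ := hf
    rw [mem_HA.1 (nc_mem_HA n p)]
    exact Ideal.mul_mem_right _ _ (Ideal.mem_map_of_mem _ (nc_mem_ncIdeal hp))
  | zero => simp
  | add f g _ _ hf hg => rw [map_add]; exact add_mem hf hg
  | smul a f _ hf => rw [smul_eq_mul, map_mul]; exact Ideal.mul_mem_left _ _ hf

/-- The inverse of the series of the `ⁿc_p`. -/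
def vSer (n : ℕ) : PowerSeries GammaXY := Ring.inverse (ncSer n)

theorem ncSer_mul_vSer (n : ℕ) : ncSer n * vSer n = 1 := by
  refine Ring.mul_inverse_cancel _ ?_
  rw [PowerSeries.isUnit_iff_constantCoeff, ← PowerSeries.coeff_zero_eq_constantCoeff_apply]
  simp [ncSer, nc_zero]

theorem coeff_vSer_zero (n : ℕ) : PowerSeries.coeff 0 (vSer n) = 1 := by
  have := congrArg (PowerSeries.coeff 0) (ncSer_mul_vSer n)
  simpa [ncSer, nc_zero] using this

/-! ## Splitting a polynomial with constant term `1` into linear factors -/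

theorem natDegree_X_add_C_le_one {R : Type*} [CommRing R] (a : R) :
    (Polynomial.X + Polynomial.C a).natDegree ≤ 1 :=
  Polynomial.natDegree_add_C.trans_le Polynomial.natDegree_X_le

theorem reflect_prod_X_add_C {R : Type*} [CommRing R] (m : Multiset R) :
    Polynomial.reflect m.card (m.map fun a => Polynomial.X + Polynomial.C a).prod =
      (m.map fun a => 1 + Polynomial.C a * Polynomial.X).prod := by
  have key : ∀ m : Multiset R,
      (m.map fun a => Polynomial.X + Polynomial.C a).prod.natDegree ≤ m.card := by
    intro m
    induction m using Multiset.induction_on with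
    | empty => simp
    | cons a m ih =>
      rw [Multiset.map_cons, Multiset.prod_cons, Multiset.card_cons, add_comm m.card]
      exact Polynomial.natDegree_mul_le_of_le (natDegree_X_add_C_le_one a) ih
  induction m using Multiset.induction_on with
  | empty => simp
  | cons a m ih =>
    rw [Multiset.map_cons, Multiset.prod_cons, Multiset.card_cons, add_comm m.card,
      Polynomial.reflect_mul _ _ (natDegree_X_add_C_le_one a) (key m), ih,
      Multiset.map_cons, Multiset.prod_cons]
    congr 1
    ext k
    simp [Polynomial.coeff_reflect, Polynomial.coeff_one, Polynomial.coeff_X, Polynomial.coeff_C]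

theorem exists_multiset_map_prod_eq {R A : Type*} [Zero R] [CommMonoid A] (F : R → A)
    (m : Multiset R) : ∃ ξ : ℕ → R, (m.map F).prod = ∏ k ∈ Finset.range m.card, F (ξ k) := by
  induction m using Multiset.induction_on with
  | empty => exact ⟨fun _ => 0, by simp⟩
  | cons a m ih =>
    obtain ⟨ξ, h⟩ := ih
    refine ⟨fun k => Nat.casesOn k a ξ, ?_⟩
    rw [Multiset.map_cons, Multiset.prod_cons, Multiset.card_cons, Finset.prod_range_succ', h,
      mul_comm]
    rfl

/-- This is a splitting principle. A monic polynomial splits over some faithful extension ring, and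
reversing its coefficients turns factors `X + ξ` into `1 + ξ X`. -/
theorem exists_prod_one_add_eq.{u} {R : Type u} [CommRing R] [Nontrivial R] (v : ℕ → R)
    (h0 : v 0 = 1) (M : ℕ) : ∃ (S : Type u) (_ : CommRing S) (φ : R →+* S) (ξ : ℕ → S),
      Function.Injective φ ∧ ∏ k ∈ Finset.range M, (1 + Polynomial.C (ξ k) * Polynomial.X) =
        ∑ j ∈ Finset.range (M + 1), Polynomial.C (φ (v j)) * Polynomial.X ^ j := by
  set g : Polynomial R :=
    ∑ j ∈ Finset.range (M + 1), Polynomial.C (v j) * Polynomial.X ^ (M - j) with hg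
  have hlow : (∑ j ∈ Finset.range M, Polynomial.C (v (j + 1)) *
      Polynomial.X ^ (M - (j + 1))).degree < (M : WithBot ℕ) := by
    refine lt_of_le_of_lt (Polynomial.degree_sum_le _ _) ?_
    rw [Finset.sup_lt_iff (by exact_mod_cast WithBot.bot_lt_coe M)]
    intro j hj
    rw [Finset.mem_range] at hj
    refine lt_of_le_of_lt (Polynomial.degree_C_mul_X_pow_le _ _) ?_
    exact_mod_cast (by omega : M - (j + 1) < M)
  have hg' : g = Polynomial.X ^ M + ∑ j ∈ Finset.range M, Polynomial.C (v (j + 1)) *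
      Polynomial.X ^ (M - (j + 1)) := by
    rw [hg, Finset.sum_range_succ', h0, add_comm]
    simp
  have hm : g.Monic := by
    rw [hg']
    exact Polynomial.monic_X_pow_add hlow
  have hdeg : g.natDegree = M := by
    rw [hg', Polynomial.natDegree_add_eq_left_of_degree_lt, Polynomial.natDegree_X_pow]
    rwa [Polynomial.degree_X_pow]
  obtain ⟨S, _, _, _, _, _, hS⟩ := hm.exists_splits_map
  obtain ⟨m, hm'⟩ := Polynomial.splits_iff_exists_multiset'.1 hS
  rw [(hm.map _).leadingCoeff, Polynomial.C_1, one_mul] at hm'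
  have hcard : m.card = M := by
    have h := congrArg Polynomial.natDegree hm'
    rw [hm.natDegree_map, hdeg, Polynomial.natDegree_multiset_prod_of_monic] at h
    · simpa using h.symm
    · intro f hf
      obtain ⟨a, -, rfl⟩ := Multiset.mem_map.1 hf
      exact Polynomial.monic_X_add_C a
  obtain ⟨ξ, hξ⟩ := exists_multiset_map_prod_eq
    (fun a : S => (1 + Polynomial.C a * Polynomial.X : Polynomial S)) m
  refine ⟨S, inferInstance, algebraMap R S, ξ, FaithfulSMul.algebraMap_injective R S, ?_⟩
  rw [hcard] at hξ
  rw [← hξ, ← reflect_prod_X_add_C, ← hm', hcard, hg, Polynomial.map_sum]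
  have hsum : ∀ (t : Finset ℕ) (F : ℕ → Polynomial S),
      Polynomial.reflect M (∑ j ∈ t, F j) = ∑ j ∈ t, Polynomial.reflect M (F j) := by
    intro t F
    ext k
    simp [Polynomial.coeff_reflect, Polynomial.finsetSum_coeff]
  rw [hsum]
  refine Finset.sum_congr rfl fun j hj => ?_
  rw [Finset.mem_range] at hj
  rw [Polynomial.map_mul, Polynomial.map_C, Polynomial.map_pow, Polynomial.map_X,
    Polynomial.reflect_C_mul_X_pow, Polynomial.revAt_le (Nat.sub_le M j),
    Nat.sub_sub_self (by omega)]

/-! ## Elements of low degree that lie in the ideal of the `ⁿc_p` -/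

/-- On `ncSer n` the map `delta` is the rescaling `t ↦ T t`. Both operations are multiplicative, so
they also agree on the inverse series. -/
theorem coeff_vSer_mem_HA (n j : ℕ) : PowerSeries.coeff j (vSer n) ∈ HA j := by
  have h1 : PowerSeries.map delta (ncSer n) =
      PowerSeries.rescale Polynomial.X (PowerSeries.map Polynomial.C (ncSer n)) := by
    ext p : 1
    simp only [PowerSeries.coeff_map, PowerSeries.coeff_rescale, ncSer, PowerSeries.coeff_mk]
    rw [mem_HA.1 (nc_mem_HA n p), mul_comm]
  have h2 := congrArg (PowerSeries.map delta) (ncSer_mul_vSer n)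
  have h3 := congrArg (fun f => PowerSeries.rescale (Polynomial.X : Polynomial GammaXY)
    (PowerSeries.map Polynomial.C f)) (ncSer_mul_vSer n)
  simp only [map_mul, map_one] at h2 h3
  rw [← h1] at h3
  have h4 : PowerSeries.map delta (vSer n) =
      PowerSeries.rescale Polynomial.X (PowerSeries.map Polynomial.C (vSer n)) := by
    rw [← mul_one (PowerSeries.map delta (vSer n)), ← h3, ← mul_assoc,
      mul_comm (PowerSeries.map delta (vSer n)), h2, one_mul]
  have h5 := congrArg (PowerSeries.coeff j) h4
  rw [PowerSeries.coeff_map, PowerSeries.coeff_rescale, PowerSeries.coeff_map, mul_comm] at h5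
  exact h5

theorem map_ncSer_add {A : Type*} [CommRing A] (φ : GammaXY →+* A) (n M : ℕ) :
    PowerSeries.map φ (ncSer (n + M)) = PowerSeries.map φ (ncSer n) *
      ∏ k ∈ Finset.range M, (1 + PowerSeries.C (φ (x (n + k))) * PowerSeries.X) := by
  rw [ncSer_eq, ncSer_eq, Finset.prod_range_add, map_mul, map_mul, map_mul, map_prod, map_prod]
  simp only [lin, map_add, map_one, map_mul, PowerSeries.map_C, PowerSeries.map_X]
  ring

theorem eq_of_mem_GammaXn {A : Type*} [CommRing A] {φ ψ : GammaXY →+* A} {n : ℕ}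
    (hc : ∀ p, φ (MvPolynomial.C (c p)) = ψ (MvPolynomial.C (c p)))
    (hx : ∀ j < n, φ (x j) = ψ (x j)) (hy : ∀ j, φ (y j) = ψ (y j)) {f : GammaXY}
    (hf : f ∈ GammaXn n) : φ f = ψ f := by
  refine GammaXn_induction (P := fun f => φ f = ψ f) hf (fun r => ?_)
    (fun f g hf hg => by rw [map_add, map_add, hf, hg])
    (fun f g hf hg => by rw [map_mul, map_mul, hf, hg]) hx hy
  have : φ.comp MvPolynomial.C = ψ.comp MvPolynomial.C := gamma_hom_ext hc
  exact RingHom.congr_fun this r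

theorem cSer_map_eq {A : Type*} [CommRing A] {φ ψ : GammaXY →+* A} {n : ℕ}
    (hc : ∀ p, φ (MvPolynomial.C (c p)) = ψ (MvPolynomial.C (c p)))
    (hx : ∀ j < n, φ (x j) = ψ (x j)) :
    PowerSeries.map φ (ncSer n) = PowerSeries.map ψ (ncSer n) := by
  rw [ncSer_eq, map_mul, map_mul, map_prod, map_prod]
  congr 1
  · refine Finset.prod_congr rfl fun j hj => ?_
    simp [lin, hx j (Finset.mem_range.1 hj)]
  · ext p : 1
    simp [cSer, hc]

/-- The last `M` variables are absent from `f` and may be specialised freely. They are sent to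
elements `ξ_k` with `∏ (1 + ξ_k t) = 1 / ⁿc(t)`, which exist once degrees above `M` are discarded.
Then the series of the `ⁿ⁺ᴹc_p` becomes `1`, so the whole ideal dies, while `f` loses nothing
because its degree is at most `M`. -/
theorem eq_zero_of_mem_ncIdeal {n M : ℕ} {f : GammaXY} (hf : f ∈ GammaXn n)
    (hd : (delta f).natDegree ≤ M) (h : f ∈ ncIdeal (n + M)) : f = 0 := by
  -- Reduction modulo `T^{M+1}`, with `T` recording the degree, kills the coefficients of `1 /
  -- ⁿc(t)` beyond `t^M`, so that it becomes a polynomial that `M` linear factors can represent.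
  set I : Ideal (Polynomial GammaXY) := Ideal.span {Polynomial.X ^ (M + 1)} with hI
  have hmem : ∀ g : Polynomial GammaXY, g ∈ I ↔ Polynomial.X ^ (M + 1) ∣ g := fun g =>
    Ideal.mem_span_singleton
  have : Nontrivial (Polynomial GammaXY ⧸ I) := by
    refine Ideal.Quotient.nontrivial_iff.2 fun h => ?_
    have h1 : (1 : Polynomial GammaXY) ∈ I := by rw [h]; trivial
    rw [hmem, Polynomial.X_pow_dvd_iff] at h1
    simpa using h1 0 (Nat.succ_pos M)
  set D0 : GammaXY →+* Polynomial GammaXY ⧸ I := (Ideal.Quotient.mk I).comp delta with hD0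
  obtain ⟨S, _, φ, ξ, hφ, hξ⟩ := exists_prod_one_add_eq
    (fun j => D0 (PowerSeries.coeff j (vSer n))) (by simp [coeff_vSer_zero]) M
  set D : GammaXY →+* S := φ.comp D0 with hD
  have hv : PowerSeries.map D (vSer n) =
      ∏ k ∈ Finset.range M, (1 + PowerSeries.C (ξ k) * PowerSeries.X) := by
    have h1 := congrArg (Polynomial.coeToPowerSeries.ringHom (R := S)) hξ
    rw [map_prod] at h1
    simp only [map_add, map_one, map_mul, Polynomial.coeToPowerSeries.ringHom_apply,
      Polynomial.coe_C, Polynomial.coe_X] at h1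
    rw [h1]
    ext j : 1
    rw [PowerSeries.coeff_map, Polynomial.coeff_coe, Polynomial.finsetSum_coeff]
    simp only [Polynomial.coeff_C_mul_X_pow]
    rw [Finset.sum_ite_eq]
    split_ifs with hj
    · rfl
    · have : D0 (PowerSeries.coeff j (vSer n)) = 0 := by
        rw [hD0, RingHom.comp_apply, Ideal.Quotient.eq_zero_iff_mem, hmem,
          mem_HA.1 (coeff_vSer_mem_HA n j)]
        refine Dvd.dvd.mul_left (pow_dvd_pow _ ?_) _
        rw [Finset.mem_range] at hj
        omega
      rw [hD, RingHom.comp_apply, this, map_zero]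
  -- `Ψ` agrees with `D` on everything that occurs in `f` and sends `x (n + k)` to `ξ k`.
  set Ψ : GammaXY →+* S := evalHom (fun p => D (MvPolynomial.C (c p))) (by simp [c_zero])
    (qRel_map_c D) (fun j => if j < n then D (x j) else ξ (j - n)) fun j => D (y j) with hΨ
  have hc : ∀ p, Ψ (MvPolynomial.C (c p)) = D (MvPolynomial.C (c p)) :=
    fun p => evalHom_c _ _ _ _ _ p
  have hx : ∀ j < n, Ψ (x j) = D (x j) := fun j hj => by
    rw [hΨ, evalHom_x, if_pos hj]
  have hx' : ∀ k, Ψ (x (n + k)) = ξ k := fun k => by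
    rw [hΨ, evalHom_x, if_neg (by omega), Nat.add_sub_cancel_left]
  have hser : PowerSeries.map Ψ (ncSer (n + M)) = 1 := by
    rw [map_ncSer_add]
    simp only [hx']
    rw [← hv, cSer_map_eq hc hx, ← map_mul, ncSer_mul_vSer, map_one]
  have hker : ncIdeal (n + M) ≤ RingHom.ker Ψ := by
    refine Ideal.span_le.2 ?_
    rintro _ ⟨p, hp, rfl⟩
    have h1 := congrArg (PowerSeries.coeff p) hser
    rw [PowerSeries.coeff_map, PowerSeries.coeff_one,
      if_neg (Nat.one_le_iff_ne_zero.1 hp)] at h1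
    simpa [ncSer] using h1
  have h1 : D f = 0 := by
    rw [← eq_of_mem_GammaXn hc hx (fun j => evalHom_y _ _ _ _ _ j) hf]
    exact hker h
  have h2 : D0 f = 0 := by
    rw [hD, RingHom.comp_apply, ← map_zero φ] at h1
    exact hφ h1
  rw [hD0, RingHom.comp_apply, Ideal.Quotient.eq_zero_iff_mem, hmem,
    Polynomial.X_pow_dvd_iff] at h2
  rw [← eval_delta f, show delta f = 0 from ?_, Polynomial.eval_zero]
  ext1 k
  by_cases hk : k < M + 1
  · exact h2 k hk
  · exact Polynomial.coeff_eq_zero_of_natDegree_lt (by omega)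

/-! ## The common kernel of the divided differences -/

/-- The ring `ℤ[Y]`. -/
def ZY : Subring GammaXY := Subring.closure (Set.range y)

theorem y_mem_ZY (j : ℕ) : y j ∈ ZY := Subring.subset_closure ⟨j, rfl⟩

theorem ZY_le_GammaXn (n : ℕ) : ZY ≤ (GammaXn n).toSubring := by
  refine Subring.closure_le.2 ?_
  rintro _ ⟨j, rfl⟩
  exact y_mem_GammaXn j n

theorem mem_HA_zero_of_mem_ZY {f : GammaXY} (hf : f ∈ ZY) : f ∈ HA 0 := by
  induction hf using Subring.closure_induction with
  | mem f hf =>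
    obtain ⟨j, rfl⟩ := hf
    exact y_mem_HA j
  | zero => exact zero_mem _
  | one => simpa using intCast_mem_HA 1
  | add f g _ _ hf hg => exact add_mem hf hg
  | neg f _ hf => exact neg_mem hf
  | mul f g _ _ hf hg =>
    have := mul_mem_HA hf hg
    rwa [add_zero] at this

theorem C_mem_of_c_mem {T : Subring GammaXY} (h : ∀ p, MvPolynomial.C (c p) ∈ T) (r : Gamma) :
    MvPolynomial.C r ∈ T := by
  induction r using gamma_induction with
  | hint n => rw [map_intCast]; exact intCast_mem T n
  | hadd f g hf hg => rw [map_add]; exact add_mem hf hg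
  | hmul f g hf hg => rw [map_mul]; exact mul_mem hf hg
  | hc p => exact h p

/-- The series `c(t)` is obtained from `ⁿc(t)` by dividing out the factors `1 + x_j t`, so all of
`Γ` is recovered from the `ⁿc_p` and the `x_j`. -/
theorem C_mem_extX {S : Subring GammaXY} {n : ℕ} (hS : ∀ p, nc n p ∈ S) (r : Gamma) :
    MvPolynomial.C r ∈ extX S n := by
  refine C_mem_of_c_mem (fun p => ?_) r
  have := coeff_mem_of_prod_lin_mul (S := extX S n) (Finset.range n) (a := x)
    (fun j hj => x_mem_extX S (Finset.mem_range.1 hj)) (f := cSer) (fun p => ?_) p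
  · simpa [cSer] using this
  · rw [← ncSer_eq, ncSer, PowerSeries.coeff_mk]
    exact le_extX S n (hS p)

theorem xRho_mem_extX (S : Subring GammaXY) (n : ℕ) : xRho n ∈ extX S n :=
  prod_mem fun _ hj => pow_mem (x_mem_extX S (Finset.mem_range.1 hj)) _

/-- Being invariant under every `s_i`, `h` contains no `x_j` and passes as a scalar through words. A
word taking `xRho N` to `±1`, applied to `h * xRho N`, shows that `h` is a polynomial in the `ᴺc_p`
and the `y_j`. Modulo the `ᴺc_p` it is thus an element of `ℤ[Y]`, and with `N` the degree of `h` the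
congruence is an equality by `eq_zero_of_mem_ncIdeal`. -/
theorem mem_ZY_of_ddx_eq_zero {h : GammaXY} (hh : ∀ i, ddx i h = 0) : h ∈ ZY := by
  have hact : ∀ i, act i h = h := fun i => ddx_eq_zero_iff.1 (hh i)
  have h0 : h ∈ GammaXn 0 := mem_GammaXn_of_forall fun i _ => hact i
  set N := (delta h).natDegree with hN
  set S : Subring GammaXY := Subring.closure (Set.range (nc N) ∪ Set.range y) with hS
  have hnc : ∀ p, nc N p ∈ S := fun p => Subring.subset_closure (Or.inl ⟨p, rfl⟩)
  have hy : ∀ j, y j ∈ S := fun j => Subring.subset_closure (Or.inr ⟨j, rfl⟩)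
  have hinv : ∀ g ∈ S, ∀ i < N, act i g = g := by
    intro g hg i hi
    have : S ≤ (act i).eqLocus (RingHom.id GammaXY) := by
      refine Subring.closure_le.2 ?_
      rintro _ (⟨p, rfl⟩ | ⟨j, rfl⟩)
      · exact act_nc hi p
      · exact act_y i j
    exact this hg
  have hext : h ∈ extX S N := GammaXn_induction (P := (· ∈ extX S N)) h0 (C_mem_extX hnc)
    (fun f g hf hg => add_mem hf hg) (fun f g hf hg => mul_mem hf hg)
    (fun j hj => absurd hj (Nat.not_lt_zero j)) fun j => le_extX S N (hy j)
  obtain ⟨g, hg, hgb⟩ := exists_foldr_ddx_eq_mul hnc hinv (mul_mem hext (xRho_mem_extX S N))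
  obtain ⟨b, b1, b2, b3⟩ := exists_word_xRho N
  have hgh : h = g := by
    have := hgb b b1 b2
    rw [foldr_ddx_mul b fun i _ => hact i] at this
    rcases b3 with b3 | b3 <;> simpa [b3] using this
  have hSZ : S ≤ (ZY.map (Ideal.Quotient.mk (ncIdeal N))).comap
      (Ideal.Quotient.mk (ncIdeal N)) := by
    refine Subring.closure_le.2 ?_
    rintro _ (⟨p, rfl⟩ | ⟨j, rfl⟩)
    · rw [SetLike.mem_coe, Subring.mem_comap]
      rcases Nat.eq_zero_or_pos p with rfl | hp
      · rw [nc_zero, map_one]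
        exact one_mem _
      · rw [Ideal.Quotient.eq_zero_iff_mem.2 (nc_mem_ncIdeal hp)]
        exact zero_mem _
    · exact ⟨y j, y_mem_ZY j, rfl⟩
  obtain ⟨z, hz, hzh⟩ := hSZ (hgh ▸ hg : h ∈ S)
  have hz0 : h - z = 0 := by
    refine eq_zero_of_mem_ncIdeal (n := 0) (M := N) (sub_mem h0 (ZY_le_GammaXn 0 hz)) ?_ ?_
    · rw [map_sub, mem_HA.1 (mem_HA_zero_of_mem_ZY hz), pow_zero, mul_one,
        Polynomial.natDegree_sub_C]
    · rw [zero_add]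
      exact Ideal.Quotient.eq.1 hzh.symm
  rw [sub_eq_zero.1 hz0]
  exact hz

/-! ## Elimination of symmetric variables -/

theorem algHom_eq_of_mem_GammaX {A : Type*} [CommRing A] [Algebra Gamma A]
    {φ ψ : GammaXY →ₐ[Gamma] A} {n : ℕ} (hx : ∀ j < n, φ (x j) = ψ (x j)) {f : GammaXY}
    (hf : f ∈ GammaX n) : φ f = ψ f := by
  refine AlgHom.adjoin_le_equalizer φ ψ ?_ hf
  rintro _ ⟨j, hj, rfl⟩
  exact hx j hj

theorem x_mem_GammaX {j n : ℕ} (h : j < n) : x j ∈ GammaX n :=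
  Algebra.subset_adjoin ⟨j, h, rfl⟩

theorem nc_mem_GammaX (n p : ℕ) : nc n p ∈ GammaX n := by
  refine sum_mem fun j _ => mul_mem (C_mem _ _) (sum_mem fun t ht => prod_mem fun i hi => ?_)
  exact x_mem_GammaX (Finset.mem_range.1 ((Finset.mem_powersetCard.1 ht).1 hi))

theorem coeff_vSer_mem_GammaX (n p : ℕ) : PowerSeries.coeff p (vSer n) ∈ GammaX n := by
  induction p using Nat.strong_induction_on with
  | _ p ih =>
    rcases p with _ | p
    · rw [coeff_vSer_zero]
      exact one_mem _
    · have h := congrArg (PowerSeries.coeff (p + 1)) (ncSer_mul_vSer n)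
      rw [PowerSeries.coeff_mul, Finset.Nat.sum_antidiagonal_succ, PowerSeries.coeff_one,
        if_neg (Nat.succ_ne_zero p)] at h
      simp only [ncSer, PowerSeries.coeff_mk, nc_zero, one_mul] at h
      rw [eq_neg_of_add_eq_zero_left h]
      refine neg_mem (sum_mem fun ij hij => mul_mem (nc_mem_GammaX n _) (ih _ ?_))
      have := Finset.HasAntidiagonal.mem_antidiagonal.1 hij
      omega

theorem coeff_prod_one_add_eq_esymm {A B : Type*} [CommRing A] [CommRing B] [Algebra A B] (M : ℕ)
    (a : ℕ → B) (j : ℕ) :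
    PowerSeries.coeff j (∏ k ∈ Finset.range M, (1 + PowerSeries.C (a k) * PowerSeries.X)) =
      MvPolynomial.aeval (fun k : Fin M => a k) (MvPolynomial.esymm (Fin M) A j) := by
  rw [Finset.prod_range, Finset.prod_one_add, map_sum, MvPolynomial.esymm, map_sum,
    Finset.powersetCard_eq_filter, Finset.sum_filter]
  refine Finset.sum_congr rfl fun t _ => ?_
  rw [Finset.prod_mul_distrib, Finset.prod_const, ← map_prod, PowerSeries.coeff_C_mul,
    PowerSeries.coeff_X_pow, map_prod]
  simp only [eq_comm (a := j), mul_ite, mul_one, mul_zero, MvPolynomial.aeval_X]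

section Elim

variable (n M : ℕ)

/-- The map that views `x_{n+1}, …, x_{n+M}` as polynomial variables. -/
def splitX : GammaXY →ₐ[Gamma] MvPolynomial (Fin M) GammaXY :=
  MvPolynomial.aeval (Sum.elim (fun j => if j < n then MvPolynomial.C (x j) else
    if h : j - n < M then MvPolynomial.X ⟨j - n, h⟩ else 0) fun _ => 0)

theorem splitX_of_lt {j : ℕ} (h : j < n) : splitX n M (x j) = MvPolynomial.C (x j) := by
  simp [splitX, x, h]

theorem splitX_add (k : Fin M) : splitX n M (x (n + k)) = MvPolynomial.X k := by
  simp [splitX, x]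

/-- The map that sets `x_j = 0` for `j > n`, and all `y_j = 0`. -/
def truncX : GammaXY →ₐ[Gamma] GammaXY :=
  MvPolynomial.aeval (Sum.elim (fun j => if j < n then x j else 0) fun _ => 0)

theorem truncX_of_lt {j : ℕ} (h : j < n) : truncX n (x j) = x j := by
  simp [truncX, x, h]

theorem truncX_mem (f : GammaXY) : truncX n f ∈ GammaX n := by
  induction f using MvPolynomial.induction_on with
  | C r => rw [algHom_C]; exact C_mem _ r
  | add f g hf hg => rw [map_add]; exact add_mem hf hg
  | mul_X f i hf =>
    rw [map_mul]
    refine mul_mem hf ?_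
    rcases i with j | j
    · simp only [truncX, MvPolynomial.aeval_X, Sum.elim_inl]
      split_ifs with h
      · exact x_mem_GammaX h
      · exact zero_mem _
    · simp only [truncX, MvPolynomial.aeval_X, Sum.elim_inr]
      exact zero_mem _

/-- The map that evaluates the polynomial variables at `x_{n+1}, …, x_{n+M}`. -/
def joinX : MvPolynomial (Fin M) GammaXY →ₐ[GammaXY] GammaXY :=
  MvPolynomial.aeval fun k => x (n + k)

variable {n M}

theorem joinX_splitX {f : GammaXY} (hf : f ∈ GammaX (n + M)) :
    joinX n M (splitX n M f) = f := by
  refine algHom_eq_of_mem_GammaX (φ := ((joinX n M).restrictScalars Gamma).comp (splitX n M))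
    (ψ := AlgHom.id Gamma GammaXY) (fun j hj => ?_) hf
  simp only [AlgHom.comp_apply, AlgHom.restrictScalars_apply, AlgHom.id_apply]
  by_cases h : j < n
  · rw [splitX_of_lt n M h, joinX, MvPolynomial.aeval_C, Algebra.algebraMap_self,
      RingHom.id_apply]
  · obtain ⟨k, rfl⟩ := Nat.exists_eq_add_of_le (not_lt.1 h)
    rw [splitX_add n M ⟨k, by omega⟩, joinX, MvPolynomial.aeval_X]

/-- All coefficients of `splitX n M f` lie in `Γ[X_n]`. Truncation thus fixes them, and can be used
to push arbitrary coefficients of a symmetric expression into `Γ[X_n]`. -/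
theorem map_truncX_splitX {f : GammaXY} (hf : f ∈ GammaX (n + M)) :
    MvPolynomial.mapAlgHom (truncX n) (splitX n M f) = splitX n M f := by
  refine algHom_eq_of_mem_GammaX (φ := (MvPolynomial.mapAlgHom (truncX n)).comp (splitX n M))
    (fun j hj => ?_) hf
  rw [AlgHom.comp_apply]
  by_cases h : j < n
  · rw [splitX_of_lt n M h, MvPolynomial.mapAlgHom_apply, MvPolynomial.map_C, RingHom.coe_coe,
      truncX_of_lt n h]
  · obtain ⟨k, rfl⟩ := Nat.exists_eq_add_of_le (not_lt.1 h)
    rw [splitX_add n M ⟨k, by omega⟩, MvPolynomial.mapAlgHom_apply, MvPolynomial.map_X]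

theorem splitX_act {k : ℕ} (hk : k + 1 < M) {f : GammaXY} (hf : f ∈ GammaX (n + M)) :
    splitX n M (act (n + k + 1) f) = MvPolynomial.rename
      (Equiv.swap (⟨k, by omega⟩ : Fin M) ⟨k + 1, hk⟩) (splitX n M f) := by
  have hact : act (n + k + 1) f =
      MvPolynomial.rename (Sum.map (Equiv.swap (n + k) (n + k + 1)) id) f := rfl
  rw [hact]
  set τ := Equiv.swap (⟨k, by omega⟩ : Fin M) ⟨k + 1, hk⟩ with hτ
  set φ : GammaXY →ₐ[Gamma] MvPolynomial (Fin M) GammaXY := (splitX n M).comp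
    (MvPolynomial.rename (Sum.map (Equiv.swap (n + k) (n + k + 1)) id)) with hφ
  set ψ : GammaXY →ₐ[Gamma] MvPolynomial (Fin M) GammaXY :=
    ((MvPolynomial.rename τ : MvPolynomial (Fin M) GammaXY →ₐ[GammaXY] _).restrictScalars
      Gamma).comp (splitX n M) with hψ
  suffices h : φ f = ψ f by
    rwa [hφ, hψ, AlgHom.comp_apply, AlgHom.comp_apply, AlgHom.restrictScalars_apply] at h
  refine algHom_eq_of_mem_GammaX (fun j hj => ?_) hf
  rw [hφ, hψ, AlgHom.comp_apply, AlgHom.comp_apply, AlgHom.restrictScalars_apply,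
    show MvPolynomial.rename (Sum.map (Equiv.swap (n + k) (n + k + 1)) id) (x j) =
      x (Equiv.swap (n + k) (n + k + 1) j) by simp [x]]
  by_cases h : j < n
  · rw [Equiv.swap_apply_of_ne_of_ne (by omega) (by omega), splitX_of_lt n M h,
      MvPolynomial.rename_C]
  · obtain ⟨l, rfl⟩ := Nat.exists_eq_add_of_le (not_lt.1 h)
    have hl : Equiv.swap (n + k) (n + k + 1) (n + l) = n + (τ ⟨l, by omega⟩ : ℕ) := by
      simp only [hτ, Equiv.swap_apply_def, Fin.ext_iff, apply_ite Fin.val]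
      split_ifs <;> omega
    rw [hl, splitX_add n M ⟨l, by omega⟩, MvPolynomial.rename_X, ← splitX_add]

/-- The adjacent transpositions generate the symmetric group, and they correspond to the reflections
`s_i` with `n < i < n + M`. -/
theorem isSymmetric_splitX {f : GammaXY} (hf : f ∈ GammaX (n + M))
    (h : ∀ i, n < i → i < n + M → act i f = f) : (splitX n M f).IsSymmetric := by
  rcases M with _ | M
  · intro σ
    rw [Subsingleton.elim σ 1]
    exact MvPolynomial.rename_id_apply _
  intro σ
  have hσ : σ ∈ Submonoid.closure (Set.range fun i : Fin M => Equiv.swap i.castSucc i.succ) := by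
    rw [Equiv.Perm.mclosure_swap_castSucc_succ]
    trivial
  induction hσ using Submonoid.closure_induction with
  | mem σ hσ =>
    obtain ⟨i, rfl⟩ := hσ
    have := splitX_act (M := M + 1) (k := i) (by omega) hf
    rw [h _ (by omega) (by omega)] at this
    exact this.symm
  | one => exact MvPolynomial.rename_id_apply _
  | mul σ τ _ _ hσ hτ =>
    rw [Equiv.Perm.coe_mul, ← MvPolynomial.rename_rename, hτ, hσ]

/-- Modulo the ideal, `ⁿc(t) ∏ (1 + x_{n+k} t) = 1`, so the product over the last `M` variables is
the inverse series of `ⁿc(t)`. -/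
theorem esymm_sub_coeff_vSer_mem (n M j : ℕ) :
    joinX n M (MvPolynomial.esymm (Fin M) GammaXY j) - PowerSeries.coeff j (vSer n) ∈
      ncIdeal (n + M) := by
  set q := Ideal.Quotient.mk (ncIdeal (n + M)) with hq
  have h1 : PowerSeries.map q (ncSer (n + M)) = 1 := by
    ext p
    rw [PowerSeries.coeff_map, ncSer, PowerSeries.coeff_mk, PowerSeries.coeff_one]
    split_ifs with hp
    · rw [hp, nc_zero, map_one]
    · exact Ideal.Quotient.eq_zero_iff_mem.2 (nc_mem_ncIdeal (Nat.one_le_iff_ne_zero.2 hp))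
  rw [map_ncSer_add] at h1
  have h2 := congrArg (PowerSeries.map q) (ncSer_mul_vSer n)
  rw [map_mul, map_one] at h2
  have h3 : PowerSeries.map q (vSer n) =
      ∏ k ∈ Finset.range M, (1 + PowerSeries.C (q (x (n + k))) * PowerSeries.X) := by
    linear_combination (∏ k ∈ Finset.range M,
      (1 + PowerSeries.C (q (x (n + k))) * PowerSeries.X)) * h2 - PowerSeries.map q (vSer n) * h1
  have h4 := congrArg (PowerSeries.coeff j) h3
  rw [coeff_prod_one_add_eq_esymm (A := GammaXY), PowerSeries.coeff_map] at h4
  refine Ideal.Quotient.eq.1 ?_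
  rw [← hq, h4, joinX]
  exact MvPolynomial.comp_aeval_apply (fun k : Fin M => x (n + k))
    (Ideal.Quotient.mkₐ GammaXY (ncIdeal (n + M))) _

/-- By the fundamental theorem on symmetric polynomials, `f` is a polynomial in the elementary
symmetric functions of the last `M` variables. Modulo the ideal each of these is a coefficient of
`vSer n`, which lies in `Γ[X_n]`. -/
theorem exists_sub_mem_ncIdeal {f : GammaXY} (hf : f ∈ GammaX (n + M))
    (h : ∀ i, n < i → i < n + M → act i f = f) :
    ∃ g ∈ GammaX n, f - g ∈ ncIdeal (n + M) := by
  obtain ⟨p, hp⟩ := MvPolynomial.esymmAlgHom_surjective (σ := Fin M) GammaXY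
    (by simp : Fintype.card (Fin M) ≤ M) ⟨splitX n M f, isSymmetric_splitX hf h⟩
  have hp' := congrArg Subtype.val hp
  rw [MvPolynomial.esymmAlgHom_apply] at hp'
  have e1 : joinX n M (MvPolynomial.mapAlgHom (truncX n) (MvPolynomial.aeval
      (fun i : Fin M => MvPolynomial.esymm (Fin M) GammaXY (i + 1)) p)) = f := by
    rw [hp', map_truncX_splitX hf, joinX_splitX hf]
  -- The polynomial `p` may have coefficients outside `Γ[X_n]`; truncating them does not change the
  -- value, by `map_truncX_splitX`.
  refine ⟨MvPolynomial.aeval (fun i : Fin M => PowerSeries.coeff (i + 1) (vSer n))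
    (MvPolynomial.mapAlgHom (truncX n) p), ?_, ?_⟩
  · clear hp hp' e1
    induction p using MvPolynomial.induction_on with
    | C r =>
      rw [MvPolynomial.mapAlgHom_apply, MvPolynomial.map_C, MvPolynomial.aeval_C,
        Algebra.algebraMap_self, RingHom.id_apply]
      exact truncX_mem n r
    | add p q hp hq => rw [map_add, map_add]; exact add_mem hp hq
    | mul_X p i hp =>
      rw [map_mul, map_mul, MvPolynomial.mapAlgHom_apply _ (MvPolynomial.X i),
        MvPolynomial.map_X, MvPolynomial.aeval_X]
      exact mul_mem hp (coeff_vSer_mem_GammaX n _)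
  · refine Ideal.Quotient.eq.1 ?_
    rw [← e1]
    clear hp hp' e1
    induction p using MvPolynomial.induction_on with
    | C r => simp
    | add p q hp hq => simp only [map_add, hp, hq]
    | mul_X p i hp =>
      have h1 := Ideal.Quotient.eq.2 (esymm_sub_coeff_vSer_mem n M (i + 1))
      rw [map_mul, map_mul, map_mul, map_mul, hp, map_mul, map_mul, MvPolynomial.aeval_X,
        MvPolynomial.mapAlgHom_apply _ (MvPolynomial.X i), MvPolynomial.map_X,
        MvPolynomial.aeval_X, MvPolynomial.mapAlgHom_apply _ (MvPolynomial.esymm _ _ _),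
        MvPolynomial.map_esymm, h1, map_mul]

end Elim

theorem coeff_delta_mem_GammaX {n : ℕ} {f : GammaXY} (hf : f ∈ GammaX n) (d : ℕ) :
    (delta f).coeff d ∈ GammaX n := by
  have key : ∀ {f : GammaXY} {k : ℕ}, f ∈ GammaX n → f ∈ HA k →
      ∀ d, (delta f).coeff d ∈ GammaX n := by
    intro f k hf hk d
    rw [mem_HA.1 hk, Polynomial.coeff_C_mul_X_pow]
    split_ifs
    · exact hf
    · exact zero_mem _
  have hadd : ∀ f g : GammaXY, (∀ d, (delta f).coeff d ∈ GammaX n) →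
      (∀ d, (delta g).coeff d ∈ GammaX n) → ∀ d, (delta (f + g)).coeff d ∈ GammaX n := by
    intro f g hf hg d
    rw [map_add, Polynomial.coeff_add]
    exact add_mem (hf d) (hg d)
  have hmul : ∀ f g : GammaXY, (∀ d, (delta f).coeff d ∈ GammaX n) →
      (∀ d, (delta g).coeff d ∈ GammaX n) → ∀ d, (delta (f * g)).coeff d ∈ GammaX n := by
    intro f g hf hg d
    rw [map_mul, Polynomial.coeff_mul]
    exact sum_mem fun ij _ => mul_mem (hf _) (hg _)
  induction hf using Algebra.adjoin_induction generalizing d with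
  | mem f hf =>
    obtain ⟨j, hj, rfl⟩ := hf
    exact key (x_mem_GammaX hj) (x_mem_HA j) d
  | algebraMap r =>
    rw [MvPolynomial.algebraMap_eq]
    induction r using gamma_induction generalizing d with
    | hint m => rw [map_intCast]; exact key (intCast_mem _ m) (intCast_mem_HA m) d
    | hadd f g hf hg => rw [map_add MvPolynomial.C]; exact hadd _ _ hf hg d
    | hmul f g hf hg => rw [map_mul MvPolynomial.C]; exact hmul _ _ hf hg d
    | hc p => exact key (C_mem _ _) (c_mem_HA p) d
  | add f g _ _ hf hg => exact hadd f g hf hg d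
  | mul f g _ _ hf hg => exact hmul f g hf hg d

theorem exists_sub_mem_ncIdeal_of_mem_HA {n M d : ℕ} {f : GammaXY} (hf : f ∈ GammaX (n + M))
    (h : ∀ i, n < i → i < n + M → act i f = f) (hd : f ∈ HA d) :
    ∃ g ∈ GammaX n, g ∈ HA d ∧ f - g ∈ ncIdeal (n + M) := by
  obtain ⟨g, hg, hfg⟩ := exists_sub_mem_ncIdeal hf h
  refine ⟨(delta g).coeff d, coeff_delta_mem_GammaX hg d, coeff_delta_mem_HA g d, ?_⟩
  have := coeff_delta_mem_ncIdeal hfg d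
  rwa [map_sub, Polynomial.coeff_sub, mem_HA.1 hd, Polynomial.coeff_C_mul_X_pow, if_pos rfl]
    at this

/-! ## Divided differences of elements without `y_j` -/

theorem act_act_comm {i j : ℕ} (h : i + 2 ≤ j) (f : GammaXY) :
    act i (act j f) = act j (act i f) := by
  suffices h : (act i).comp (act j) = (act j).comp (act i) from RingHom.congr_fun h f
  refine gammaXY_hom_ext (fun p => ?_) (fun k => act_comm h (x_mem_ZX k)) fun k => ?_
  · obtain ⟨j, rfl⟩ : ∃ k, j = k + 2 := ⟨j - 2, by omega⟩
    rw [RingHom.comp_apply, RingHom.comp_apply, show j + 2 = (j + 1) + 1 from rfl, act_c_succ]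
    cases i with
    | zero =>
      rw [act_c_zero, s0c]
      simp only [map_add, map_mul, map_sum, map_pow, map_ofNat, act_c_succ, act_x_succ]
      rw [Equiv.swap_apply_of_ne_of_ne (by omega) (by omega)]
    | succ i => rw [act_c_succ, act_c_succ]
  · rw [RingHom.comp_apply, RingHom.comp_apply, act_y, act_y, act_y]

theorem act_ddx_comm {i j : ℕ} (h : i + 2 ≤ j) (f : GammaXY) :
    act j (ddx i f) = ddx i (act j f) := by
  apply den_mul_cancel (i := i)
  have e := congrArg (act j) (den_mul_ddx i f)
  rw [map_mul, map_sub, (act_den_of_le h).2, ← act_act_comm h] at e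
  rw [e, den_mul_ddx]

theorem act_eq_of_mem_GammaXn {n i : ℕ} (hi : n < i) {f : GammaXY} (hf : f ∈ GammaXn n) :
    act i f = f := by
  obtain ⟨i, rfl⟩ := Nat.exists_eq_succ_of_ne_zero (Nat.ne_of_gt (Nat.zero_lt_of_lt hi))
  refine eq_of_mem_GammaXn (φ := act (i + 1)) (ψ := RingHom.id _) (act_c_succ i) (fun j hj => ?_)
    (fun j => act_y _ j) hf
  rw [act_x_succ, Equiv.swap_apply_of_ne_of_ne (by omega) (by omega), RingHom.id_apply]

/-- The reflections `s_j` with `j > n` commute with `∂_i` for `i < n`, so the result is invariant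
under all of them. -/
theorem ddx_mem_GammaXn {n i : ℕ} (hi : i < n) {f : GammaXY} (hf : f ∈ GammaXn n) :
    ddx i f ∈ GammaXn n :=
  mem_GammaXn_of_forall fun j hj => by
    rw [act_ddx_comm (by omega), act_eq_of_mem_GammaXn hj hf]

/-- The substitution `y_j ↦ 0`. -/
def killY : GammaXY →ₐ[Gamma] GammaXY :=
  MvPolynomial.aeval (Sum.elim x fun _ => 0)

theorem killY_x (j : ℕ) : killY (x j) = x j := by simp [killY, x]

theorem killY_y (j : ℕ) : killY (y j) = 0 := by simp [killY, y]

theorem killY_mem_GammaX {n : ℕ} {f : GammaXY} (hf : f ∈ GammaXn n) : killY f ∈ GammaX n := by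
  refine GammaXn_induction (P := fun f => killY f ∈ GammaX n) hf
    (fun r => by rw [algHom_C]; exact C_mem _ r)
    (fun f g hf hg => by rw [map_add]; exact add_mem hf hg)
    (fun f g hf hg => by rw [map_mul]; exact mul_mem hf hg)
    (fun j hj => by rw [killY_x]; exact x_mem_GammaX hj)
    fun j => by rw [killY_y]; exact zero_mem _

theorem killY_of_mem_GammaX {n : ℕ} {f : GammaXY} (hf : f ∈ GammaX n) : killY f = f :=
  algHom_eq_of_mem_GammaX (φ := killY) (ψ := AlgHom.id _ _) (fun j _ => killY_x j) hf

theorem killY_of_mem_ZX {f : GammaXY} (hf : f ∈ ZX) : killY f = f :=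
  eq_of_mem_ZX (φ := killY.toRingHom) (ψ := RingHom.id _) killY_x hf

theorem killY_act (i : ℕ) (f : GammaXY) : killY (act i f) = act i (killY f) := by
  suffices h : killY.toRingHom.comp (act i) = (act i).comp killY.toRingHom from
    RingHom.congr_fun h f
  refine gammaXY_hom_ext (fun p => ?_) (fun j => ?_) fun j => ?_
  · change killY (act i _) = act i (killY _)
    rw [algHom_C]
    cases i with
    | zero => simp [act_c_zero, s0c, algHom_C, killY_x, map_ofNat]
    | succ k => rw [act_c_succ, algHom_C]
  · change killY (act i _) = act i (killY _)
    rw [killY_x]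
    exact killY_of_mem_ZX (act_mem_ZX i (x_mem_ZX j))
  · change killY (act i _) = act i (killY _)
    rw [act_y, killY_y, map_zero]

theorem killY_ddx (i : ℕ) (f : GammaXY) : killY (ddx i f) = ddx i (killY f) := by
  apply den_mul_cancel (i := i)
  have hd : killY (den i) = den i := by
    cases i <;> simp [den, killY_x, map_ofNat]
  rw [den_mul_ddx, ← killY_act, ← map_sub, ← den_mul_ddx, map_mul, hd]

theorem constTerm_c (p : ℕ) : constTerm (MvPolynomial.C (c p)) = if p = 0 then 1 else 0 := by
  simp [constTerm, gammaLift_c]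

theorem constTerm_x (j : ℕ) : constTerm (x j) = 0 := by simp [constTerm, x]

theorem constTerm_y (j : ℕ) : constTerm (y j) = 0 := by simp [constTerm, y]

theorem constTerm_killY (f : GammaXY) : constTerm (killY f) = constTerm f := by
  suffices h : constTerm.comp killY.toRingHom = constTerm from RingHom.congr_fun h f
  refine gammaXY_hom_ext (fun p => ?_) (fun j => ?_) fun j => ?_
  · exact congrArg constTerm (algHom_C killY _)
  · exact congrArg constTerm (killY_x j)
  · exact (congrArg constTerm (killY_y j)).trans ((map_zero _).trans (constTerm_y j).symm)

theorem killY_of_mem_ZY {f : GammaXY} (hf : f ∈ ZY) : killY f = (constTerm f : ℤ) := by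
  refine RingHom.eqOn_set_closure (s := Set.range y) (f := killY.toRingHom)
    (g := (Int.castRingHom GammaXY).comp constTerm) ?_ hf
  rintro _ ⟨j, rfl⟩
  change killY (y j) = ((constTerm (y j) : ℤ) : GammaXY)
  rw [killY_y, constTerm_y, Int.cast_zero]

/-- An element without `y_j` that is annihilated by all divided differences is constant. -/
theorem eq_constTerm_of_ddx_eq_zero {f : GammaXY} (hy : killY f = f) (h : ∀ i, ddx i f = 0) :
    f = (constTerm f : ℤ) := by
  rw [← killY_of_mem_ZY (mem_ZY_of_ddx_eq_zero h), hy]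

theorem constTerm_of_mem_HA {d : ℕ} (hd : d ≠ 0) {f : GammaXY} (hf : f ∈ HA d) :
    constTerm f = 0 := by
  have h : constTerm.comp ((Polynomial.evalRingHom 0).comp delta) = constTerm := by
    refine gammaXY_hom_ext (fun p => ?_) (fun j => ?_) fun j => ?_
    · cases p <;> simp [delta_c, constTerm_c]
    · simp [delta_x, constTerm_x]
    · simp [delta_y, constTerm_y]
  rw [← h, RingHom.comp_apply, RingHom.comp_apply, mem_HA.1 hf]
  simp [hd]

/-! ## Schubert polynomials of level `N` -/

theorem foldr_ddx_neg (a : List ℕ) (f : GammaXY) : a.foldr ddx (-f) = -a.foldr ddx f := by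
  rw [← add_eq_zero_iff_eq_neg, ← foldr_ddx_add, neg_add_cancel, foldr_ddx_zero]

/-- Some reduced word of `w` begins with `i`, and `∂_i ∘ ∂_i = 0`. -/
theorem ddx_foldr_eq_zero {a : List ℕ} {w : Winf} (ha : IsReducedWord a w) {i : ℕ}
    (hi : length (s i * w) < length w) {f : GammaXY} (hf : f ∈ ZX) :
    ddx i (a.foldr ddx f) = 0 := by
  obtain ⟨b, hb⟩ := exists_reducedWord (s i * w)
  have h : IsReducedWord (i :: b) w := by
    have := hb.cons (i := i) (by
      rw [s_mul_s_mul]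
      rcases length_s_mul_or w i with h | h <;> omega)
    rwa [s_mul_s_mul] at this
  rw [foldr_ddx_eq ha h hf, List.foldr_cons, ddx_ddx]

/-- A word that is not reduced acts by zero on `ℤ[X]`. This identifies the explicit word for `xRho
n` as a reduced word of `w0 n` without computing its product. -/
theorem isReducedWord_of_foldr_ddx_ne_zero {a : List ℕ} {f : GammaXY} (hf : f ∈ ZX)
    (h : a.foldr ddx f ≠ 0) : IsReducedWord a (a.map s).prod := by
  induction a with
  | nil => exact isReducedWord_nil
  | cons i a ih =>
    rw [List.foldr_cons] at h
    have ha := ih fun h0 => h (by rw [h0, ddx_zero])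
    rw [List.map_cons, List.prod_cons]
    refine ha.cons ?_
    by_contra hl
    refine h (ddx_foldr_eq_zero ha ?_ hf)
    rcases length_s_mul_or (a.map s).prod i with h | h <;> omega

theorem prod_map_s_mem_W {n : ℕ} {a : List ℕ} (h : ∀ i ∈ a, i < n) : (a.map s).prod ∈ W n := by
  refine list_prod_mem fun w hw => ?_
  obtain ⟨i, hi, rfl⟩ := List.mem_map.1 hw
  exact s_mem_W (h i hi)

theorem eq_w0_of_length {n : ℕ} {w : Winf} (hw : w ∈ W n) (h : length w = n ^ 2) : w = w0 n := by
  have h1 := length_w0_mul hw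
  have h2 : w0 n * w = 1 := length_eq_zero (by omega)
  rw [← w0_inv n]
  exact eq_inv_of_mul_eq_one_right h2

theorem isReducedWord_w0 {n : ℕ} {b : List ℕ} (h1 : b.length = n ^ 2) (h2 : ∀ i ∈ b, i < n)
    (h3 : b.foldr ddx (xRho n) ≠ 0) : IsReducedWord b (w0 n) := by
  have h := isReducedWord_of_foldr_ddx_ne_zero (HX_le_ZX (xRho_mem_HX n)) h3
  have h4 : (b.map s).prod = w0 n :=
    eq_w0_of_length (prod_map_s_mem_W h2) (by rw [← h.2, h1])
  rwa [h4] at h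

theorem exists_top_class (N : ℕ) : ∃ f ∈ HX (N ^ 2), f ∈ GammaXn N ∧
    ∀ a, IsReducedWord a (w0 N) → a.foldr ddx f = 1 := by
  obtain ⟨b, b1, b2, b3⟩ := exists_word_xRho N
  have hx : xRho N ∈ GammaXn N :=
    prod_mem fun j hj => pow_mem (x_mem_GammaXn (Finset.mem_range.1 hj)) _
  have hb : IsReducedWord b (w0 N) := isReducedWord_w0 b1 b2 (by
    rcases b3 with h | h <;> rw [h] <;> simp)
  have hf : ∀ a, IsReducedWord a (w0 N) → a.foldr ddx (xRho N) = b.foldr ddx (xRho N) :=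
    fun a ha => foldr_ddx_eq ha hb (HX_le_ZX (xRho_mem_HX N))
  rcases b3 with h | h
  · exact ⟨xRho N, xRho_mem_HX N, hx, fun a ha => by rw [hf a ha, h]⟩
  · exact ⟨-xRho N, neg_mem (xRho_mem_HX N), neg_mem hx, fun a ha => by
      rw [foldr_ddx_neg, hf a ha, h, neg_neg]⟩

theorem foldr_ddx_mem_GammaXn {n : ℕ} {a : List ℕ} (ha : ∀ i ∈ a, i < n) {f : GammaXY}
    (hf : f ∈ GammaXn n) : a.foldr ddx f ∈ GammaXn n := by
  induction a with
  | nil => exact hf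
  | cons i a ih =>
    exact ddx_mem_GammaXn (ha i List.mem_cons_self) (ih fun j hj => ha j (List.mem_cons_of_mem _ hj))

-- The choice is `F w = ∂_{w⁻¹ w_0} f` for a top class `f`. Since `(w s_i)⁻¹ w_0 = s_i w⁻¹ w_0`,
-- applying `∂_i` lengthens the word exactly when `w s_i` is shorter than `w`, and gives zero
-- otherwise.
open scoped Classical in
theorem exists_level_family (N : ℕ) : ∃ F : Winf → GammaXY, F 1 = 1 ∧ ∀ w ∈ W N,
    F w ∈ GammaX N ∧ F w ∈ HA (length w) ∧
      ∀ i < N, ddx i (F w) = if length (w * s i) < length w then F (w * s i) else 0 := by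
  obtain ⟨f, hf, hf', h1⟩ := exists_top_class N
  have hfZ : f ∈ ZX := HX_le_ZX hf
  choose r hr using exists_reducedWord
  refine ⟨fun w => (r (w⁻¹ * w0 N)).foldr ddx f, h1 _ ?_, fun w hw => ⟨?_, ?_, fun i hi => ?_⟩⟩
  · have := hr (1⁻¹ * w0 N)
    rwa [inv_one, one_mul] at this
  · have h2 := foldr_ddx_mem_GammaXn ((hr _).lt (mul_mem (inv_mem hw) (w0_mem_W N))) hf'
    dsimp only
    rw [← killY_of_mem_ZX (f := (r (w⁻¹ * w0 N)).foldr ddx f) ?_]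
    · exact killY_mem_GammaX h2
    · generalize r (w⁻¹ * w0 N) = a
      induction a with
      | nil => exact hfZ
      | cons i a ih => exact ddx_mem_ZX i ih
  · refine HX_le_HA (foldr_ddx_mem_HX _ ?_)
    rwa [(hr _).2, add_comm, length_inv_mul_w0 hw]
  · dsimp only
    have e1 := length_inv_mul_w0 hw
    have e2 := length_inv_mul_w0 (mul_mem hw (s_mem_W hi))
    have e3 : (w * s i)⁻¹ * w0 N = s i * (w⁻¹ * w0 N) := by
      rw [mul_inv_rev, s_inv, mul_assoc]
    rw [e3] at e2 ⊢
    have e4 := length_mul_s_or w i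
    split_ifs with h
    · exact foldr_ddx_eq ((hr _).cons (by omega)) (hr _) hfZ
    · exact ddx_foldr_eq_zero (hr _) (by omega) hfZ

/-! ## Single Schubert polynomials -/

theorem natDegree_delta_le {d M : ℕ} {f : GammaXY} (hf : f ∈ HA d) (h : d ≤ M) :
    (delta f).natDegree ≤ M := by
  rw [mem_HA.1 hf]
  exact (Polynomial.natDegree_C_mul_X_pow_le _ _).trans h

theorem length_le_sq {n : ℕ} {w : Winf} (hw : w ∈ W n) : length w ≤ n ^ 2 := by
  have := length_w0_mul hw
  omega

theorem lt_of_length_mul_s_lt {n : ℕ} {w : Winf} (hw : w ∈ W n) {i : ℕ}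
    (h : length (w * s i) < length w) : i < n := lt_of_descent hw (length_mul_s_lt_iff.1 h)

-- For `w ∈ W n` the level `N` polynomial is symmetric in the variables beyond `x_n`, and is
-- therefore congruent to some `G w` in `Γ[X_n]` of the same degree. The recursion for `G` holds
-- modulo the ideal of the `ᴺc_p`, and exactly because `N` is large.
open scoped Classical in
theorem exists_stable_family (n : ℕ) : ∃ G : Winf → GammaXY, G 1 = 1 ∧ ∀ w ∈ W n,
    G w ∈ GammaX n ∧ G w ∈ HA (length w) ∧
      ∀ i, ddx i (G w) = if length (w * s i) < length w then G (w * s i) else 0 := by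
  -- The level `n + 1 + n²` has room for the `n + 1` variables involved in `∂_n` and for the bound
  -- `n²` on the degrees, as `eq_zero_of_mem_ncIdeal` requires.
  have hN : n + (n ^ 2 + 1) = n + 1 + n ^ 2 := by ring
  obtain ⟨F, hF1, hF⟩ := exists_level_family (n + (n ^ 2 + 1))
  have hW : W n ≤ W (n + (n ^ 2 + 1)) := W_mono (by omega)
  have key : ∀ w ∈ W n, ∃ g ∈ GammaX n, g ∈ HA (length w) ∧
      F w - g ∈ ncIdeal (n + (n ^ 2 + 1)) := by
    intro w hw
    obtain ⟨h1, h2, h3⟩ := hF w (hW hw)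
    refine exists_sub_mem_ncIdeal_of_mem_HA h1 (fun i hi hi' => ddx_eq_zero_iff.1 ?_) h2
    rw [h3 i hi', if_neg fun h => (lt_of_length_mul_s_lt hw h).not_gt hi]
  choose! G hG hGd hGF using key
  have hX : ∀ w ∈ W n, G w ∈ GammaXn (n + 1) := fun w hw =>
    GammaXn_mono (Nat.le_succ n) (GammaX_le_GammaXn n (hG w hw))
  refine ⟨G, ?_, fun w hw => ⟨hG w hw, hGd w hw, fun i => ?_⟩⟩
  · have h1 := hGd 1 (one_mem _)
    rw [length_one] at h1
    have h2 : (1 : GammaXY) ∈ HA 0 := by simpa using intCast_mem_HA 1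
    refine (sub_eq_zero.1 (eq_zero_of_mem_ncIdeal (n := n + 1) (M := n ^ 2)
      (sub_mem (one_mem _) (hX 1 (one_mem _)))
      (natDegree_delta_le (sub_mem h2 h1) (Nat.zero_le _)) ?_)).symm
    rw [← hN, ← hF1]
    exact hGF 1 (one_mem _)
  · by_cases hi : n < i
    · rw [if_neg fun h => (lt_of_length_mul_s_lt hw h).not_gt hi]
      exact ddx_eq_zero_iff.2 (act_eq_of_mem_GammaXn hi (GammaX_le_GammaXn n (hG w hw)))
    have hws : length (w * s i) < length w → w * s i ∈ W n := fun h =>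
      mul_mem hw (s_mem_W (lt_of_length_mul_s_lt hw h))
    have hd := hGd w hw
    have hlen := length_le_sq hw
    refine sub_eq_zero.1 (eq_zero_of_mem_ncIdeal (n := n + 1) (M := n ^ 2) ?_ ?_ ?_)
    · refine sub_mem (ddx_mem_GammaXn (by omega) (hX w hw)) ?_
      split_ifs with h
      · exact hX _ (hws h)
      · exact zero_mem _
    · rcases hl : length w with _ | l
      · rw [hl] at hd
        simp [ddx_eq_zero_of_mem_HA_zero i hd]
      · rw [← hl]
        refine natDegree_delta_le (d := l) (sub_mem (ddx_mem_HA i (hl ▸ hd)) ?_) (by omega)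
        split_ifs with h
        · have h2 := hGd _ (hws h)
          have h3 : length (w * s i) = l := by
            rcases length_mul_s_or w i with h | h <;> omega
          rwa [h3] at h2
        · exact zero_mem _
    · rw [← hN]
      have h1 := ddx_mem_ncIdeal (i := i) (by omega) (hGF w hw)
      rw [ddx_sub, (hF w (hW hw)).2.2 i (by omega)] at h1
      split_ifs with h
      · rw [if_pos h] at h1
        have h2 := sub_mem (hGF _ (hws h)) h1
        convert h2 using 1
        ring
      · rw [if_neg h] at h1
        simpa using h1

open scoped Classical in
/-- The characterising properties of the single Schubert polynomials. -/
structure IsSingleFamily (G : Winf → GammaXY) : Prop where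
  mem_GammaX : ∀ {n w}, w ∈ W n → G w ∈ GammaX n
  ddx_eq : ∀ i w, ddx i (G w) = if length (w * s i) < length w then G (w * s i) else 0
  constTerm_eq : ∀ w, constTerm (G w) = if w = 1 then 1 else 0

/-- The families for different `n` agree by induction on the length: the difference is killed by
every `∂_i`, so it is a constant, and for `w ≠ 1` its constant term vanishes for reasons of degree.
-/
theorem exists_isSingleFamily : ∃ G, IsSingleFamily G := by
  classical
  choose G hG1 hG using exists_stable_family
  have hct : ∀ {n w}, w ∈ W n → w ≠ 1 → constTerm (G n w) = 0 := fun {n w} hw h1 =>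
    constTerm_of_mem_HA (fun h => h1 (length_eq_zero h)) (hG n w hw).2.1
  have hindep : ∀ {m n w}, w ∈ W m → w ∈ W n → G m w = G n w := by
    intro m n w hm hn
    obtain ⟨k, hk⟩ : ∃ k, length w = k := ⟨_, rfl⟩
    induction k using Nat.strong_induction_on generalizing w with
    | _ k ih =>
      by_cases h1 : w = 1
      · rw [h1, hG1, hG1]
      refine sub_eq_zero.1 ((eq_constTerm_of_ddx_eq_zero ?_ fun i => ?_).trans ?_)
      · rw [map_sub, killY_of_mem_GammaX (hG m w hm).1, killY_of_mem_GammaX (hG n w hn).1]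
      · rw [ddx_sub, (hG m w hm).2.2, (hG n w hn).2.2]
        split_ifs with h
        · rw [ih _ (hk ▸ h) (mul_mem hm (s_mem_W (lt_of_length_mul_s_lt hm h)))
            (mul_mem hn (s_mem_W (lt_of_length_mul_s_lt hn h))) rfl, sub_self]
        · exact sub_zero 0
      · rw [map_sub, hct hm h1, hct hn h1, sub_zero, Int.cast_zero]
  choose r hr using exists_mem_W
  have hGr : ∀ {n w}, w ∈ W n → G (r w) w = G n w := fun {n w} hw => hindep (hr w) hw
  refine ⟨fun w => G (r w) w, ⟨fun {n w} hw => ?_, fun i w => ?_, fun w => ?_⟩⟩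
  · rw [hGr hw]
    exact (hG n w hw).1
  · rw [(hG _ w (hr w)).2.2]
    split_ifs with h
    · rw [hGr (mul_mem (hr w) (s_mem_W (lt_of_length_mul_s_lt (hr w) h)))]
    · rfl
  · split_ifs with h
    · rw [h, hG1, map_one]
    · exact hct (hr w) h

/-! ## Divided differences in the `y_j` -/

theorem omega_c (r : Gamma) : omega (MvPolynomial.C r) = MvPolynomial.C r := algHom_C omega r

theorem omega_x (j : ℕ) : omega (x j) = -y j := by simp [omega, x]

theorem omega_y (j : ℕ) : omega (y j) = -x j := by simp [omega, y]

theorem omega_omega (f : GammaXY) : omega (omega f) = f := by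
  suffices h : omega.toRingHom.comp omega.toRingHom = RingHom.id GammaXY from
    RingHom.congr_fun h f
  refine gammaXY_hom_ext (fun p => ?_) (fun j => ?_) fun j => ?_
  · change omega (omega _) = _
    rw [omega_c, omega_c, RingHom.id_apply]
  · change omega (omega _) = _
    rw [omega_x, map_neg, omega_y, neg_neg, RingHom.id_apply]
  · change omega (omega _) = _
    rw [omega_y, map_neg, omega_x, neg_neg, RingHom.id_apply]

/-- The action of `s_i` in the variables `y_j`. -/
def actY (i : ℕ) : GammaXY →+* GammaXY := omega.toRingHom.comp ((act i).comp omega.toRingHom)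

theorem actY_apply (i : ℕ) (f : GammaXY) : actY i f = omega (act i (omega f)) := rfl

/-- The denominators of the divided differences in the variables `y_j`. -/
def denY (i : ℕ) : GammaXY := omega (den i)

theorem denY_zero : denY 0 = 2 * y 0 := by simp [denY, den, omega_x, map_ofNat]

theorem denY_succ (k : ℕ) : denY (k + 1) = y (k + 1) - y k := by
  simp [denY, den, omega_x]
  ring

theorem denY_mul_ddy (i : ℕ) (f : GammaXY) : denY i * ddy i f = f - actY i f := by
  rw [denY, ddy, ← map_mul, den_mul_ddx, map_sub, omega_omega, actY_apply]

theorem denY_mul_cancel {i : ℕ} {f g : GammaXY} (h : denY i * f = denY i * g) : f = g := by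
  have h' := congrArg omega h
  rw [denY, map_mul, map_mul, omega_omega] at h'
  rw [← omega_omega f, den_mul_cancel h', omega_omega]

theorem actY_denY (i : ℕ) : actY i (denY i) = -denY i := by
  rw [actY_apply, denY, omega_omega, act_den, map_neg]

theorem actY_x (i j : ℕ) : actY i (x j) = x j := by
  rw [actY_apply, omega_x, map_neg, act_y, ← omega_x, omega_omega]

theorem actY_y_zero (j : ℕ) : actY 0 (y j) = if j = 0 then -y 0 else y j := by
  rw [actY_apply, omega_y, map_neg, act_x_zero]
  split_ifs with h
  · rw [neg_neg, omega_x]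
  · rw [map_neg, omega_x, neg_neg]

theorem actY_y_succ (k j : ℕ) : actY (k + 1) (y j) = y (Equiv.swap k (k + 1) j) := by
  rw [actY_apply, omega_y, map_neg, act_x_succ, map_neg, omega_x, neg_neg]

theorem actY_c_succ (k p : ℕ) : actY (k + 1) (MvPolynomial.C (c p)) = MvPolynomial.C (c p) := by
  rw [actY_apply, omega_c, act_c_succ, omega_c]

theorem map_omega_cSer : PowerSeries.map omega.toRingHom cSer = cSer := by
  ext p : 1
  simp only [PowerSeries.coeff_map, cSer, PowerSeries.coeff_mk]
  exact omega_c _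

theorem lin_mul_map_actY_cSer :
    lin (y 0) * PowerSeries.map (actY 0) cSer = lin (-y 0) * cSer := by
  have h := congrArg (PowerSeries.map omega.toRingHom) lin_mul_map_act_cSer
  have h1 : omega.toRingHom (x 0) = -y 0 := omega_x 0
  rw [map_mul, map_mul, map_lin, map_lin, map_neg, h1, neg_neg, map_omega_cSer] at h
  rw [← h]
  congr 1
  ext p
  simp only [PowerSeries.coeff_map, cSer, PowerSeries.coeff_mk]
  rw [actY_apply, omega_c]
  rfl

theorem hom_c_eq_of_map_cSer {φ ψ : GammaXY →+* GammaXY}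
    (h : PowerSeries.map φ cSer = PowerSeries.map ψ cSer) (p : ℕ) :
    φ (MvPolynomial.C (c p)) = ψ (MvPolynomial.C (c p)) := by
  simpa [cSer] using congrArg (PowerSeries.coeff p) h

theorem map_comp_apply (φ ψ : GammaXY →+* GammaXY) (f : PowerSeries GammaXY) :
    PowerSeries.map (φ.comp ψ) f = PowerSeries.map φ (PowerSeries.map ψ f) := by
  ext p
  simp

theorem actY_of_mem_ZX (i : ℕ) {f : GammaXY} (hf : f ∈ ZX) : actY i f = f :=
  eq_of_mem_ZX (φ := actY i) (ψ := RingHom.id _) (actY_x i) hf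

theorem act_of_mem_ZY (i : ℕ) {f : GammaXY} (hf : f ∈ ZY) : act i f = f := by
  refine RingHom.eqOn_set_closure (s := Set.range y) (f := act i) (g := RingHom.id _) ?_ hf
  rintro _ ⟨j, rfl⟩
  exact act_y i j

theorem actY_y_mem_ZY (i j : ℕ) : actY i (y j) ∈ ZY := by
  cases i with
  | zero =>
    rw [actY_y_zero]
    split_ifs
    · exact neg_mem (y_mem_ZY 0)
    · exact y_mem_ZY j
  | succ k => rw [actY_y_succ]; exact y_mem_ZY _

theorem denY_mem_ZY (i : ℕ) : denY i ∈ ZY := by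
  cases i with
  | zero =>
    rw [denY_zero, two_mul]
    exact add_mem (y_mem_ZY 0) (y_mem_ZY 0)
  | succ k => rw [denY_succ]; exact sub_mem (y_mem_ZY _) (y_mem_ZY _)

theorem den_mem_ZX (i : ℕ) : den i ∈ ZX := by
  cases i with
  | zero =>
    rw [den, neg_mul, two_mul]
    exact neg_mem (add_mem (x_mem_ZX 0) (x_mem_ZX 0))
  | succ k => exact sub_mem (x_mem_ZX _) (x_mem_ZX _)

/-- The two actions permute and negate separate sets of variables. On `c(t)` the reflections with
index `0` multiply by rational functions in `x_1` and in `y_1`, and neither action touches the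
factor of the other. -/
theorem act_actY_comm (i j : ℕ) (f : GammaXY) : act j (actY i f) = actY i (act j f) := by
  suffices h : (act j).comp (actY i) = (actY i).comp (act j) from RingHom.congr_fun h f
  refine gammaXY_hom_ext (fun p => ?_) (fun k => ?_) fun k => ?_
  · cases i with
    | zero =>
      cases j with
      | zero =>
        apply hom_c_eq_of_map_cSer
        rw [map_comp_apply, map_comp_apply]
        have h1 := congrArg (PowerSeries.map (act 0)) lin_mul_map_actY_cSer
        have h2 := congrArg (PowerSeries.map (actY 0)) lin_mul_map_act_cSer
        simp only [map_mul, map_lin, map_neg, act_y, actY_x] at h1 h2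
        apply (lin_isUnit (y 0)).mul_left_cancel
        apply (lin_isUnit (-x 0)).mul_left_cancel
        linear_combination lin (-x 0) * h1 - lin (y 0) * h2 + lin (-y 0) * lin_mul_map_act_cSer
          - lin (x 0) * lin_mul_map_actY_cSer
      | succ j =>
        apply hom_c_eq_of_map_cSer
        rw [map_comp_apply, map_comp_apply]
        have h0 : PowerSeries.map (act (j + 1)) cSer = cSer := by
          ext p
          simp [cSer, act_c_succ]
        have h1 := congrArg (PowerSeries.map (act (j + 1))) lin_mul_map_actY_cSer
        simp only [map_mul, map_lin, map_neg, act_y, h0] at h1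
        apply (lin_isUnit (y 0)).mul_left_cancel
        rw [h1, h0, lin_mul_map_actY_cSer]
    | succ i =>
      cases j with
      | zero =>
        apply hom_c_eq_of_map_cSer
        rw [map_comp_apply, map_comp_apply]
        have h0 : PowerSeries.map (actY (i + 1)) cSer = cSer := by
          ext p
          simp [cSer, actY_c_succ]
        have h1 := congrArg (PowerSeries.map (actY (i + 1))) lin_mul_map_act_cSer
        simp only [map_mul, map_lin, map_neg, actY_x, h0] at h1
        apply (lin_isUnit (-x 0)).mul_left_cancel
        rw [h1, h0, lin_mul_map_act_cSer]
      | succ j =>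
        rw [RingHom.comp_apply, RingHom.comp_apply, actY_c_succ, act_c_succ, actY_c_succ]
  · rw [RingHom.comp_apply, RingHom.comp_apply, actY_x,
      actY_of_mem_ZX i (act_mem_ZX j (x_mem_ZX k))]
  · rw [RingHom.comp_apply, RingHom.comp_apply, act_y, act_of_mem_ZY j (actY_y_mem_ZY i k)]

theorem ddx_ddy_comm (i j : ℕ) (f : GammaXY) : ddx j (ddy i f) = ddy i (ddx j f) := by
  apply den_mul_cancel (i := j)
  apply denY_mul_cancel (i := i)
  have e1 := congrArg (act j) (denY_mul_ddy i f)
  have e2 := congrArg (actY i) (den_mul_ddx j f)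
  rw [map_mul, map_sub, act_of_mem_ZY j (denY_mem_ZY i)] at e1
  rw [map_mul, map_sub, actY_of_mem_ZX i (den_mem_ZX j)] at e2
  linear_combination denY i * den_mul_ddx j (ddy i f) - den j * denY_mul_ddy i (ddx j f) - e1 + e2
    + denY_mul_ddy i f - den_mul_ddx j f + act_actY_comm i j f

theorem ddy_zero (i : ℕ) : ddy i 0 = 0 := by rw [ddy, map_zero, ddx_zero, map_zero]

/-! ## The substitution `c_p ↦ 0`, `x_j ↦ y_j` -/

/-- The homomorphism with `c_p ↦ 0` for `p ≥ 1`, `x_j ↦ y_j` and `y_j ↦ y_j`. -/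
def evalY : GammaXY →+* GammaXY :=
  evalHom (fun p => if p = 0 then 1 else 0) (by simp) (fun p hp => by
    have h : p ≠ 0 := by omega
    simp [qRel, h]) y y

theorem evalY_c (p : ℕ) : evalY (MvPolynomial.C (c p)) = if p = 0 then 1 else 0 :=
  evalHom_c _ _ _ _ _ p

theorem evalY_x (j : ℕ) : evalY (x j) = y j := evalHom_x _ _ _ _ _ j

theorem evalY_y (j : ℕ) : evalY (y j) = y j := evalHom_y _ _ _ _ _ j

theorem evalY_mem_ZY (f : GammaXY) : evalY f ∈ ZY := by
  induction f using gammaXY_induction with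
  | hint n => rw [map_intCast]; exact intCast_mem _ n
  | hadd f g hf hg => rw [map_add]; exact add_mem hf hg
  | hmul f g hf hg => rw [map_mul]; exact mul_mem hf hg
  | hc p =>
    rw [evalY_c]
    split_ifs
    · exact one_mem _
    · exact zero_mem _
  | hx j => rw [evalY_x]; exact y_mem_ZY j
  | hy j => rw [evalY_y]; exact y_mem_ZY j

theorem evalY_of_mem_ZY {f : GammaXY} (hf : f ∈ ZY) : evalY f = f := by
  refine RingHom.eqOn_set_closure (s := Set.range y) (f := evalY) (g := RingHom.id _) ?_ hf
  rintro _ ⟨j, rfl⟩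
  exact evalY_y j

theorem constTerm_evalY (f : GammaXY) : constTerm (evalY f) = constTerm f := by
  suffices h : constTerm.comp evalY = constTerm from RingHom.congr_fun h f
  refine gammaXY_hom_ext (fun p => ?_) (fun j => ?_) fun j => ?_
  · rw [RingHom.comp_apply, evalY_c, constTerm_c, apply_ite constTerm, map_one, map_zero]
  · rw [RingHom.comp_apply, evalY_x, constTerm_x, constTerm_y]
  · rw [RingHom.comp_apply, evalY_y]

theorem map_evalY_cSer : PowerSeries.map evalY cSer = 1 := by
  ext p
  simp only [PowerSeries.coeff_map, cSer, PowerSeries.coeff_mk, evalY_c, PowerSeries.coeff_one]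

theorem evalY_den (i : ℕ) : evalY (den i) = -denY i := by
  cases i with
  | zero => rw [denY_zero, den, map_mul, map_neg, map_ofNat, evalY_x, neg_mul]
  | succ k => rw [denY_succ, den, map_sub, evalY_x, evalY_x, neg_sub]

/-- When `x` is identified with `y`, the factors `(1 + x_1 t) / (1 - x_1 t)` and `(1 - y_1 t) / (1 +
y_1 t)` of the two actions of `s_0` cancel, which is consistent with `c(t) ↦ 1`. -/
theorem evalY_actY_act (i : ℕ) (f : GammaXY) : evalY (actY i (act i f)) = actY i (evalY f) := by
  suffices h : evalY.comp ((actY i).comp (act i)) = (actY i).comp evalY from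
    RingHom.congr_fun h f
  refine gammaXY_hom_ext (fun p => ?_) (fun j => ?_) fun j => ?_
  · cases i with
    | zero =>
      apply hom_c_eq_of_map_cSer
      rw [map_comp_apply, map_comp_apply, map_comp_apply, map_evalY_cSer, map_one]
      have h1 := congrArg (PowerSeries.map evalY) lin_mul_map_actY_cSer
      have h2 := congrArg (fun f => PowerSeries.map evalY (PowerSeries.map (actY 0) f))
        lin_mul_map_act_cSer
      simp only [map_mul, map_lin, map_neg, evalY_y, evalY_x, actY_x, map_evalY_cSer] at h1 h2
      apply (lin_isUnit (-y 0)).mul_left_cancel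
      rw [h2, h1]
    | succ i =>
      rw [RingHom.comp_apply, RingHom.comp_apply, RingHom.comp_apply, act_c_succ, actY_c_succ,
        evalY_c, apply_ite (actY (i + 1)), map_one, map_zero]
  · simp only [RingHom.comp_apply, evalY_x]
    rw [actY_of_mem_ZX i (act_mem_ZX i (x_mem_ZX j))]
    cases i with
    | zero =>
      rw [act_x_zero, actY_y_zero, apply_ite evalY, map_neg, evalY_x, evalY_x]
    | succ k => rw [act_x_succ, actY_y_succ, evalY_x]
  · simp only [RingHom.comp_apply, evalY_y, act_y]
    exact evalY_of_mem_ZY (actY_y_mem_ZY i j)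

/-- The specialisation turns `den i` into `-denY i` and the simultaneous action into the action on
`y`. Integers are fixed by that action, which relates the specialised values of `∂_i f` and `∂_i^y
f`. -/
theorem evalY_ddy {i : ℕ} {f : GammaXY} {a b : ℤ} (ha : evalY f = a) (hb : evalY (ddx i f) = b) :
    evalY (ddy i f) = b := by
  apply denY_mul_cancel (i := i)
  have h1 := congrArg evalY (denY_mul_ddy i f)
  have h2 := congrArg evalY (den_mul_ddx i f)
  rw [map_mul, map_sub, evalY_of_mem_ZY (denY_mem_ZY i)] at h1
  rw [map_mul, map_sub, evalY_den, hb, ha] at h2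
  have h3 := evalY_actY_act i (act i f)
  rw [act_act, show evalY (act i f) = a + denY i * b by linear_combination h2, map_add, map_mul,
    map_intCast, map_intCast, actY_denY] at h3
  rw [h1, h3, ha]
  ring

/-! ## Reduced factorisations -/

theorem finite_W_length_le (n k : ℕ) : {w | w ∈ W n ∧ length w ≤ k}.Finite := by
  induction k with
  | zero =>
    refine (Set.finite_singleton 1).subset ?_
    rintro w ⟨-, hw⟩
    exact length_eq_zero (Nat.le_zero.1 hw)
  | succ k ih =>
    refine (ih.union (Set.Finite.image2 (fun w i => w * s i) ih (Set.finite_Iio n))).subset ?_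
    rintro w ⟨hw, hl⟩
    by_cases h1 : w = 1
    · exact Or.inl ⟨hw, by rw [h1, length_one]; exact Nat.zero_le k⟩
    · obtain ⟨i, hi⟩ := exists_descent h1
      have hin := lt_of_descent hw hi
      have := length_mul_s' hi
      exact Or.inr ⟨w * s i, ⟨mul_mem hw (s_mem_W hin), by omega⟩, i, hin, mul_s_mul_s w i⟩

theorem mem_W_of_length_add {n : ℕ} {u w : Winf} (hw : w ∈ W n)
    (h : length u + length (u⁻¹ * w) = length w) : u ∈ W n := by
  obtain ⟨a, ha⟩ := exists_reducedWord u
  obtain ⟨b, hb⟩ := exists_reducedWord (u⁻¹ * w)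
  have hab : IsReducedWord (a ++ b) w := by
    constructor
    · rw [List.map_append, List.prod_append, ha.1, hb.1, mul_inv_cancel_left]
    · rw [List.length_append, ha.2, hb.2, h]
  rw [← ha.1]
  exact prod_map_s_mem_W fun i hi => hab.lt hw i (List.mem_append_left b hi)

theorem finite_leftFactors (w : Winf) :
    {u | length u + length (u⁻¹ * w) = length w}.Finite := by
  obtain ⟨n, hn⟩ := exists_mem_W w
  refine (finite_W_length_le n (length w)).subset fun u hu => ⟨mem_W_of_length_add hn hu, ?_⟩
  have : length u + length (u⁻¹ * w) = length w := hu
  omega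

/-- The left factors of the reduced factorisations of `w`. -/
def leftFactors (w : Winf) : Finset Winf := (finite_leftFactors w).toFinset

theorem mem_leftFactors {u w : Winf} :
    u ∈ leftFactors w ↔ length u + length (u⁻¹ * w) = length w := by
  simp [leftFactors]

theorem one_mem_leftFactors (w : Winf) : 1 ∈ leftFactors w := by
  rw [mem_leftFactors, length_one, inv_one, one_mul, zero_add]

theorem length_lt_of_mem_leftFactors {u w : Winf} (hu : u ∈ leftFactors w) (h1 : u ≠ 1) :
    length (u⁻¹ * w) < length w := by
  rw [mem_leftFactors] at hu
  have : length u ≠ 0 := fun h => h1 (length_eq_zero h)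
  omega

theorem length_mul_s_lt_of_mem_leftFactors {u w : Winf} {i : ℕ} (hu : u ∈ leftFactors w)
    (h : length (u⁻¹ * w * s i) < length (u⁻¹ * w)) : length (w * s i) < length w := by
  rw [mem_leftFactors] at hu
  have := length_mul_le u (u⁻¹ * w * s i)
  rw [mul_assoc, mul_inv_cancel_left] at this
  rw [mul_assoc] at h
  omega

/-- Reduced factorisations of `w s_i` are those of `w` whose right factor has a descent at `i`, with
that descent removed. This matches the terms surviving under `∂_i` in `doubleOf`. -/
theorem mem_leftFactors_mul_s {u w : Winf} {i : ℕ} (hi : length (w * s i) < length w) :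
    u ∈ leftFactors (w * s i) ↔
      u ∈ leftFactors w ∧ length (u⁻¹ * w * s i) < length (u⁻¹ * w) := by
  rw [mem_leftFactors, mem_leftFactors, ← mul_assoc]
  have h1 := length_mul_s_or w i
  have h2 := length_mul_s_or (u⁻¹ * w) i
  have h3 := length_mul_le u (u⁻¹ * w)
  rw [mul_inv_cancel_left] at h3
  omega

/-! ## Double Schubert polynomials -/

open scoped Classical in
/-- The solution of `G w = ∑ evalY (G u) * F v`, where the sum is over the reduced
factorisations `w = u * v`. -/
def doubleOf (G : Winf → GammaXY) (w : Winf) : GammaXY :=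
  G w - ∑ u ∈ ((leftFactors w).erase 1).attach, evalY (G u.1) * doubleOf G (u.1⁻¹ * w)
termination_by length w
decreasing_by
  have := u.2
  rw [Finset.mem_erase] at this
  exact length_lt_of_mem_leftFactors this.2 this.1

section Double

variable {G : Winf → GammaXY}

open scoped Classical in
theorem doubleOf_eq (G : Winf → GammaXY) (w : Winf) : doubleOf G w =
    G w - ∑ u ∈ (leftFactors w).erase 1, evalY (G u) * doubleOf G (u⁻¹ * w) := by
  rw [doubleOf, Finset.sum_attach ((leftFactors w).erase 1)
    (fun u => evalY (G u) * doubleOf G (u⁻¹ * w))]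

theorem IsSingleFamily.one (hG : IsSingleFamily G) : G 1 = 1 := by
  have h := eq_constTerm_of_ddx_eq_zero (f := G 1)
    (killY_of_mem_GammaX (hG.mem_GammaX (one_mem (W 0)))) fun i => by
      rw [hG.ddx_eq, length_one, if_neg (Nat.not_lt_zero _)]
  rw [h, hG.constTerm_eq, if_pos rfl, Int.cast_one]

theorem IsSingleFamily.eq_sum (hG : IsSingleFamily G) (w : Winf) :
    G w = ∑ u ∈ leftFactors w, evalY (G u) * doubleOf G (u⁻¹ * w) := by
  classical
  rw [← Finset.add_sum_erase _ _ (one_mem_leftFactors w), hG.one, map_one, one_mul, inv_one,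
    one_mul, doubleOf_eq G w, sub_add_cancel]

-- Specialise the defining sum. By induction the proper right factors `v ≠ 1` contribute zero, so
-- the term with `v = 1`, namely `evalY (G w)`, cancels the specialised left side.
open scoped Classical in
theorem IsSingleFamily.evalY_doubleOf (hG : IsSingleFamily G) (w : Winf) :
    evalY (doubleOf G w) = ((if w = 1 then 1 else 0 : ℤ) : GammaXY) := by
  obtain ⟨k, hk⟩ : ∃ k, length w = k := ⟨_, rfl⟩
  induction k using Nat.strong_induction_on generalizing w with
  | _ k ih =>
    by_cases h1 : w = 1
    · subst h1
      have h := congrArg evalY (doubleOf_eq G 1)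
      rw [h, Finset.sum_eq_zero, hG.one, sub_zero, map_one, if_pos rfl, Int.cast_one]
      intro u hu
      rw [Finset.mem_erase] at hu
      have := length_lt_of_mem_leftFactors hu.2 hu.1
      rw [length_one] at this
      omega
    · rw [doubleOf_eq, map_sub, map_sum, if_neg h1, Int.cast_zero, sub_eq_zero]
      have hw : w ∈ (leftFactors w).erase 1 := by
        rw [Finset.mem_erase, mem_leftFactors, inv_mul_cancel, length_one]
        exact ⟨h1, rfl⟩
      rw [Finset.sum_eq_single_of_mem w hw]
      · rw [map_mul, inv_mul_cancel, ih _ ?_ 1 rfl, if_pos rfl, Int.cast_one, mul_one,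
          evalY_of_mem_ZY (evalY_mem_ZY _)]
        rw [length_one, ← hk]
        exact Nat.pos_of_ne_zero fun h => h1 (length_eq_zero h)
      · intro u hu huw
        rw [Finset.mem_erase] at hu
        rw [map_mul, ih _ (hk ▸ length_lt_of_mem_leftFactors hu.2 hu.1) _ rfl, if_neg,
          Int.cast_zero, mul_zero]
        exact fun h => huw (inv_mul_eq_one.1 h)

-- The coefficients `evalY (G u)` lie in `ℤ[Y]` and are constants for `∂_i`, so the recursion for
-- `G` passes to the solution of the triangular system.
open scoped Classical in
theorem IsSingleFamily.ddx_doubleOf (hG : IsSingleFamily G) (i : ℕ) (w : Winf) :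
    ddx i (doubleOf G w) = if length (w * s i) < length w then doubleOf G (w * s i) else 0 := by
  obtain ⟨k, hk⟩ : ∃ k, length w = k := ⟨_, rfl⟩
  induction k using Nat.strong_induction_on generalizing w with
  | _ k ih =>
    have h1 : ddx i (doubleOf G w) = ddx i (G w) - ∑ u ∈ (leftFactors w).erase 1,
        evalY (G u) * if length (u⁻¹ * w * s i) < length (u⁻¹ * w) then
          doubleOf G (u⁻¹ * w * s i) else 0 := by
      rw [doubleOf_eq, ddx_sub, ddx_sum]
      congr 1
      refine Finset.sum_congr rfl fun u hu => ?_
      rw [Finset.mem_erase] at hu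
      rw [ddx_mul_of_act_eq (act_of_mem_ZY i (evalY_mem_ZY _)),
        ih _ (hk ▸ length_lt_of_mem_leftFactors hu.2 hu.1) _ rfl]
    have h2 : ddx i (G w) = ∑ u ∈ leftFactors w,
        evalY (G u) * if length (u⁻¹ * w * s i) < length (u⁻¹ * w) then
          doubleOf G (u⁻¹ * w * s i) else 0 := by
      rw [hG.ddx_eq]
      split_ifs with h
      · rw [hG.eq_sum (w * s i)]
        simp only [mul_ite, mul_zero]
        rw [← Finset.sum_filter]
        refine Finset.sum_congr ?_ fun u _ => by rw [mul_assoc]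
        ext u
        rw [Finset.mem_filter, mem_leftFactors_mul_s h]
      · refine (Finset.sum_eq_zero fun u hu => ?_).symm
        rw [if_neg fun h' => h (length_mul_s_lt_of_mem_leftFactors hu h'), mul_zero]
    rw [h1, h2, ← Finset.add_sum_erase _ _ (one_mem_leftFactors w), hG.one, map_one, one_mul,
      inv_one, one_mul, add_sub_cancel_right]

-- Let `h` be the difference of the two sides. Since `∂_j` commutes with `∂_i^y`, the known
-- recursion in `x` and induction on the length give `∂_j h = 0` for all `j`, so `h ∈ ℤ[Y]`. There
-- `evalY` is the identity, and `evalY h = 0` because all specialised values are Kronecker deltas.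
open scoped Classical in
theorem IsSingleFamily.ddy_doubleOf (hG : IsSingleFamily G) (i : ℕ) (w : Winf) :
    ddy i (doubleOf G w) = if length (s i * w) < length w then doubleOf G (s i * w) else 0 := by
  obtain ⟨k, hk⟩ : ∃ k, length w = k := ⟨_, rfl⟩
  induction k using Nat.strong_induction_on generalizing w with
  | _ k ih =>
    set h := ddy i (doubleOf G w) -
      if length (s i * w) < length w then doubleOf G (s i * w) else 0 with hh
    have hd : ∀ j, ddx j h = 0 := by
      intro j
      have l1 := length_mul_s_or w j
      have l2 := length_s_mul_or w i
      have l3 := length_s_mul_or (w * s j) i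
      have l4 := length_mul_s_or (s i * w) j
      rw [← mul_assoc] at l3
      rw [hh, ddx_sub, ddx_ddy_comm, hG.ddx_doubleOf, apply_ite (ddx j), ddx_zero,
        hG.ddx_doubleOf]
      by_cases hj : length (w * s j) < length w
      · rw [if_pos hj, ih _ (hk ▸ hj) _ rfl, ← mul_assoc]
        split_ifs <;> first | exact sub_self _ | omega
      · rw [if_neg hj, ddy_zero]
        split_ifs <;> first | exact sub_self _ | omega
    have he : evalY h = 0 := by
      have e1 : evalY (ddx i (doubleOf G w)) = ((if w = s i then 1 else 0 : ℤ) : GammaXY) := by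
        rw [hG.ddx_doubleOf, apply_ite evalY, map_zero, hG.evalY_doubleOf]
        by_cases hw : w = s i
        · rw [if_pos hw, hw, s_mul_s, if_pos rfl, if_pos]
          have := length_mul_s_or (s i) i
          rw [s_mul_s, length_one] at this
          rw [length_one]
          omega
        · have : w * s i ≠ 1 := fun h => hw (by rw [eq_inv_of_mul_eq_one_left h, s_inv])
          rw [if_neg hw, if_neg this, Int.cast_zero, ite_self]
      rw [hh, map_sub, evalY_ddy (hG.evalY_doubleOf w) e1, apply_ite evalY, map_zero,
        hG.evalY_doubleOf, sub_eq_zero]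
      by_cases hw : w = s i
      · rw [if_pos hw, hw, s_mul_s, if_pos rfl, if_pos]
        have := length_mul_s_or (s i) i
        rw [s_mul_s, length_one] at this
        rw [length_one]
        omega
      · have : s i * w ≠ 1 := fun h => hw (by rw [eq_inv_of_mul_eq_one_right h, s_inv])
        rw [if_neg hw, if_neg this, Int.cast_zero, ite_self]
    rw [evalY_of_mem_ZY (mem_ZY_of_ddx_eq_zero hd)] at he
    exact sub_eq_zero.1 he

theorem IsSingleFamily.isDoubleSchubertFamily (hG : IsSingleFamily G) :
    IsDoubleSchubertFamily (doubleOf G) where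
  ddx_eq := hG.ddx_doubleOf
  ddy_eq := hG.ddy_doubleOf
  constTerm_eq w := by
    rw [← constTerm_evalY, hG.evalY_doubleOf, map_intCast, Int.cast_id]

end Double

/-- Existence of one such family is what gives the `Classical.epsilon` choice its properties. -/
theorem isDoubleSchubertFamily_doubleSchubert : IsDoubleSchubertFamily doubleSchubert := by
  obtain ⟨G, hG⟩ := exists_isSingleFamily
  exact Classical.epsilon_spec (p := IsDoubleSchubertFamily) ⟨_, hG.isDoubleSchubertFamily⟩

/-! ## The scalar product -/

theorem isSingleFamily_schubert : IsSingleFamily schubert where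
  mem_GammaX {n w} hw := killY_mem_GammaX (mem_GammaXn_of_forall fun i hi => ddx_eq_zero_iff.1 (by
    rw [isDoubleSchubertFamily_doubleSchubert.ddx_eq,
      if_neg fun h => (lt_of_length_mul_s_lt hw h).not_gt hi]))
  ddx_eq i w := by
    change ddx i (killY _) = _
    rw [← killY_ddx, isDoubleSchubertFamily_doubleSchubert.ddx_eq, apply_ite killY, map_zero]
    rfl
  constTerm_eq w :=
    (constTerm_killY _).trans (isDoubleSchubertFamily_doubleSchubert.constTerm_eq w)

/-- The proportionality of words of length `n²` is applied with `S = Γ^{(n)}`, whose elements are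
invariant under `s_0, …, s_{n-1}` and over which the `x_j` generate `Γ[X_n]`. -/
theorem exists_scalarProduct_eq {n : ℕ} {f : GammaXY} (hf : f ∈ GammaX n) :
    ∃ g ∈ Theta n, ∀ a, IsReducedWord a (w0 n) → a.foldr ddx f = g * a.foldr ddx (xRho n) := by
  have hnc : ∀ p, nc n p ∈ (Theta n).toSubring := by
    intro p
    rcases Nat.eq_zero_or_pos p with rfl | hp
    · rw [nc_zero]
      exact one_mem _
    · exact Algebra.subset_adjoin ⟨p, hp, rfl⟩
  have hinv : ∀ g ∈ (Theta n).toSubring, ∀ i < n, act i g = g := by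
    intro g hg i hi
    replace hg : g ∈ Theta n := hg
    induction hg using Algebra.adjoin_induction with
    | mem g hg =>
      obtain ⟨p, -, rfl⟩ := hg
      exact act_nc hi p
    | algebraMap r => exact map_intCast (act i) r
    | add f g _ _ hf hg => rw [map_add, hf, hg]
    | mul f g _ _ hf hg => rw [map_mul, hf, hg]
  have hext : f ∈ extX (Theta n).toSubring n := by
    induction hf using Algebra.adjoin_induction with
    | mem f hf =>
      obtain ⟨j, hj, rfl⟩ := hf
      exact x_mem_extX _ hj
    | algebraMap r => exact C_mem_extX hnc r
    | add f g _ _ hf hg => exact add_mem hf hg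
    | mul f g _ _ hf hg => exact mul_mem hf hg
  obtain ⟨g, hg, h⟩ := exists_foldr_ddx_eq_mul hnc hinv hext
  exact ⟨g, hg, fun a ha => h a (ha.2.trans (length_w0 n)) (ha.lt (w0_mem_W n))⟩

theorem foldr_ddx_mem_Theta {n : ℕ} {a : List ℕ} (ha : IsReducedWord a (w0 n)) {f : GammaXY}
    (hf : f ∈ GammaX n) : a.foldr ddx f ∈ Theta n := by
  obtain ⟨g, hg, h⟩ := exists_scalarProduct_eq hf
  obtain ⟨m, hm⟩ := mem_HX_zero (foldr_ddx_mem_HX a (d := 0) (f := xRho n) (by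
    rw [ha.2, length_w0, zero_add]
    exact xRho_mem_HX n))
  rw [h a ha, hm]
  exact mul_mem hg (intCast_mem _ m)

/-- Words of the same length `n²` share the factor `g`, so independence of the reduced word on
`Γ[X_n]` follows from independence on the single integral polynomial `xRho n`. -/
theorem foldr_ddx_w0_eq {n : ℕ} {a b : List ℕ} (ha : IsReducedWord a (w0 n))
    (hb : IsReducedWord b (w0 n)) {f : GammaXY} (hf : f ∈ GammaX n) :
    a.foldr ddx f = b.foldr ddx f := by
  obtain ⟨g, -, h⟩ := exists_scalarProduct_eq hf
  rw [h a ha, h b hb, foldr_ddx_eq ha hb (HX_le_ZX (xRho_mem_HX n))]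

theorem scalarProduct_eq {n : ℕ} {a : List ℕ} (ha : IsReducedWord a (w0 n)) {f g : GammaXY}
    (hf : f ∈ GammaX n) (hg : g ∈ GammaX n) : scalarProduct n f g = a.foldr ddx (f * g) :=
  foldr_ddx_w0_eq (Classical.epsilon_spec (exists_reducedWord (w0 n))) ha (mul_mem hf hg)

theorem scalarProduct_mem_Theta {n : ℕ} {f g : GammaXY} (hf : f ∈ GammaX n) (hg : g ∈ GammaX n) :
    scalarProduct n f g ∈ Theta n :=
  foldr_ddx_mem_Theta (Classical.epsilon_spec (exists_reducedWord (w0 n))) (mul_mem hf hg)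

/-! ### Adjointness and duality -/

theorem ddx_mem_GammaX {n i : ℕ} (hi : i < n) {f : GammaXY} (hf : f ∈ GammaX n) :
    ddx i f ∈ GammaX n := by
  rw [← killY_of_mem_GammaX hf, ← killY_ddx]
  exact killY_mem_GammaX (ddx_mem_GammaXn hi (GammaX_le_GammaXn n hf))

/-- The divided differences are self-adjoint. -/
theorem scalarProduct_ddx {n i : ℕ} (hi : i < n) {f g : GammaXY} (hf : f ∈ GammaX n)
    (hg : g ∈ GammaX n) : scalarProduct n f (ddx i g) = scalarProduct n (ddx i f) g := by
  -- The longest element has a descent at every `i < n`, so it has a reduced word whose last letter,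
  -- applied first, is `i`.
  obtain ⟨b, hb⟩ := exists_reducedWord (w0 n * s i)
  have hd : (w0 n).1 (i + 1) < (w0 n).1 i := by
    rw [w0_apply, w0_apply, if_pos (abs_le.2 ⟨by omega, by omega⟩),
      if_pos (abs_le.2 ⟨by omega, by omega⟩)]
    omega
  have h := hb.snoc (mul_s_lt_iff.2 hd)
  rw [mul_s_mul_s] at h
  rw [scalarProduct_eq h hf (ddx_mem_GammaX hi hg), scalarProduct_eq h (ddx_mem_GammaX hi hf) hg,
    List.foldr_append, List.foldr_append]
  simp only [List.foldr_cons, List.foldr_nil]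
  -- After the first letter `∂_i`, both sides equal `∂_i f * ∂_i g`.
  rw [ddx_mul, ddx_mul, ddx_ddx, ddx_ddx, act_ddx, mul_zero, zero_mul, add_zero, zero_add]

theorem IsSingleFamily.foldr_ddx {G : Winf → GammaXY} (hG : IsSingleFamily G) {a : List ℕ}
    {w : Winf} (ha : IsReducedWord a w) : a.foldr ddx (G w) = 1 := by
  induction a using List.reverseRecOn generalizing w with
  | nil => rw [List.foldr_nil, ← ha.1, List.map_nil, List.prod_nil, hG.one]
  | append_singleton a i ih =>
    obtain ⟨h1, h2⟩ := ha.of_snoc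
    rw [List.foldr_append, List.foldr_cons, List.foldr_nil, hG.ddx_eq,
      if_pos (length_mul_s_lt_iff.2 h2), ih h1]

-- Induction on the length of `u`. As long as `u ≠ 1`, `v` has an ascent `i < n`, and
-- self-adjointness moves `∂_i` from `G (v s_i)` to `G u`. If `u` also has an ascent at `i` the
-- result is zero, and `v = w0 n * u` is excluded because left multiplication by `w0 n` exchanges
-- ascents and descents.
open scoped Classical in
theorem IsSingleFamily.scalarProduct {G : Winf → GammaXY} (hG : IsSingleFamily G) {n : ℕ}
    {u v : Winf} (hu : u ∈ W n) (hv : v ∈ W n) (h : length u + length v = n ^ 2) :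
    scalarProduct n (G u) (G v) = if v = w0 n * u then 1 else 0 := by
  obtain ⟨k, hk⟩ : ∃ k, length u = k := ⟨_, rfl⟩
  induction k generalizing u v with
  | zero =>
    obtain rfl := length_eq_zero hk
    obtain rfl := eq_w0_of_length hv (by omega)
    obtain ⟨a, ha⟩ := exists_reducedWord (w0 n)
    rw [mul_one, if_pos rfl, scalarProduct_eq ha (hG.mem_GammaX hu) (hG.mem_GammaX hv), hG.one,
      one_mul, hG.foldr_ddx ha]
  | succ k ih =>
    obtain ⟨i, hi, hvi⟩ := exists_ascent hv (by
      rintro rfl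
      rw [length_w0] at h
      omega)
    have h1 := length_mul_s hvi
    have hv' := mul_mem hv (s_mem_W hi)
    have h2 : G v = ddx i (G (v * s i)) := by
      rw [hG.ddx_eq, mul_s_mul_s, if_pos (by omega)]
    rw [h2, scalarProduct_ddx hi (hG.mem_GammaX hu) (hG.mem_GammaX hv'), hG.ddx_eq]
    rcases length_mul_s_or u i with h3 | h3
    · rw [if_neg (by omega), if_neg]
      · rw [SchubertC.scalarProduct, zero_mul]
        exact foldr_ddx_zero _
      · rintro rfl
        have := length_mul_s_lt_iff.2 ((w0_mul_apply_lt_iff hu hi).1 hvi)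
        omega
    · rw [if_pos (by omega), ih (mul_mem hu (s_mem_W hi)) hv' (by omega) (by omega)]
      simp only [← mul_assoc, mul_left_inj]

end SchubertC

end

open scoped Classical in
theorem mainTheorem12 (n : ℕ) :
    (∀ f ∈ SchubertC.GammaX n, ∀ g ∈ SchubertC.GammaX n,
      SchubertC.scalarProduct n f g ∈ SchubertC.Theta n) ∧
    (∀ w ∈ SchubertC.W n, SchubertC.schubert w ∈ SchubertC.GammaX n) ∧
    (∀ u ∈ SchubertC.W n, ∀ v ∈ SchubertC.W n,
      SchubertC.length u + SchubertC.length v = n ^ 2 →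
      SchubertC.scalarProduct n (SchubertC.schubert u) (SchubertC.schubert v) =
        if v = SchubertC.w0 n * u then 1 else 0) :=
  ⟨fun _ hf _ hg => SchubertC.scalarProduct_mem_Theta hf hg,
    fun _ hw => SchubertC.isSingleFamily_schubert.mem_GammaX hw,
    fun _ hu _ hv h => SchubertC.isSingleFamily_schubert.scalarProduct hu hv h⟩
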